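/- **Setting.** Let $\omega=e^{2\pi i/3}$ and $a\in\{i,-i\}$. Consider initial-boundary value problems $\partial_tq+a(-i\partial_x)^3q=0$ on $[0,1]\times[0,T]$, $q(x,0)=q_0(x)$, with three boundary conditions $$A\,\bigl(\partial_x^2q(0,t),\partial_x^2q(1,t),\partial_xq(0,t),\partial_xq(1,t),q(0,t),q(1,t)\bigr)^{\mathsf T}=h(t),$$ where $A\in\mathbb R^{3\times6}$ has rank 3, is in reduced row-echelon form, and is non-Robin: each row involves only one order of $\partial_x$. Let $c_j(\rho)=-a\rho^3(i\rho)^{-(j+1)}$ $(j=0,1,2)$. To the boundary value $\partial_x^jq(0,t)$ assign $C(\rho)=c_j(\rho)$, and to $\partial_x^jq(1,t)$ assign $C(\rho)=-c_j(\rho)e^{-i\rho}$. Let $p_1<p_2<p_3$ be the pivot columns of $A$, $f_1<f_2<f_3$ the other columns, and $C_m$ the function $C$ of the boundary value in column $m$. The PDE characteristic matrix and determinant are $$\mathcal A_{kl}(\rho)=C_{f_l}(\omega^{k-1}\rho)-\sum_{r=1}^3A_{r f_l}\,C_{p_r}(\omega^{k-1}\rho),\qquad \Delta_P=\det\mathcal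 A .$$ For $q_T\in C^\infty[0,1]$ put $\hat q_T(\rho)=\int_0^1e^{-i\rho x}q_T(x)\,dx$; let $\hat\eta_l(\rho)$ be the determinant of $\mathcal A(\rho)$ with its $l$-th column replaced by $(\hat q_T(\rho),\hat q_T(\omega\rho),\hat q_T(\omega^2\rho))^{\mathsf T}$. Define $\eta_1,\dots,\eta_6$ as $c_{j}\hat\eta_l$ ($l=1,2,3$, where $j$ is the order of the derivative in column $f_l$) and $-c_{j}\sum_{l}A_{rf_l}\hat\eta_l$ ($r=1,2,3$, where $j$ is the order of the derivative in column $p_r$). Let $D=\{\rho\in\mathbb C:\operatorname{Re}(a\rho^3)<0\}$ and $E=\{\rho\in\mathbb C:\operatorname{Re}(a\rho^3)>0\}$. * The problem is *well-conditioned* for $a$ if, for every $q_T\in C^\infty[0,1]$ and every $j\in\{1,\dots,6\}$, $\eta_j$ is entire and, for every $\varepsilon>0$, $\eta_j(\rho)/\Delta_P(\rho)\to0$ as $\rho\to\infty$ within $D$ at distance at least $\varepsilon$ from all zeros of $\Delta_P$. * The *zero bound* holds for $a$ if the distinct nonzero zeros $(\sigma_k)$ of $\Delta_P$, listed by nondecreasing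 modulus, satisfy $\operatorname{dist}(\sigma_k,E)=O(k^{-2})$ as $k\to\infty$ (no condition if there are only finitely many). **Classes** (of a matrix $A$). * (I) the zero bound holds for both $a=i$ and $a=-i$; well-conditioned for neither. * (II) the zero bound holds for $a=i$ only; well-conditioned for $a=i$ only. * (III) the zero bound holds for $a=-i$ only; well-conditioned for $a=-i$ only. * (IVa), (IVb), (IVc) well-conditioned for both $a=i$ and $a=-i$; the zero bound holds, respectively, for $a=i$ only, for both, for $a=-i$ only. **Forms** (of $\Delta_P$), where $M(\rho)=m\rho^d$ with $m\in\mathbb C\setminus\{0\}$ and $1\le d\le5$, $X\in\mathbb C$, $Y\in\mathbb R\setminus\{0\}$, $W\in\{-1,0,1\}$. * (I) $\Delta_P(\rho)=M(\rho)$ * (II) $\Delta_P(\rho)=M(\rho)\bigl[X+\sum_{r=0}^2\omega^{Wr}e^{i\omega^r\rho}\bigr]$ * (III) $\Delta_P(\rho)=M(\rho)\bigl[X+\sum_{r=0}^2\omega^{Wr}e^{-i\omega^r\rho}\bigr]$ * (IV) $\Delta_P(\rho)=M(\rho)\bigl[X+\sum_{r=0}^2\omega^{Wr}\bigl(e^{i\omega^r\rho}+Ye^{-i\omega^r\rho}\bigr)\bigr]$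 **Proposition 3.2.** Let $A$ be as above and let $a\in\{i,-i\}$ be the coefficient with which $\Delta_P$ is formed. Then $\Delta_P$ has one of the forms (I)–(IV). It has form (I) if and only if $A$ belongs to class (I), form (II) if and only if $A$ belongs to class (II), form (III) if and only if $A$ belongs to class (III), and form (IV) if and only if $A$ belongs to one of the classes (IVa), (IVb), (IVc). If it has form (IV) with parameter $Y$, then $A$ belongs to (IVa) if and only if $|Y|<1$, to (IVb) if and only if $|Y|=1$, and to (IVc) if and only if $|Y|>1$. In particular, both criteria (well-conditioning and the zero bound) hold in both directions $a=i$ and $a=-i$ exactly when $\Delta_P$ has form (IV) with $|Y|=1$. -/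

import Mathlib

noncomputable section

namespace IBVP

/-- The primitive root `ω = exp (2πi / n)`. -/
def omega (n : ℕ) : ℂ := Complex.exp (2 * Real.pi * Complex.I / n)

/-- The open set `D = {ρ : Re (a ρ ^ n) < 0}`. -/
def D (n : ℕ) (a : ℂ) : Set ℂ := {ρ | (a * ρ ^ n).re < 0}

/-- The open set `E = {ρ : Re (a ρ ^ n) > 0}`. -/
def E (n : ℕ) (a : ℂ) : Set ℂ := {ρ | 0 < (a * ρ ^ n).re}

/-- The transform `q̂(ρ) = ∫₀¹ exp (-iρx) q(x) dx`. -/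
def fourier (q : ℝ → ℂ) (ρ : ℂ) : ℂ :=
  ∫ x in (0 : ℝ)..1, Complex.exp (-Complex.I * ρ * x) * q x

/-- The monomial `c_j(ρ) = -a ρ^n (iρ)^{-(j+1)} = -a ρ^{n-1-j} i^{-(j+1)}`, for `0 ≤ j ≤ n - 1`. -/
def c (n : ℕ) (a : ℂ) (j : ℕ) (ρ : ℂ) : ℂ :=
  -a * ρ ^ (n - 1 - j) * (Complex.I ^ (j + 1))⁻¹

/-- The order of the derivative to which a column of the boundary coefficient matrix belongs.
The columns `0, 1, 2, 3, …, 2n-2, 2n-1` multiply, in this order, the boundary values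
`∂ₓ^{n-1}q(0,t), ∂ₓ^{n-1}q(1,t), ∂ₓ^{n-2}q(0,t), ∂ₓ^{n-2}q(1,t), …, q(0,t), q(1,t)`. -/
def order (n : ℕ) (i : Fin (2 * n)) : ℕ := n - 1 - i.val / 2

/-- The coefficient with which the `t`-transform of the boundary value numbered `i` enters the
global relation `∑ⱼ c_j(ρ) (f_j(ρ) - exp (-iρ) g_j(ρ)) = q̂₀(ρ) - exp (aρⁿT) q̂_T(ρ)`
(`f_j`, `g_j` are the transforms of `∂ₓʲq(0,·)`, `∂ₓʲq(1,·)`). -/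
def globalCoeff (n : ℕ) (a : ℂ) (i : Fin (2 * n)) (ρ : ℂ) : ℂ :=
  c n a (order n i) ρ * (if i.val % 2 = 0 then 1 else -Complex.exp (-Complex.I * ρ))

/-- A real `n × 2n` boundary coefficient matrix `A` of rank `n` in reduced row-echelon form.
`piv r` is the column of the leading `1` of row `r`; `free` lists the other `n` columns in
increasing order.  Both maps are determined by `A`. -/
structure BoundaryConditions (n : ℕ) where
  /-- the boundary coefficient matrix -/
  A : Matrix (Fin n) (Fin (2 * n)) ℝ
  /-- the pivot columns -/
  piv : Fin n → Fin (2 * n)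
  /-- the columns without a pivot -/
  free : Fin n → Fin (2 * n)
  piv_strictMono : StrictMono piv
  free_strictMono : StrictMono free
  piv_ne_free : ∀ r l, piv r ≠ free l
  leading_one : ∀ r, A r (piv r) = 1
  zero_of_lt_piv : ∀ r i, i < piv r → A r i = 0
  zero_of_ne : ∀ r s, s ≠ r → A s (piv r) = 0

namespace BoundaryConditions

variable {n : ℕ}

/-- Non-Robin: each boundary condition contains only one order of partial derivative. -/
def NonRobin (B : BoundaryConditions n) : Prop :=
  ∀ r, ∃ j, ∀ i, B.A r i ≠ 0 → order n i = j

/-- The PDE characteristic matrix: the coefficients of the `n` boundary values without a pivot in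
the global relation at `ρ, ωρ, …, ω^{n-1}ρ`, after the `n` boundary values with a pivot have been
eliminated by the homogeneous boundary conditions. -/
def charMatrix (B : BoundaryConditions n) (a ρ : ℂ) : Matrix (Fin n) (Fin n) ℂ :=
  Matrix.of fun k l =>
    globalCoeff n a (B.free l) (omega n ^ k.val * ρ)
      - ∑ r, (B.A r (B.free l) : ℂ) * globalCoeff n a (B.piv r) (omega n ^ k.val * ρ)

/-- The PDE characteristic determinant `Δ_P`. -/
def charDet (B : BoundaryConditions n) (a ρ : ℂ) : ℂ := (B.charMatrix a ρ).det

/-- The determinant of the PDE characteristic matrix with its `l`-th column replaced by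
`(q̂_T(ρ), q̂_T(ωρ), …, q̂_T(ω^{n-1}ρ))`. -/
def etaHat (B : BoundaryConditions n) (a : ℂ) (qT : ℝ → ℂ) (l : Fin n) (ρ : ℂ) : ℂ :=
  ((B.charMatrix a ρ).updateCol l fun k => fourier qT (omega n ^ k.val * ρ)).det

/-- The `2n` functions `η_j`, one for each boundary value: `η_j / Δ_P` is the part due to `q_T` in
the solution, by Cramer's rule, of the global relation and the homogeneous boundary conditions
for the transformed boundary value times its monomial `c`.  The left summand lists the boundary
values without a pivot, the right summand those with a pivot, which the boundary conditions express
through the former. -/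
def eta (B : BoundaryConditions n) (a : ℂ) (qT : ℝ → ℂ) : Fin n ⊕ Fin n → ℂ → ℂ
  | .inl l, ρ => c n a (order n (B.free l)) ρ * B.etaHat a qT l ρ
  | .inr r, ρ => c n a (order n (B.piv r)) ρ *
      -∑ l, (B.A r (B.free l) : ℂ) * B.etaHat a qT l ρ

/-- The points whose distance from every zero of `Δ_P` is at least `ε`. -/
def awayFromZeros (B : BoundaryConditions n) (a : ℂ) (ε : ℝ) : Set ℂ :=
  {ρ | ∀ σ, B.charDet a σ = 0 → ε ≤ dist ρ σ}

/-- Well-conditioned: whatever the smooth final function `q_T` on `[0,1]`, each `η_j` is entire and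
`η_j(ρ) / Δ_P(ρ) → 0` as `ρ → ∞` from within `D`, away from the zeros of `Δ_P`. -/
def WellConditioned (B : BoundaryConditions n) (a : ℂ) : Prop :=
  ∀ qT : ℝ → ℂ, ContDiffOn ℝ (⊤ : ℕ∞) qT (Set.Icc 0 1) → ∀ j,
    Differentiable ℂ (B.eta a qT j) ∧
    ∀ ε : ℝ, 0 < ε →
      Filter.Tendsto (fun ρ => B.eta a qT j ρ / B.charDet a ρ)
        (Bornology.cobounded ℂ ⊓ Filter.principal (D n a ∩ B.awayFromZeros a ε)) (nhds 0)

/-- `σ` lists the nonzero zeros of `Δ_P`, each once, in order of nondecreasing modulus. -/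
def EnumeratesZeros (B : BoundaryConditions n) (a : ℂ) (σ : ℕ → ℂ) : Prop :=
  Function.Injective σ ∧ Set.range σ = {ρ | ρ ≠ 0 ∧ B.charDet a ρ = 0} ∧ Monotone fun k => ‖σ k‖

/-- The zero bound: `dist(σ_k, E) = O(k^{-(n-1)})` for the nonzero zeros `σ_k` of `Δ_P` (no
condition if there are only finitely many). -/
def ZeroBound (B : BoundaryConditions n) (a : ℂ) : Prop :=
  ∀ σ : ℕ → ℂ, B.EnumeratesZeros a σ →
    (fun k => Metric.infDist (σ k) (E n a)) =O[Filter.atTop] fun k => ((k : ℝ) ^ (n - 1))⁻¹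

/-! ### The classes: what holds for `a = i` and for `a = -i` -/

/-- Class (I). -/
def ClassI (B : BoundaryConditions n) : Prop :=
  (B.ZeroBound Complex.I ∧ B.ZeroBound (-Complex.I)) ∧
    (¬ B.WellConditioned Complex.I ∧ ¬ B.WellConditioned (-Complex.I))

/-- Class (II). -/
def ClassII (B : BoundaryConditions n) : Prop :=
  (B.ZeroBound Complex.I ∧ ¬ B.ZeroBound (-Complex.I)) ∧
    (B.WellConditioned Complex.I ∧ ¬ B.WellConditioned (-Complex.I))

/-- Class (III). -/
def ClassIII (B : BoundaryConditions n) : Prop :=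
  (¬ B.ZeroBound Complex.I ∧ B.ZeroBound (-Complex.I)) ∧
    (¬ B.WellConditioned Complex.I ∧ B.WellConditioned (-Complex.I))

/-- Class (IVa). -/
def ClassIVa (B : BoundaryConditions n) : Prop :=
  (B.ZeroBound Complex.I ∧ ¬ B.ZeroBound (-Complex.I)) ∧
    (B.WellConditioned Complex.I ∧ B.WellConditioned (-Complex.I))

/-- Class (IVb). -/
def ClassIVb (B : BoundaryConditions n) : Prop :=
  (B.ZeroBound Complex.I ∧ B.ZeroBound (-Complex.I)) ∧
    (B.WellConditioned Complex.I ∧ B.WellConditioned (-Complex.I))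

/-- Class (IVc). -/
def ClassIVc (B : BoundaryConditions n) : Prop :=
  (¬ B.ZeroBound Complex.I ∧ B.ZeroBound (-Complex.I)) ∧
    (B.WellConditioned Complex.I ∧ B.WellConditioned (-Complex.I))

end BoundaryConditions

/-! ### The forms of `Δ_P` for `n = 3` -/

/-- A (nonzero) monomial of degree between `1` and `5`. -/
def IsMonomial (M : ℂ → ℂ) : Prop :=
  ∃ m : ℂ, m ≠ 0 ∧ ∃ d : ℕ, 1 ≤ d ∧ d ≤ 5 ∧ ∀ ρ, M ρ = m * ρ ^ d

/-- Form (I). -/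
def FormI (Δ : ℂ → ℂ) : Prop := ∃ M, IsMonomial M ∧ ∀ ρ, Δ ρ = M ρ

/-- Form (II). -/
def FormII (Δ : ℂ → ℂ) : Prop :=
  ∃ M, IsMonomial M ∧ ∃ X : ℂ, ∃ W : ℤ, (W = -1 ∨ W = 0 ∨ W = 1) ∧
    ∀ ρ, Δ ρ = M ρ * (X + ∑ r ∈ Finset.range 3,
      omega 3 ^ (W * (r : ℤ)) * Complex.exp (Complex.I * omega 3 ^ r * ρ))

/-- Form (III). -/
def FormIII (Δ : ℂ → ℂ) : Prop :=
  ∃ M, IsMonomial M ∧ ∃ X : ℂ, ∃ W : ℤ, (W = -1 ∨ W = 0 ∨ W = 1) ∧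
    ∀ ρ, Δ ρ = M ρ * (X + ∑ r ∈ Finset.range 3,
      omega 3 ^ (W * (r : ℤ)) * Complex.exp (-Complex.I * omega 3 ^ r * ρ))

/-- Form (IV) with the real parameter `Y ≠ 0`. -/
def FormIV (Δ : ℂ → ℂ) (Y : ℝ) : Prop :=
  Y ≠ 0 ∧ ∃ M, IsMonomial M ∧ ∃ X : ℂ, ∃ W : ℤ, (W = -1 ∨ W = 0 ∨ W = 1) ∧
    ∀ ρ, Δ ρ = M ρ * (X + ∑ r ∈ Finset.range 3,
      omega 3 ^ (W * (r : ℤ)) * (Complex.exp (Complex.I * omega 3 ^ r * ρ) +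
        (Y : ℂ) * Complex.exp (-Complex.I * omega 3 ^ r * ρ)))

end IBVP

end

/-!
The conditions of one order of the derivative involve only the two boundary values of that order, so
the `l`-th column of the characteristic matrix is a monomial in `ρ` times the column with the entries
`ω^(k p_l) (x_l exp (-iωᵏρ) + y_l)`, where `x_l`, `y_l` are real (`charMatrix_eq`). As the product of
the three exponentials `exp (iωᵏρ)` is `1`, the determinant is a monomial times
`X + ∑ₖ ηᵏ (Z exp (iωᵏρ) + Y exp (-iωᵏρ))` with a cube root of unity `η` (`det_colMatrix`). Here `Z`
and `Y` are imaginary, which makes their quotient real, and if both vanish then `X` does not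
(`zeroCoeff_ne_zero`). The forms (I)-(IV) say which of `Z`, `Y` vanish, and the parameter of form (IV)
is `Y / Z`; comparing the growth along the two imaginary half-axes shows that these data are
determined by the function `Δ_P`.

So are the classes, by the following two equivalences for `a = i`. For `a = -i` the roles of `Z` and
`Y` are exchanged, by the reflection `x ↦ 1 - x`, `ρ ↦ -ρ`.

*Well-conditioning holds if and only if `Z ≠ 0`* (`wellConditioned_iff`). The monomials cancel in
`η_j / Δ_P`, which is the solution, by Cramer's rule, of a linear system with the matrix just
described. In the sector of `D` where `Im ωρ` and `Im ω²ρ` are positive, the rows have the sizes `1`,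
`|exp (-iωρ)|`, `|exp (-iω²ρ)|`, and an integration by parts shows that the numerator is smaller than
their product by a factor `1 / |ρ|`. The product is the size of the term `Z exp (iρ)`, which is also
the size of the determinant away from its zeros, if `Z ≠ 0`. Conversely `Z` is the determinant of the
matrix of the dominant parts of the rows. If it vanishes, then a combination of the rows is
exponentially small along a ray in the sector, and a bounded solution would force the same
combination of the transforms of every smooth function to be exponentially small too, which fails for
`1`, `1 - x` or `x - x²`.

*The zero bound holds if and only if `|Y| ≤ |Z|`* (`zeroBound_iff`). If `|Y| ≤ |Z|` and `Z ≠ 0`, the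
large zeros outside `E` are exponentially close to the boundary of `E`, and as there are only `O(R)`
zeros in the disc of radius `R` this is more than enough. If `|Z| < |Y|`, there are infinitely many
zeros in `D` at a positive distance from `E`, near the explicit zeros of the sum of the two dominant
exponentials. Zeros are found by the minimum modulus principle (`exists_delta_zero_near`), which also
gives the lower bound for the determinant away from its zeros.
-/

noncomputable section

namespace IBVP

open Filter Topology

/-! ### The cube root of unity and the three heights -/

theorem omega_three : omega 3 = -1 / 2 + (Real.sqrt 3 / 2 : ℝ) * Complex.I := by
  have h : (2 * Real.pi * Complex.I / ((3 : ℕ) : ℂ)) = ((Real.pi - Real.pi / 3 : ℝ) : ℂ) * Complex.I := by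
    push_cast; ring
  rw [omega, h, Complex.exp_mul_I, ← Complex.ofReal_cos, ← Complex.ofReal_sin, Real.cos_pi_sub,
    Real.sin_pi_sub, Real.cos_pi_div_three, Real.sin_pi_div_three]
  push_cast; ring

theorem omega_re : (omega 3).re = -1 / 2 := by
  simp [omega_three]

theorem omega_im : (omega 3).im = Real.sqrt 3 / 2 := by
  simp [omega_three]

theorem sqrt_three_sq : Real.sqrt 3 * Real.sqrt 3 = 3 := Real.mul_self_sqrt (by norm_num)

theorem omega_quadratic : omega 3 ^ 2 + omega 3 + 1 = 0 := by
  apply Complex.ext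
  · simp [pow_two, omega_re, omega_im]; linarith [sqrt_three_sq]
  · simp [pow_two, omega_re, omega_im]; ring

theorem omega_cube : omega 3 ^ 3 = 1 := by
  linear_combination (omega 3 - 1) * omega_quadratic

theorem norm_omega : ‖omega 3‖ = 1 :=
  Complex.norm_eq_one_of_pow_eq_one omega_cube (by norm_num)

theorem omega_ne_zero : omega 3 ≠ 0 := by
  intro h; have := norm_omega; simp [h] at this

/-- The three heights `Im (ω ^ k ρ)`: their signs decide in which sector `ρ` lies, and they give the
moduli of the exponentials `exp (± i ω ^ k ρ)`. -/
def height (k : ℕ) (ρ : ℂ) : ℝ := (omega 3 ^ k * ρ).im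

theorem height_zero (ρ : ℂ) : height 0 ρ = ρ.im := by simp [height]

theorem height_one (ρ : ℂ) : height 1 ρ = (Real.sqrt 3 * ρ.re - ρ.im) / 2 := by
  simp [height, omega_re, omega_im]; ring

theorem height_two (ρ : ℂ) : height 2 ρ = (-Real.sqrt 3 * ρ.re - ρ.im) / 2 := by
  simp [height, omega_re, omega_im, pow_two]; linear_combination (-ρ.im / 4) * sqrt_three_sq

theorem height_sum (ρ : ℂ) : height 0 ρ + height 1 ρ + height 2 ρ = 0 := by
  rw [height_zero, height_one, height_two]; ring

theorem height_neg (k : ℕ) (ρ : ℂ) : height k (-ρ) = -height k ρ := by simp [height]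

theorem height_sub (k : ℕ) (ρ σ : ℂ) : height k (ρ - σ) = height k ρ - height k σ := by
  simp [height, mul_sub]

theorem height_omega_mul (k : ℕ) (ρ : ℂ) : height k (omega 3 * ρ) = height (k + 1) ρ := by
  simp only [height]; ring_nf

theorem height_add_three (k : ℕ) (ρ : ℂ) : height (k + 3) ρ = height k ρ := by
  simp only [height, pow_add, omega_cube, mul_one]

theorem abs_height_le (k : ℕ) (ρ : ℂ) : |height k ρ| ≤ ‖ρ‖ := by
  have := Complex.abs_im_le_norm (omega 3 ^ k * ρ)
  rwa [norm_mul, norm_pow, norm_omega, one_pow, one_mul] at this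

theorem abs_height_sub_le (k : ℕ) (ρ σ : ℂ) : |height k ρ - height k σ| ≤ dist ρ σ := by
  rw [← height_sub, dist_eq_norm]; exact abs_height_le k _

theorem sum_height_sq (ρ : ℂ) :
    height 0 ρ ^ 2 + height 1 ρ ^ 2 + height 2 ρ ^ 2 = 3 / 2 * ‖ρ‖ ^ 2 := by
  rw [height_zero, height_one, height_two, Complex.sq_norm, Complex.normSq_apply]
  linear_combination (ρ.re ^ 2 / 2) * sqrt_three_sq

theorem cube_im (ρ : ℂ) : (ρ ^ 3).im = -4 * (height 0 ρ * height 1 ρ * height 2 ρ) := by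
  rw [height_zero, height_one, height_two]
  simp [pow_succ]
  linear_combination (-ρ.im * ρ.re ^ 2) * sqrt_three_sq

theorem mem_D_I (ρ : ℂ) :
    ρ ∈ D 3 Complex.I ↔ height 0 ρ * height 1 ρ * height 2 ρ < 0 := by
  have h : (Complex.I * ρ ^ 3).re = 4 * (height 0 ρ * height 1 ρ * height 2 ρ) := by
    rw [Complex.I_mul_re, cube_im]; ring
  simp only [D, Set.mem_ofPred_eq, h]
  constructor <;> intro h <;> linarith

theorem mem_E_I (ρ : ℂ) :
    ρ ∈ E 3 Complex.I ↔ 0 < height 0 ρ * height 1 ρ * height 2 ρ := by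
  have h : (Complex.I * ρ ^ 3).re = 4 * (height 0 ρ * height 1 ρ * height 2 ρ) := by
    rw [Complex.I_mul_re, cube_im]; ring
  simp only [E, Set.mem_ofPred_eq, h]
  constructor <;> intro h <;> linarith

/-- The closure of `D` for `a = i` is the union of the three rotations of one closed sector. -/
theorem exists_rotation_of_nonpos {ρ : ℂ} (h : height 0 ρ * height 1 ρ * height 2 ρ ≤ 0) :
    ∃ k, 0 ≤ height 1 (omega 3 ^ k * ρ) ∧ 0 ≤ height 2 (omega 3 ^ k * ρ) := by
  have h3 := height_add_three 0 ρ
  have h4 := height_add_three 1 ρ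
  have hs := height_sum ρ
  have e1 : ∀ k, height k (omega 3 ^ 1 * ρ) = height (k + 1) ρ := fun k => by
    rw [pow_one, height_omega_mul]
  have e2 : ∀ k, height k (omega 3 ^ 2 * ρ) = height (k + 2) ρ := fun k => by
    rw [pow_two, mul_assoc, height_omega_mul, height_omega_mul]
  norm_num at h3 h4
  by_cases h12 : 0 ≤ height 1 ρ ∧ 0 ≤ height 2 ρ
  · exact ⟨0, by simpa using h12⟩
  by_cases h20 : 0 ≤ height 2 ρ ∧ 0 ≤ height 0 ρ
  · exact ⟨1, by rw [e1, e1]; norm_num [h3]; exact h20⟩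
  by_cases h01 : 0 ≤ height 0 ρ ∧ 0 ≤ height 1 ρ
  · exact ⟨2, by rw [e2, e2]; norm_num [h3, h4]; exact h01⟩
  exfalso
  -- otherwise two of the heights are negative, and as their sum vanishes the third is positive
  rcases lt_or_ge (height 0 ρ) 0 with a0 | a0 <;> rcases lt_or_ge (height 1 ρ) 0 with a1 | a1 <;>
    rcases lt_or_ge (height 2 ρ) 0 with a2 | a2
  · linarith
  · have := mul_pos_of_neg_of_neg a0 a1
    nlinarith
  · have := mul_pos_of_neg_of_neg a0 a2
    nlinarith
  · exact h12 ⟨a1, a2⟩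
  · have := mul_pos_of_neg_of_neg a1 a2
    nlinarith
  · exact h20 ⟨a2, a0⟩
  · exact h01 ⟨a0, a1⟩
  · exact h12 ⟨a1, a2⟩

/-- In the closed sector where `Im ωρ` and `Im ω²ρ` are nonnegative, their sum `-Im ρ` is comparable
to `|ρ|`. -/
theorem norm_le_height_add {ρ : ℂ} (h1 : 0 ≤ height 1 ρ) (h2 : 0 ≤ height 2 ρ) :
    4 / 5 * ‖ρ‖ ≤ height 1 ρ + height 2 ρ := by
  have hs := height_sum ρ
  have hq := sum_height_sq ρ
  have h0 : height 0 ρ = -(height 1 ρ + height 2 ρ) := by linarith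
  rw [h0] at hq
  have := mul_nonneg h1 h2
  refine (abs_le_of_sq_le_sq' ?_ (add_nonneg h1 h2)).2
  nlinarith [sq_nonneg ‖ρ‖]

/-! ### Exponentials along the three directions -/

/-- The exponential `exp (i ω ^ k ρ)`. -/
def wave (k : ℕ) (ρ : ℂ) : ℂ := Complex.exp (Complex.I * omega 3 ^ k * ρ)

theorem wave_ne_zero (k : ℕ) (ρ : ℂ) : wave k ρ ≠ 0 := Complex.exp_ne_zero _

theorem norm_wave (k : ℕ) (ρ : ℂ) : ‖wave k ρ‖ = Real.exp (-height k ρ) := by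
  rw [wave, Complex.norm_exp, mul_assoc, Complex.I_mul_re, height]

theorem wave_neg (k : ℕ) (ρ : ℂ) : wave k (-ρ) = (wave k ρ)⁻¹ := by
  rw [wave, wave, ← Complex.exp_neg]; ring_nf

theorem wave_mul_neg (k : ℕ) (ρ : ℂ) : wave k ρ * wave k (-ρ) = 1 := by
  rw [wave_neg, mul_inv_cancel₀ (wave_ne_zero k ρ)]

theorem wave_prod (ρ : ℂ) : wave 0 ρ * wave 1 ρ * wave 2 ρ = 1 := by
  rw [wave, wave, wave, ← Complex.exp_add, ← Complex.exp_add, ← Complex.exp_zero]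
  congr 1
  linear_combination Complex.I * ρ * omega_quadratic

theorem wave_omega_mul (k : ℕ) (ρ : ℂ) : wave k (omega 3 * ρ) = wave (k + 1) ρ := by
  simp only [wave]; ring_nf

theorem wave_add_three (k : ℕ) (ρ : ℂ) : wave (k + 3) ρ = wave k ρ := by
  simp only [wave, pow_add, omega_cube, mul_one]

theorem differentiable_wave (k : ℕ) : Differentiable ℂ (wave k) := by
  unfold wave; fun_prop

theorem norm_wave_le_of_dist {k : ℕ} {ρ w : ℂ} (h : dist w ρ ≤ 1 / 2) :
    ‖wave k w‖ ≤ 2 * Real.exp (-height k ρ) := by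
  have h1 := (abs_le.1 ((abs_height_sub_le k w ρ).trans h)).1
  have h2 : Real.exp (1 / 2) ≤ 2 := by
    have h3 : Real.exp (1 / 2) ^ 2 = Real.exp 1 := by rw [← Real.exp_nat_mul]; norm_num
    nlinarith [Real.exp_one_lt_d9, Real.exp_pos (1 / 2)]
  rw [norm_wave]
  calc Real.exp (-height k w) ≤ Real.exp (1 / 2 + -height k ρ) := Real.exp_le_exp.2 (by linarith)
    _ = Real.exp (1 / 2) * Real.exp (-height k ρ) := Real.exp_add _ _
    _ ≤ _ := by gcongr

/-- The exponential sum `X + ∑ₖ ηᵏ (Z exp (i ωᵏ ρ) + Y exp (-i ωᵏ ρ))`, which is `Δ_P` up to a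
monomial factor. -/
def expSum (X Z Y η ρ : ℂ) : ℂ :=
  X + ∑ k ∈ Finset.range 3, η ^ k * (Z * wave k ρ + Y * wave k (-ρ))

theorem expSum_neg (X Z Y η ρ : ℂ) : expSum X Z Y η (-ρ) = expSum X Y Z η ρ := by
  simp only [expSum, neg_neg, add_comm]

theorem expSum_omega_mul {X η : ℂ} (hη : η ^ 3 = 1) (hX : X * η = X) (Z Y ρ : ℂ) :
    η * expSum X Z Y η (omega 3 * ρ) = expSum X Z Y η ρ := by
  have e : -(omega 3 * ρ) = omega 3 * -ρ := by ring
  have h3 := wave_add_three 0 ρ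
  have h3' := wave_add_three 0 (-ρ)
  norm_num at h3 h3'
  simp only [expSum, Finset.sum_range_succ, Finset.sum_range_zero, e, wave_omega_mul]
  norm_num [h3, h3']
  linear_combination hX + (Z * wave 0 ρ + Y * wave 0 (-ρ)) * hη

theorem differentiable_expSum (X Z Y η : ℂ) : Differentiable ℂ (expSum X Z Y η) := by
  have := differentiable_wave
  have h2 : ∀ k, Differentiable ℂ fun ρ => wave k (-ρ) := fun k => (this k).comp differentiable_neg
  unfold expSum
  fun_prop

theorem norm_eta {η : ℂ} (hη : η ^ 3 = 1) : ‖η‖ = 1 :=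
  Complex.norm_eq_one_of_pow_eq_one hη (by norm_num)

/-- Divided by its dominant exponential, the exponential sum is, in the closed sector where
`exp (iωρ)` and `exp (iω²ρ)` are bounded, a function of a single exponential up to a small error. -/
theorem norm_expSum_mul_sub_le {η : ℂ} (hη : η ^ 3 = 1) (X Z Y : ℂ) {w : ℂ} (h1 : ‖wave 1 w‖ ≤ 2)
    (h2 : ‖wave 2 w‖ ≤ 2) :
    ‖expSum X Z Y η w * wave 0 (-w) - (Z + η * Y * wave 2 w)‖ ≤
        (2 * ‖X‖ + 8 * ‖Z‖ + 9 * ‖Y‖) * ‖wave 1 w‖ ∧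
    ‖expSum X Z Y η w * wave 0 (-w) - (Z + η ^ 2 * Y * wave 1 w)‖ ≤
        (2 * ‖X‖ + 8 * ‖Z‖ + 9 * ‖Y‖) * ‖wave 2 w‖ := by
  have e0 : wave 0 (-w) = wave 1 w * wave 2 w := by
    rw [wave_neg]
    refine inv_eq_of_mul_eq_one_right ?_
    rw [← mul_assoc, wave_prod]
  have hg : expSum X Z Y η w * wave 0 (-w) = Z + η * Y * wave 2 w + η ^ 2 * Y * wave 1 w +
      wave 1 w * wave 2 w * (X + η * Z * wave 1 w + η ^ 2 * Z * wave 2 w +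
        Y * (wave 1 w * wave 2 w)) := by
    have a0 : wave 0 w * (wave 1 w * wave 2 w) = 1 := by rw [← mul_assoc, wave_prod]
    have a1 := wave_mul_neg 1 w
    have a2 := wave_mul_neg 2 w
    simp only [expSum, Finset.sum_range_succ, Finset.sum_range_zero, e0]
    linear_combination Z * a0 + η * Y * wave 2 w * a1 + η ^ 2 * Y * wave 1 w * a2
  have hn := norm_eta hη
  set u := wave 1 w
  set v := wave 2 w
  have hu := norm_nonneg u
  have hv := norm_nonneg v
  have hb : ‖X + η * Z * u + η ^ 2 * Z * v + Y * (u * v)‖ ≤ ‖X‖ + 4 * ‖Z‖ + 4 * ‖Y‖ := by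
    have i1 : ‖η * Z * u‖ ≤ 2 * ‖Z‖ := by
      rw [norm_mul, norm_mul, hn]; nlinarith [norm_nonneg Z]
    have i2 : ‖η ^ 2 * Z * v‖ ≤ 2 * ‖Z‖ := by
      rw [norm_mul, norm_mul, norm_pow, hn]; nlinarith [norm_nonneg Z]
    have i3 : ‖Y * (u * v)‖ ≤ 4 * ‖Y‖ := by
      rw [norm_mul, norm_mul]
      have : ‖u‖ * ‖v‖ ≤ 2 * 2 := by gcongr
      nlinarith [norm_nonneg Y]
    calc _ ≤ ‖X‖ + ‖η * Z * u‖ + ‖η ^ 2 * Z * v‖ + ‖Y * (u * v)‖ := by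
          refine (norm_add_le _ _).trans ?_
          gcongr
          refine (norm_add_le _ _).trans ?_
          gcongr
          exact norm_add_le _ _
      _ ≤ _ := by linarith
  rw [hg]
  have key : ∀ θ s t : ℂ, ‖θ‖ = 1 → ‖t‖ ≤ 2 →
      ‖θ * Y * s + s * t * (X + η * Z * u + η ^ 2 * Z * v + Y * (u * v))‖ ≤
        (2 * ‖X‖ + 8 * ‖Z‖ + 9 * ‖Y‖) * ‖s‖ := by
    intro θ s t hθ ht
    refine (norm_add_le _ _).trans ?_
    rw [norm_mul (s * t), norm_mul, norm_mul, norm_mul, hθ]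
    have : ‖s‖ * ‖t‖ * ‖X + η * Z * u + η ^ 2 * Z * v + Y * (u * v)‖ ≤
        ‖s‖ * 2 * (‖X‖ + 4 * ‖Z‖ + 4 * ‖Y‖) := by gcongr
    linarith
  constructor
  · convert key (η ^ 2) u v (by rw [norm_pow, hn, one_pow]) h2 using 2; ring
  · convert key η v u hn h1 using 2; ring

/-! ### Zeros of perturbed exponentials -/

/-- The minimum modulus principle, in the form used to produce zeros: a function which is smaller at
the centre of a disc than on the whole boundary has a zero in the disc. -/
theorem exists_zero_of_lt_norm_sphere {g : ℂ → ℂ} (hg : Differentiable ℂ g) {ρ : ℂ} {r m : ℝ}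
    (hr : 0 < r) (h0 : ‖g ρ‖ < m) (hs : ∀ w, dist w ρ = r → m ≤ ‖g w‖) :
    ∃ σ, dist σ ρ < r ∧ g σ = 0 := by
  by_contra! h
  have hne : ∀ w ∈ Metric.closedBall ρ r, g w ≠ 0 := by
    intro w hw h'
    rcases (Metric.mem_closedBall.1 hw).lt_or_eq with h1 | h1
    · exact h w h1 h'
    · have := hs w h1
      rw [h', norm_zero] at this
      linarith [norm_nonneg (g ρ)]
  have hm : 0 < m := (norm_nonneg _).trans_lt h0
  have := Complex.norm_le_of_forall_mem_frontier_norm_le (f := fun w => (g w)⁻¹)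
    (U := Metric.ball ρ r) (C := m⁻¹) Metric.isBounded_ball
    (by
      apply DifferentiableOn.diffContOnCl
      rw [closure_ball _ hr.ne']
      exact hg.differentiableOn.inv hne)
    (by
      intro w hw
      rw [frontier_ball _ hr.ne'] at hw
      rw [norm_inv]
      exact inv_anti₀ hm (hs w hw))
    (z := ρ) (subset_closure (Metric.mem_ball_self hr))
  rw [norm_inv, inv_le_inv₀ (norm_pos_iff.2 (hne ρ (Metric.mem_closedBall_self hr.le))) hm] at this
  linarith

/-- A small value of a slight perturbation of `A + B exp (iκρ)` forces a zero nearby, uniformly in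
the position: translating by `z` changes the value of the unperturbed function by
`(exp (iκz) - 1)` times `h - A`, where `h` is its small value. -/
theorem exists_delta_zero_near {A κ : ℂ} (hA : A ≠ 0) (B : ℂ) (hκ : κ ≠ 0) {r : ℝ} (hr : 0 < r)
    (hr' : ‖κ‖ * r ≤ 1 / 2) :
    ∃ δ > 0, ∀ g : ℂ → ℂ, Differentiable ℂ g → ∀ ρ,
      (∀ w, dist w ρ ≤ r → ‖g w - (A + B * Complex.exp (Complex.I * κ * w))‖ ≤ δ) →
      ‖g ρ‖ < δ → ∃ σ, dist σ ρ < r ∧ g σ = 0 := by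
  have hκ' := norm_pos_iff.2 hκ
  have hA' := norm_pos_iff.2 hA
  refine ⟨‖A‖ * ‖κ‖ * r / 16, by positivity, fun g hg ρ hw h0 => ?_⟩
  refine exists_zero_of_lt_norm_sphere hg hr h0 fun w hd => ?_
  set δ := ‖A‖ * ‖κ‖ * r / 16 with hδ
  set z : ℂ := Complex.I * κ * (w - ρ) with hz
  have hzn : ‖z‖ = ‖κ‖ * r := by
    rw [hz, norm_mul, norm_mul, Complex.norm_I, one_mul, ← dist_eq_norm, hd]
  have e1 : A + B * Complex.exp (Complex.I * κ * w) =
      -A * (Complex.exp z - 1) + (A + B * Complex.exp (Complex.I * κ * ρ)) * Complex.exp z := by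
    have : Complex.I * κ * w = Complex.I * κ * ρ + z := by rw [hz]; ring
    rw [this, Complex.exp_add]; ring
  have e2 : ‖Complex.exp z - 1‖ ≥ ‖κ‖ * r / 2 := by
    have h1 := Complex.norm_exp_sub_one_sub_id_le (x := z) (by linarith)
    have h2 := norm_sub_norm_le z (-(Complex.exp z - 1 - z))
    rw [norm_neg] at h2
    have : z - -(Complex.exp z - 1 - z) = Complex.exp z - 1 := by ring
    rw [this] at h2
    have h4 : ‖z‖ ^ 2 ≤ ‖κ‖ * r / 2 := by rw [hzn]; nlinarith [mul_pos hκ' hr]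
    linarith
  have e3 : ‖Complex.exp z‖ ≤ 2 := by
    have h1 := Complex.norm_exp_sub_one_le (x := z) (by linarith)
    have h2 := norm_add_le (Complex.exp z - 1) 1
    simp only [sub_add_cancel, norm_one] at h2
    linarith
  have e4 : ‖A + B * Complex.exp (Complex.I * κ * ρ)‖ ≤ 2 * δ := by
    have h1 := hw ρ (by simpa using hr.le)
    have h2 := norm_sub_norm_le (A + B * Complex.exp (Complex.I * κ * ρ)) (g ρ)
    rw [norm_sub_rev] at h2
    linarith
  have e5 : ‖A + B * Complex.exp (Complex.I * κ * w)‖ ≥ 4 * δ := by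
    rw [e1]
    have h1 := norm_sub_norm_le (-A * (Complex.exp z - 1))
      (-((A + B * Complex.exp (Complex.I * κ * ρ)) * Complex.exp z))
    rw [sub_neg_eq_add, norm_neg, norm_mul, norm_mul, norm_neg] at h1
    have h2 : ‖A + B * Complex.exp (Complex.I * κ * ρ)‖ * ‖Complex.exp z‖ ≤ 2 * δ * 2 := by gcongr
    have h3 : ‖A‖ * ‖Complex.exp z - 1‖ ≥ ‖A‖ * (‖κ‖ * r / 2) := by gcongr
    have h4 : ‖A‖ * (‖κ‖ * r / 2) = 8 * δ := by rw [hδ]; ring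
    linarith
  have h1 := hw w hd.le
  have h2 := norm_sub_norm_le (A + B * Complex.exp (Complex.I * κ * w)) (g w)
  rw [norm_sub_rev] at h2
  have hδ0 : 0 < δ := by positivity
  linarith

/-! ### Size and zeros of the exponential sums -/

theorem exists_exp_le (K : ℝ) {c δ : ℝ} (hc : 0 < c) (hδ : 0 < δ) :
    ∃ R, ∀ t, R ≤ t → K * Real.exp (-(c * t)) ≤ δ := by
  have h : Tendsto (fun t : ℝ => K * Real.exp (-(c * t))) atTop (𝓝 (K * 0)) :=
    (Real.tendsto_exp_neg_atTop_nhds_zero.comp (tendsto_id.const_mul_atTop hc)).const_mul K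
  rw [mul_zero] at h
  exact eventually_atTop.1 (h.eventually_le_const hδ)

theorem wave_one_eq (w : ℂ) : wave 1 w = Complex.exp (Complex.I * omega 3 * w) := by
  rw [wave, pow_one]

theorem norm_wave_zero_neg (w : ℂ) : ‖wave 0 (-w)‖ = ‖wave 0 w‖⁻¹ := by
  rw [wave_neg, norm_inv]

theorem differentiable_expSum_mul_wave (X Z Y η : ℂ) :
    Differentiable ℂ fun w => expSum X Z Y η w * wave 0 (-w) :=
  (differentiable_expSum X Z Y η).mul ((differentiable_wave 0).comp differentiable_neg)

/-- In the closed sector where `exp (iρ)` is the largest of the exponentials `exp (iωᵏρ)`, and away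
from its zeros, the exponential sum is as large as this term, if it occurs. On the boundary of the
sector another exponential has the same size; there the absence of zeros nearby is what excludes
cancellation. -/
theorem exists_lower_bound_sector {Z η : ℂ} (hη : η ^ 3 = 1) (hZ : Z ≠ 0) (X Y : ℂ) {ε : ℝ}
    (hε : 0 < ε) :
    ∃ R, ∃ δ > 0, ∀ ρ, 0 ≤ height 1 ρ → 0 ≤ height 2 ρ → R ≤ ‖ρ‖ →
      (∀ σ, expSum X Z Y η σ = 0 → ε ≤ dist ρ σ) → δ * ‖wave 0 ρ‖ ≤ ‖expSum X Z Y η ρ‖ := by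
  have hr : 0 < min ε (1 / 2) := by positivity
  have hr' : min ε (1 / 2) ≤ 1 / 2 := min_le_right _ _
  have hω2 : ‖omega 3 ^ 2‖ = 1 := by rw [norm_pow, norm_omega, one_pow]
  obtain ⟨δ₁, hδ₁, H₁⟩ := exists_delta_zero_near hZ (η * Y) (pow_ne_zero 2 omega_ne_zero) hr
    (by rw [hω2, one_mul]; exact hr')
  obtain ⟨δ₂, hδ₂, H₂⟩ := exists_delta_zero_near hZ (η ^ 2 * Y) omega_ne_zero hr
    (by rw [norm_omega, one_mul]; exact hr')
  set K := 2 * ‖X‖ + 8 * ‖Z‖ + 9 * ‖Y‖ with hK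
  have hK0 : 0 ≤ K := by positivity
  obtain ⟨R, hR⟩ := exists_exp_le (K * 2) (c := 2 / 5) (by norm_num) (lt_min hδ₁ hδ₂)
  refine ⟨R, min δ₁ δ₂, lt_min hδ₁ hδ₂, fun ρ h1 h2 hρ hz => ?_⟩
  have hd := hR _ hρ
  have hsum := norm_le_height_add h1 h2
  have hw0 : 0 < ‖wave 0 ρ‖ := norm_pos_iff.2 (wave_ne_zero _ _)
  suffices h : min δ₁ δ₂ ≤ ‖expSum X Z Y η ρ * wave 0 (-ρ)‖ by
    rw [norm_mul, norm_wave_zero_neg, ← div_eq_mul_inv, le_div_iff₀ hw0] at h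
    exact h
  by_contra! hlt
  have hno : ¬ ∃ σ, dist σ ρ < min ε (1 / 2) ∧ expSum X Z Y η σ * wave 0 (-σ) = 0 := by
    rintro ⟨σ, hσ, h0⟩
    have := hz σ ((mul_eq_zero.1 h0).resolve_right (wave_ne_zero _ _))
    rw [dist_comm] at this
    linarith [min_le_left ε (1 / 2)]
  have hb : ∀ {k w}, 0 ≤ height k ρ → dist w ρ ≤ min ε (1 / 2) → ‖wave k w‖ ≤ 2 := by
    intro k w hk hw
    refine (norm_wave_le_of_dist (hw.trans hr')).trans ?_
    have : Real.exp (-height k ρ) ≤ 1 := Real.exp_le_one_iff.2 (by linarith)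
    linarith
  have hs : ∀ {k w}, 2 / 5 * ‖ρ‖ ≤ height k ρ → dist w ρ ≤ min ε (1 / 2) →
      K * ‖wave k w‖ ≤ min δ₁ δ₂ := by
    intro k w hk hw
    refine le_trans ?_ hd
    rw [mul_assoc]
    gcongr
    refine (norm_wave_le_of_dist (hw.trans hr')).trans ?_
    gcongr
  rcases le_total (height 2 ρ) (height 1 ρ) with h | h
  · refine hno (H₁ _ (differentiable_expSum_mul_wave X Z Y η) ρ (fun w hw => ?_)
      (hlt.trans_le (min_le_left _ _)))
    exact ((norm_expSum_mul_sub_le hη X Z Y (hb h1 hw) (hb h2 hw)).1.trans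
      (hs (by linarith) hw)).trans (min_le_left _ _)
  · refine hno (H₂ _ (differentiable_expSum_mul_wave X Z Y η) ρ (fun w hw => ?_)
      (hlt.trans_le (min_le_right _ _)))
    have := ((norm_expSum_mul_sub_le hη X Z Y (hb h1 hw) (hb h2 hw)).2.trans
      (hs (by linarith) hw)).trans (min_le_right _ _)
    rwa [wave_one_eq] at this

theorem expSum_omega_pow_eq_zero_iff {X η : ℂ} (hη : η ^ 3 = 1) (hX : X * η = X) (Z Y : ℂ) (k : ℕ)
    (ρ : ℂ) : expSum X Z Y η (omega 3 ^ k * ρ) = 0 ↔ expSum X Z Y η ρ = 0 := by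
  have h0 : η ≠ 0 := by rintro rfl; norm_num at hη
  induction k with
  | zero => simp
  | succ k ih =>
    refine Iff.trans ?_ ih
    rw [pow_succ', mul_assoc, ← expSum_omega_mul hη hX Z Y (omega 3 ^ k * ρ)]
    simp [h0]

theorem norm_expSum_omega_pow {X η : ℂ} (hη : η ^ 3 = 1) (hX : X * η = X) (Z Y : ℂ) (k : ℕ)
    (ρ : ℂ) : ‖expSum X Z Y η (omega 3 ^ k * ρ)‖ = ‖expSum X Z Y η ρ‖ := by
  induction k with
  | zero => simp
  | succ k ih =>
    rw [← ih, pow_succ', mul_assoc, ← expSum_omega_mul hη hX Z Y (omega 3 ^ k * ρ), norm_mul,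
      norm_eta hη, one_mul]

/-- The common scale of the three rows of the characteristic matrix:
`∏ₖ max (1, |exp (-iωᵏρ)|)`. -/
def rowScale (ρ : ℂ) : ℝ := ∏ k ∈ Finset.range 3, max 1 ‖wave k (-ρ)‖

theorem rowScale_omega_pow (k : ℕ) (ρ : ℂ) : rowScale (omega 3 ^ k * ρ) = rowScale ρ := by
  induction k with
  | zero => simp
  | succ k ih =>
    rw [← ih, pow_succ', mul_assoc]
    generalize omega 3 ^ k * ρ = w
    have h3 := wave_add_three 0 (-w)
    norm_num at h3
    simp only [rowScale, Finset.prod_range_succ, Finset.prod_range_zero, ← mul_neg, wave_omega_mul]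
    norm_num [h3]
    ring

theorem rowScale_eq_of_sector {ρ : ℂ} (h1 : 0 ≤ height 1 ρ) (h2 : 0 ≤ height 2 ρ) :
    rowScale ρ = ‖wave 0 ρ‖ := by
  have hs := height_sum ρ
  simp only [rowScale, Finset.prod_range_succ, Finset.prod_range_zero, norm_wave, height_neg, neg_neg]
  rw [max_eq_left (Real.exp_le_one_iff.2 (by linarith)), max_eq_right (Real.one_le_exp h1),
    max_eq_right (Real.one_le_exp h2), one_mul, one_mul, ← Real.exp_add]
  congr 1; linarith

theorem dist_omega_pow_mul (k : ℕ) (ρ σ : ℂ) :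
    dist (omega 3 ^ k * ρ) (omega 3 ^ k * σ) = dist ρ σ := by
  rw [dist_eq_norm, ← mul_sub, norm_mul, norm_pow, norm_omega, one_pow, one_mul, dist_eq_norm]

theorem exists_lower_bound {X Z η : ℂ} (hη : η ^ 3 = 1) (hX : X * η = X) (hZ : Z ≠ 0) (Y : ℂ) {ε : ℝ}
    (hε : 0 < ε) :
    ∃ R, ∃ δ > 0, ∀ ρ ∈ D 3 Complex.I, R ≤ ‖ρ‖ →
      (∀ σ, expSum X Z Y η σ = 0 → ε ≤ dist ρ σ) → δ * rowScale ρ ≤ ‖expSum X Z Y η ρ‖ := by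
  obtain ⟨R, δ, hδ, H⟩ := exists_lower_bound_sector hη hZ X Y hε
  refine ⟨R, δ, hδ, fun ρ hρ hR hz => ?_⟩
  obtain ⟨k, h1, h2⟩ := exists_rotation_of_nonpos ((mem_D_I ρ).1 hρ).le
  have := H _ h1 h2 (by rwa [norm_mul, norm_pow, norm_omega, one_pow, one_mul]) (fun σ hσ => by
    have e : omega 3 ^ k * ((omega 3 ^ k)⁻¹ * σ) = σ :=
      mul_inv_cancel_left₀ (pow_ne_zero k omega_ne_zero) σ
    rw [← e, dist_omega_pow_mul]
    apply hz
    rwa [← expSum_omega_pow_eq_zero_iff hη hX Z Y k, e])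
  rwa [norm_expSum_omega_pow hη hX, ← rowScale_eq_of_sector h1 h2, rowScale_omega_pow] at this

/-- A dominant term `Y exp (-iωρ)`, with neighbour `Y exp (-iω²ρ)`: without the terms `exp (iωᵏρ)`
the zeros in the sector lie near its axis. -/
theorem exists_zero_sector_of_eq_zero {Y η : ℂ} (hη : η ^ 3 = 1) (hY : Y ≠ 0) (X : ℂ) (R : ℝ) :
    ∃ σ, expSum X 0 Y η σ = 0 ∧ R ≤ height 1 σ ∧ R ≤ height 2 σ := by
  have hn := norm_eta hη
  have hη0 : η ≠ 0 := by rintro rfl; norm_num at hη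
  have h3 : 0 < Real.sqrt 3 := by positivity
  have hκ : omega 3 - omega 3 ^ 2 = Complex.I * (Real.sqrt 3 : ℝ) := by
    have e := omega_quadratic
    have e2 := omega_three
    push_cast at e2 ⊢
    linear_combination 2 * e2 - e
  have hκn : ‖omega 3 - omega 3 ^ 2‖ = Real.sqrt 3 := by
    rw [hκ, norm_mul, Complex.norm_I, one_mul, Complex.norm_real, Real.norm_of_nonneg h3.le]
  obtain ⟨δ, hδ, H⟩ := exists_delta_zero_near (mul_ne_zero hη0 hY) (η ^ 2 * Y)
    (norm_pos_iff.1 (by rw [hκn]; exact h3)) (r := 1 / 4) (by norm_num)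
    (by
      rw [hκn]
      nlinarith [Real.sqrt_lt' (x := 3) (y := 2) (by norm_num) |>.2 (by norm_num)])
  obtain ⟨R₁, hR₁⟩ := exists_exp_le ((‖X‖ + 4 * ‖Y‖) * 2) (c := 1) one_pos (half_pos hδ)
  -- the zeros of the two dominant terms, as far out as wanted
  set T := max (max R₁ (R + 1)) 0 with hT
  set ℓ := Complex.log (-η⁻¹) with hℓ
  have hℓ' : Complex.exp ℓ = -η⁻¹ := Complex.exp_log (neg_ne_zero.2 (inv_ne_zero hη0))
  have hℓre : ℓ.re = 0 := by
    rw [hℓ, Complex.log_re, norm_neg, norm_inv, hn]; simp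
  obtain ⟨n, hn'⟩ := exists_nat_ge (2 * Real.sqrt 3 * T - ℓ.im)
  set ρ : ℂ := -(ℓ + n * (2 * Real.pi * Complex.I)) / (Real.sqrt 3 : ℝ) with hρ
  have hρre : ρ.re = 0 := by
    rw [hρ, Complex.div_ofReal_re]; simp [hℓre]
  have hρim : -ρ.im ≥ 2 * T := by
    rw [hρ, Complex.div_ofReal_im]
    have : (-(ℓ + n * (2 * Real.pi * Complex.I))).im = -(ℓ.im + n * (2 * Real.pi)) := by simp
    rw [this, neg_div, neg_neg, ge_iff_le, le_div_iff₀ h3]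
    nlinarith [Real.pi_gt_three, Nat.cast_nonneg (α := ℝ) n]
  have hh1 : T ≤ height 1 ρ := by rw [height_one, hρre]; linarith
  have hh2 : T ≤ height 2 ρ := by rw [height_two, hρre]; linarith
  have hT0 : 0 ≤ T := le_max_right _ _
  have hT1 : R₁ ≤ T := (le_max_left _ _).trans (le_max_left _ _)
  have hT2 : R + 1 ≤ T := (le_max_right _ _).trans (le_max_left _ _)
  have hg : ∀ w, expSum X 0 Y η w * wave 1 w = (η * Y + η ^ 2 * Y *
      Complex.exp (Complex.I * (omega 3 - omega 3 ^ 2) * w)) +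
      wave 1 w * (X + Y * (wave 1 w * wave 2 w)) := by
    intro w
    have e0 : wave 0 (-w) = wave 1 w * wave 2 w := by
      rw [wave_neg]
      refine inv_eq_of_mul_eq_one_right ?_
      rw [← mul_assoc, wave_prod]
    have e1 := wave_mul_neg 1 w
    have e2 : Complex.exp (Complex.I * (omega 3 - omega 3 ^ 2) * w) = wave 1 w * wave 2 (-w) := by
      rw [wave, wave, ← Complex.exp_add]; ring_nf
    rw [e2]
    simp only [expSum, Finset.sum_range_succ, Finset.sum_range_zero, e0]
    linear_combination η * Y * e1
  have hb : ∀ w, dist w ρ ≤ 1 / 4 → ‖wave 1 w * (X + Y * (wave 1 w * wave 2 w))‖ ≤ δ / 2 := by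
    intro w hw
    have i1 : ∀ k, 0 ≤ height k ρ → ‖wave k w‖ ≤ 2 := by
      intro k hk
      refine (norm_wave_le_of_dist (hw.trans (by norm_num))).trans ?_
      have : Real.exp (-height k ρ) ≤ 1 := Real.exp_le_one_iff.2 (by linarith)
      linarith
    have i2 : ‖wave 1 w‖ ≤ 2 * Real.exp (-height 1 ρ) :=
      norm_wave_le_of_dist (hw.trans (by norm_num))
    have i3 : ‖X + Y * (wave 1 w * wave 2 w)‖ ≤ ‖X‖ + 4 * ‖Y‖ := by
      refine (norm_add_le _ _).trans ?_
      rw [norm_mul, norm_mul]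
      have : ‖wave 1 w‖ * ‖wave 2 w‖ ≤ 2 * 2 := by
        gcongr
        exacts [i1 1 (hT0.trans hh1), i1 2 (hT0.trans hh2)]
      nlinarith [norm_nonneg Y]
    have i4 := hR₁ _ (hT1.trans hh1)
    rw [one_mul] at i4
    calc _ ≤ (2 * Real.exp (-height 1 ρ)) * (‖X‖ + 4 * ‖Y‖) := by
          rw [norm_mul]; gcongr
      _ ≤ _ := by linarith
  obtain ⟨σ, hσ, h0⟩ := H (fun w => expSum X 0 Y η w * wave 1 w)
    ((differentiable_expSum X 0 Y η).mul (differentiable_wave 1)) ρ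
    (fun w hw => by
      rw [hg w, add_sub_cancel_left]
      linarith [hb w hw])
    (by
      have e : Complex.I * (omega 3 - omega 3 ^ 2) * ρ = ℓ + n * (2 * Real.pi * Complex.I) := by
        have h3' : ((Real.sqrt 3 : ℝ) : ℂ) ≠ 0 := by exact_mod_cast h3.ne'
        rw [hκ, hρ]
        field_simp
        linear_combination (-(ℓ + n * (2 * Real.pi * Complex.I))) * Complex.I_sq
      have e' : η * Y + η ^ 2 * Y * Complex.exp (Complex.I * (omega 3 - omega 3 ^ 2) * ρ) = 0 := by
        rw [e, Complex.exp_add, Complex.exp_nat_mul_two_pi_mul_I, hℓ']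
        field_simp
        ring
      rw [hg ρ, e', zero_add]
      linarith [hb ρ (by norm_num)])
  refine ⟨σ, (mul_eq_zero.1 h0).resolve_right (wave_ne_zero _ _), ?_, ?_⟩
  · linarith [(abs_le.1 (abs_height_sub_le 1 σ ρ)).1]
  · linarith [(abs_le.1 (abs_height_sub_le 2 σ ρ)).1]

/-- If `0 < |Z| < |Y|`, then zeros in the sector lie near the line where `exp (iρ)` and
`exp (-iωρ)` balance: it is parallel to a boundary line of the sector and lies inside. -/
theorem exists_zero_sector_of_ne_zero {Z Y η : ℂ} (hη : η ^ 3 = 1) (hZ : Z ≠ 0) (hZY : ‖Z‖ < ‖Y‖)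
    (X : ℂ) :
    ∃ δ > 0, ∀ R, ∃ σ, expSum X Z Y η σ = 0 ∧ R ≤ height 1 σ ∧ δ ≤ height 2 σ := by
  have hn := norm_eta hη
  have hη0 : η ≠ 0 := by rintro rfl; norm_num at hη
  have h3 : 0 < Real.sqrt 3 := by positivity
  have hY : Y ≠ 0 := norm_pos_iff.1 ((norm_nonneg _).trans_lt hZY)
  have hQ : -Z / (η * Y) ≠ 0 := div_ne_zero (neg_ne_zero.2 hZ) (mul_ne_zero hη0 hY)
  set ℓ := Complex.log (-Z / (η * Y)) with hℓ
  have hℓ' : Complex.exp ℓ = -Z / (η * Y) := Complex.exp_log hQ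
  have hℓre : ℓ.re < 0 := by
    rw [hℓ, Complex.log_re, norm_div, norm_neg, norm_mul, hn, one_mul]
    exact Real.log_neg (div_pos (norm_pos_iff.2 hZ) (norm_pos_iff.2 hY))
      ((div_lt_one (norm_pos_iff.2 hY)).2 hZY)
  refine ⟨-ℓ.re / 2, by linarith, fun R => ?_⟩
  have hr : 0 < min (-ℓ.re / 2) (1 / 2) := lt_min (by linarith) (by norm_num)
  have hω2 : ‖omega 3 ^ 2‖ = 1 := by rw [norm_pow, norm_omega, one_pow]
  obtain ⟨δ, hδ, H⟩ := exists_delta_zero_near hZ (η * Y) (pow_ne_zero 2 omega_ne_zero) hr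
    (by rw [hω2, one_mul]; exact min_le_right _ _)
  set K := 2 * ‖X‖ + 8 * ‖Z‖ + 9 * ‖Y‖ with hK
  have hK0 : 0 ≤ K := by positivity
  obtain ⟨R₁, hR₁⟩ := exists_exp_le (K * 2) (c := 1) one_pos (half_pos hδ)
  set T := max (max R₁ (R + 1)) 0 with hT
  have hT0 : 0 ≤ T := le_max_right _ _
  have hT1 : R₁ ≤ T := (le_max_left _ _).trans (le_max_left _ _)
  have hT2 : R + 1 ≤ T := (le_max_right _ _).trans (le_max_left _ _)
  obtain ⟨n, hn'⟩ := exists_nat_ge (T - height 2 (-Complex.I * ℓ))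
  set ρ : ℂ := omega 3 * (-Complex.I * ℓ - n * (2 * Real.pi)) with hρ
  have hh2 : height 2 ρ = -ℓ.re := by
    have h := height_add_three 0 (-Complex.I * ℓ - n * (2 * Real.pi))
    norm_num at h
    rw [hρ, height_omega_mul]
    norm_num
    rw [neg_mul] at *
    rw [h, height_zero]
    simp
  have hh1 : T ≤ height 1 ρ := by
    rw [hρ, height_omega_mul, height_sub]
    have : height 2 ((n : ℂ) * (2 * Real.pi)) = -(Real.sqrt 3 * Real.pi * n) := by
      rw [height_two]
      simp
      ring
    have h1 : (1 : ℝ) ≤ Real.sqrt 3 * Real.pi := by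
      have : 1 ≤ Real.sqrt 3 := Real.one_le_sqrt.2 (by norm_num)
      nlinarith [Real.pi_gt_three]
    norm_num
    norm_num at this hn'
    rw [this]
    nlinarith [Nat.cast_nonneg (α := ℝ) n]
  have hb : ∀ w, dist w ρ ≤ min (-ℓ.re / 2) (1 / 2) →
      ‖expSum X Z Y η w * wave 0 (-w) - (Z + η * Y * wave 2 w)‖ ≤ δ / 2 := by
    intro w hw
    have hw' := hw.trans (min_le_right _ _)
    have i1 : ∀ k, 0 ≤ height k ρ → ‖wave k w‖ ≤ 2 := by
      intro k hk
      refine (norm_wave_le_of_dist hw').trans ?_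
      have : Real.exp (-height k ρ) ≤ 1 := Real.exp_le_one_iff.2 (by linarith)
      linarith
    refine (norm_expSum_mul_sub_le hη X Z Y (i1 1 (hT0.trans hh1))
      (i1 2 (by rw [hh2]; linarith))).1.trans ?_
    have i4 := hR₁ _ (hT1.trans hh1)
    rw [one_mul, mul_assoc] at i4
    refine le_trans ?_ i4
    gcongr
    exact norm_wave_le_of_dist hw'
  obtain ⟨σ, hσ, h0⟩ := H _ (differentiable_expSum_mul_wave X Z Y η) ρ
    (fun w hw => (hb w hw).trans (by linarith))
    (by
      have e : wave 2 ρ = -Z / (η * Y) := by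
        have : Complex.I * omega 3 ^ 2 * ρ = ℓ - n * (2 * Real.pi * Complex.I) := by
          rw [hρ]
          linear_combination (Complex.I * (-Complex.I * ℓ - n * (2 * Real.pi))) * omega_cube -
            ℓ * Complex.I_sq
        rw [wave, this, Complex.exp_sub, Complex.exp_nat_mul_two_pi_mul_I, div_one, hℓ']
      have e' : Z + η * Y * wave 2 ρ = 0 := by
        rw [e]; field_simp; ring
      have := hb ρ (by rw [dist_self]; exact hr.le)
      rw [e', sub_zero] at this
      linarith)
  refine ⟨σ, (mul_eq_zero.1 h0).resolve_right (wave_ne_zero _ _), ?_, ?_⟩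
  · linarith [(abs_le.1 (abs_height_sub_le 1 σ ρ)).1, min_le_right (-ℓ.re / 2) (1 / 2)]
  · linarith [(abs_le.1 (abs_height_sub_le 2 σ ρ)).1, min_le_left (-ℓ.re / 2) (1 / 2)]

theorem exists_zero_sector {Z Y η : ℂ} (hη : η ^ 3 = 1) (hZY : ‖Z‖ < ‖Y‖) (X : ℂ) :
    ∃ δ > 0, ∀ R, ∃ σ, expSum X Z Y η σ = 0 ∧ R ≤ ‖σ‖ ∧ δ ≤ height 1 σ ∧ δ ≤ height 2 σ := by
  have hle : ∀ {k σ R}, R ≤ height k σ → R ≤ ‖σ‖ := fun h =>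
    h.trans ((le_abs_self _).trans (abs_height_le _ _))
  by_cases hZ : Z = 0
  · subst hZ
    refine ⟨1, one_pos, fun R => ?_⟩
    obtain ⟨σ, h0, h1, h2⟩ := exists_zero_sector_of_eq_zero hη
      (norm_pos_iff.1 ((norm_nonneg _).trans_lt hZY)) X (max R 1)
    exact ⟨σ, h0, hle ((le_max_left _ _).trans h1), (le_max_right _ _).trans h1,
      (le_max_right _ _).trans h2⟩
  · obtain ⟨δ, hδ, H⟩ := exists_zero_sector_of_ne_zero hη hZ hZY X
    refine ⟨δ, hδ, fun R => ?_⟩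
    obtain ⟨σ, h0, h1, h2⟩ := H (max R δ)
    exact ⟨σ, h0, hle ((le_max_left _ _).trans h1), (le_max_right _ _).trans h1, h2⟩

/-- If `|Y| ≤ |Z|`, then the large zeros in the closed sector are exponentially close to one of its
two boundary lines. -/
theorem height_le_of_zero {Z Y η : ℂ} (hη : η ^ 3 = 1) (hZ : Z ≠ 0) (hYZ : ‖Y‖ ≤ ‖Z‖) (X : ℂ) :
    ∃ C R, ∀ ρ, 0 ≤ height 1 ρ → 0 ≤ height 2 ρ → expSum X Z Y η ρ = 0 → R ≤ ‖ρ‖ →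
      height 1 ρ ≤ C * Real.exp (-(2 / 5 * ‖ρ‖)) ∨ height 2 ρ ≤ C * Real.exp (-(2 / 5 * ‖ρ‖)) := by
  have hZ' := norm_pos_iff.2 hZ
  set K := 2 * ‖X‖ + 8 * ‖Z‖ + 9 * ‖Y‖ with hK
  have hK0 : 0 ≤ K := by positivity
  obtain ⟨R, hR⟩ := exists_exp_le (K / ‖Z‖) (c := 2 / 5) (δ := 1 / 2) (by norm_num) (by norm_num)
  refine ⟨2 * (K / ‖Z‖), R, fun ρ h1 h2 h0 hρ => ?_⟩
  have hsmall := hR _ hρ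
  set q := K / ‖Z‖ * Real.exp (-(2 / 5 * ‖ρ‖)) with hq
  have hb : ∀ {k}, 0 ≤ height k ρ → ‖wave k ρ‖ ≤ 2 := fun hk => by
    rw [norm_wave]
    exact (Real.exp_le_one_iff.2 (by linarith)).trans (by norm_num)
  have hne := norm_expSum_mul_sub_le hη X Z Y (hb h1) (hb h2)
  rw [h0, zero_mul, zero_sub, norm_neg, zero_sub, norm_neg] at hne
  have key : ∀ {θ : ℂ} {k l}, ‖θ‖ = 1 → 2 / 5 * ‖ρ‖ ≤ height l ρ →
      ‖Z + θ * Y * wave k ρ‖ ≤ K * ‖wave l ρ‖ → height k ρ ≤ 2 * q := by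
    intro θ k l hθ hl hle
    have i1 : ‖Z‖ ≤ ‖Z‖ * Real.exp (-height k ρ) + K * Real.exp (-(2 / 5 * ‖ρ‖)) := by
      have h := norm_sub_le (Z + θ * Y * wave k ρ) (θ * Y * wave k ρ)
      rw [add_sub_cancel_right, norm_mul (θ * Y), norm_mul θ, hθ, one_mul] at h
      have h' : K * ‖wave l ρ‖ ≤ K * Real.exp (-(2 / 5 * ‖ρ‖)) := by
        rw [norm_wave]; gcongr
      have h'' : ‖Y‖ * ‖wave k ρ‖ ≤ ‖Z‖ * Real.exp (-height k ρ) := by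
        rw [norm_wave]; gcongr
      linarith
    have i2 : 1 - q ≤ Real.exp (-height k ρ) := by
      have : ‖Z‖ * (1 - q) = ‖Z‖ - K * Real.exp (-(2 / 5 * ‖ρ‖)) := by
        rw [hq]; field_simp
      exact le_of_mul_le_mul_left (by linarith) hZ'
    have i3 : Real.exp (height k ρ) * Real.exp (-height k ρ) = 1 := by
      rw [← Real.exp_add, add_neg_cancel, Real.exp_zero]
    have i4 := Real.add_one_le_exp (height k ρ)
    have i5 : Real.exp (height k ρ) ≤ 2 := by nlinarith [Real.exp_pos (height k ρ)]
    have i6 : 0 ≤ q := by positivity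
    nlinarith [Real.exp_pos (height k ρ)]
  have hsum := norm_le_height_add h1 h2
  rw [mul_assoc]
  rcases le_total (height 2 ρ) (height 1 ρ) with h | h
  · exact Or.inr (key (norm_eta hη) (by linarith) hne.1)
  · exact Or.inl (key (by rw [norm_pow, norm_eta hη, one_pow]) (by linarith) hne.2)

/-- On the imaginary half-axis where `exp (iρ)` grows, its coefficient is the leading one. -/
theorem norm_expSum_neg_I_mul_sub_le {η : ℂ} (hη : η ^ 3 = 1) (X Z Y : ℂ) :
    ∃ K, ∀ t : ℝ, 0 ≤ t →
      ‖expSum X Z Y η (-Complex.I * t) * Real.exp (-t) - Z‖ ≤ K * Real.exp (-(1 / 2 * t)) := by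
  refine ⟨2 * ‖X‖ + 8 * ‖Z‖ + 9 * ‖Y‖ + ‖Y‖, fun t ht => ?_⟩
  have h1 : height 1 (-Complex.I * t) = 1 / 2 * t := by
    rw [height_one]; simp; ring
  have h2 : height 2 (-Complex.I * t) = 1 / 2 * t := by
    rw [height_two]; simp; ring
  have e0 : wave 0 (-(-Complex.I * t)) = Real.exp (-t) := by
    rw [wave]
    push_cast
    congr 1
    linear_combination (t : ℂ) * Complex.I_sq
  have hb : Real.exp (-(1 / 2 * t)) ≤ 2 :=
    (Real.exp_le_one_iff.2 (by linarith)).trans (by norm_num)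
  have h := (norm_expSum_mul_sub_le hη X Z Y (w := -Complex.I * t) (by rw [norm_wave, h1]; exact hb)
    (by rw [norm_wave, h2]; exact hb)).1
  rw [e0, norm_wave, h1] at h
  have h' := norm_add_le (expSum X Z Y η (-Complex.I * t) * Real.exp (-t) -
    (Z + η * Y * wave 2 (-Complex.I * t))) (η * Y * wave 2 (-Complex.I * t))
  rw [norm_mul (η * Y), norm_mul η, norm_eta hη, one_mul, norm_wave, h2] at h'
  have e : expSum X Z Y η (-Complex.I * t) * Real.exp (-t) -
    (Z + η * Y * wave 2 (-Complex.I * t)) + η * Y * wave 2 (-Complex.I * t) =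
    expSum X Z Y η (-Complex.I * t) * Real.exp (-t) - Z := by ring
  rw [e] at h'
  linarith

theorem tendsto_expSum_neg_I_mul {η : ℂ} (hη : η ^ 3 = 1) (X Z Y : ℂ) :
    Tendsto (fun t : ℝ => expSum X Z Y η (-Complex.I * t) * Real.exp (-t)) atTop (𝓝 Z) := by
  obtain ⟨K, hK⟩ := norm_expSum_neg_I_mul_sub_le hη X Z Y
  rw [tendsto_iff_norm_sub_tendsto_zero]
  have h : Tendsto (fun t : ℝ => K * Real.exp (-(1 / 2 * t))) atTop (𝓝 (K * 0)) :=
    (Real.tendsto_exp_neg_atTop_nhds_zero.comp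
      (tendsto_id.const_mul_atTop (by norm_num : (0 : ℝ) < 1 / 2))).const_mul K
  rw [mul_zero] at h
  exact squeeze_zero' (Eventually.of_forall fun _ => norm_nonneg _)
    (eventually_atTop.2 ⟨0, hK⟩) h

theorem exists_expSum_ne_zero {X Z Y η : ℂ} (hη : η ^ 3 = 1) (h : Z ≠ 0 ∨ Y ≠ 0) :
    ∃ z, expSum X Z Y η z ≠ 0 := by
  have key : ∀ {Z Y : ℂ}, Z ≠ 0 → ∃ z, expSum X Z Y η z ≠ 0 := by
    intro Z Y hZ
    obtain ⟨t, ht⟩ := ((tendsto_expSum_neg_I_mul hη X Z Y).eventually_ne hZ).exists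
    exact ⟨_, left_ne_zero_of_mul ht⟩
  rcases h with h | h
  · exact key h
  · obtain ⟨z, hz⟩ := key (Y := Z) h
    exact ⟨-z, by rwa [expSum_neg]⟩

theorem norm_expSum_le {η : ℂ} (hη : η ^ 3 = 1) (X Z Y ρ : ℂ) :
    ‖expSum X Z Y η ρ‖ ≤ (‖X‖ + 3 * ‖Z‖ + 3 * ‖Y‖) * Real.exp ‖ρ‖ := by
  have hw : ∀ k, ∀ w : ℂ, ‖wave k w‖ ≤ Real.exp ‖w‖ := fun k w => by
    rw [norm_wave]
    exact Real.exp_le_exp.2 ((neg_le_abs _).trans (abs_height_le k w))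
  have h1 : 1 ≤ Real.exp ‖ρ‖ := Real.one_le_exp (norm_nonneg _)
  have ht : ∀ k ∈ Finset.range 3, ‖η ^ k * (Z * wave k ρ + Y * wave k (-ρ))‖ ≤
      (‖Z‖ + ‖Y‖) * Real.exp ‖ρ‖ := by
    intro k _
    rw [norm_mul, norm_pow, norm_eta hη, one_pow, one_mul, add_mul]
    refine (norm_add_le _ _).trans ?_
    rw [norm_mul, norm_mul]
    have h1 := hw k ρ
    have h2 := hw k (-ρ)
    rw [norm_neg] at h2
    gcongr
  have h2 := norm_sum_le_of_le _ ht
  rw [Finset.sum_const, Finset.card_range] at h2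
  have h3 := norm_add_le X (∑ k ∈ Finset.range 3, η ^ k * (Z * wave k ρ + Y * wave k (-ρ)))
  have h4 : ‖X‖ ≤ ‖X‖ * Real.exp ‖ρ‖ := le_mul_of_one_le_right (norm_nonneg _) h1
  rw [nsmul_eq_mul] at h2
  push_cast at h2
  rw [expSum]
  linarith

/-! ### Counting and listing zeros -/

/-- Jensen's inequality in elementary form: each zero in the disc of radius `R` halves the bound
which the maximum principle gives on that disc from the circle of radius `5R`. -/
theorem norm_mul_two_pow_card_le {R : ℝ} (hR : 0 < R) (T : Finset ℂ) :
    ∀ (F : ℂ → ℂ), Differentiable ℂ F → (∀ σ ∈ T, ‖σ‖ ≤ R ∧ F σ = 0) → ∀ M,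
      (∀ w, ‖w‖ = 5 * R → ‖F w‖ ≤ M) → ∀ z, ‖z‖ ≤ R → ‖F z‖ * 2 ^ T.card ≤ M := by
  induction T using Finset.induction_on with
  | empty =>
    intro F hF _ M hM z hz
    simp only [Finset.card_empty, pow_zero, mul_one]
    refine Complex.norm_le_of_forall_mem_frontier_norm_le (U := Metric.ball 0 (5 * R))
      Metric.isBounded_ball hF.diffContOnCl (fun w hw => ?_) (subset_closure ?_)
    · rw [frontier_ball _ (by positivity)] at hw
      exact hM w (by simpa using hw)
    · simpa using (by linarith : ‖z‖ < 5 * R)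
  | insert s T hs ih =>
    intro F hF hT M hM z hz
    have hs' := hT s (Finset.mem_insert_self s T)
    have hfac : ∀ w, F w = (w - s) * dslope F s w := by
      intro w
      have := sub_smul_dslope F s w
      rw [hs'.2, sub_zero, smul_eq_mul] at this
      exact this.symm
    have hG : Differentiable ℂ (dslope F s) := by
      rw [← differentiableOn_univ]
      exact (Complex.differentiableOn_dslope Filter.univ_mem).2 hF.differentiableOn
    have key := ih (dslope F s) hG (fun σ hσ => by
      have h := hT σ (Finset.mem_insert_of_mem hσ)
      refine ⟨h.1, ?_⟩
      have h2 := h.2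
      rw [hfac, mul_eq_zero, sub_eq_zero] at h2
      exact h2.resolve_left fun e => hs (e ▸ hσ)) (M / (4 * R)) (fun w hw => by
        rw [le_div_iff₀ (by positivity)]
        have h1 := hM w hw
        rw [hfac, norm_mul] at h1
        have h2 := norm_sub_norm_le w s
        have h3 : 4 * R ≤ ‖w - s‖ := by linarith [hs'.1]
        nlinarith [norm_nonneg (dslope F s w)]) z hz
    rw [le_div_iff₀ (by positivity)] at key
    rw [Finset.card_insert_of_notMem hs, pow_succ, hfac, norm_mul]
    have h1 : ‖z - s‖ ≤ 2 * R := (norm_sub_le _ _).trans (by linarith [hs'.1])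
    calc ‖z - s‖ * ‖dslope F s z‖ * (2 ^ T.card * 2)
        = ‖z - s‖ * (‖dslope F s z‖ * 2 ^ T.card * 2) := by ring
      _ ≤ 2 * R * (‖dslope F s z‖ * 2 ^ T.card * 2) := by gcongr
      _ = ‖dslope F s z‖ * 2 ^ T.card * (4 * R) := by ring
      _ ≤ M := key

/-- An entire function of exponential type has `O(R)` zeros in the disc of radius `R`. -/
theorem exists_card_zeros_le {F : ℂ → ℂ} (hF : Differentiable ℂ F) {C : ℝ}
    (hC : ∀ z, ‖F z‖ ≤ C * Real.exp ‖z‖) {z₀ : ℂ} (h₀ : F z₀ ≠ 0) :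
    ∃ A > 0, ∀ R, ∀ T : Finset ℂ, (∀ σ ∈ T, ‖σ‖ ≤ R ∧ F σ = 0) → (T.card : ℝ) ≤ A * (1 + |R|) := by
  have h0 := norm_pos_iff.2 h₀
  have hC0 : 0 < C := by
    have := h0.trans_le (hC z₀)
    exact pos_of_mul_pos_left this (Real.exp_pos _).le
  set L := |Real.log (C / ‖F z₀‖)| with hL
  have hl2 := Real.log_two_gt_d9
  refine ⟨2 * (L + 5 * (‖z₀‖ + 1) + 5), by positivity, fun R T hT => ?_⟩
  set R' := |R| + ‖z₀‖ + 1 with hR'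
  have hR0 : 0 < R' := by positivity
  have key := norm_mul_two_pow_card_le hR0 T F hF (fun σ hσ => ⟨(hT σ hσ).1.trans (by
      linarith [le_abs_self R, norm_nonneg z₀]), (hT σ hσ).2⟩) (C * Real.exp (5 * R'))
    (fun w hw => by rw [← hw]; exact hC w) z₀ (by linarith [abs_nonneg R])
  rw [mul_comm, ← le_div_iff₀ h0] at key
  have h1 := Real.log_le_log (by positivity) key
  rw [Real.log_pow, mul_div_right_comm, Real.log_mul (by positivity) (Real.exp_pos _).ne',
    Real.log_exp] at h1
  have h2 : Real.log (C / ‖F z₀‖) ≤ L := le_abs_self _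
  have h3 : (T.card : ℝ) * (1 / 2) ≤ T.card * Real.log 2 := by gcongr; linarith
  have h4 : 0 ≤ L := abs_nonneg _
  nlinarith [abs_nonneg R, norm_nonneg z₀, mul_nonneg (abs_nonneg R) (norm_nonneg z₀),
    mul_nonneg (abs_nonneg R) h4]

/-- An infinite set with finitely many points in each disc can be listed by nondecreasing modulus. -/
theorem exists_monotone_enumeration {S : Set ℂ} (hS : S.Infinite)
    (hfin : ∀ R, (S ∩ {z | ‖z‖ ≤ R}).Finite) :
    ∃ σ : ℕ → ℂ, Function.Injective σ ∧ Set.range σ = S ∧ Monotone fun k => ‖σ k‖ := by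
  classical
  have hpick : ∀ T : Finset ℂ, ∃ s ∈ S, s ∉ T ∧ ∀ z ∈ S, z ∉ T → ‖s‖ ≤ ‖z‖ := by
    intro T
    obtain ⟨z, hz, hzT⟩ := hS.exists_notMem_finset T
    have hf : ((S ∩ {w | ‖w‖ ≤ ‖z‖}) \ T).Finite := (hfin ‖z‖).subset Set.sdiff_subset
    obtain ⟨s, hs, hmin⟩ := Set.exists_min_image _ (fun w => ‖w‖) hf ⟨z, ⟨hz, le_refl ‖z‖⟩, hzT⟩
    refine ⟨s, hs.1.1, hs.2, fun w hw hwT => ?_⟩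
    rcases le_total ‖w‖ ‖z‖ with h | h
    · exact hmin w ⟨⟨hw, h⟩, hwT⟩
    · exact le_trans hs.1.2 h
  choose pick hpS hpT hpmin using hpick
  -- the first `n` points, chosen one after the other with least possible modulus
  let T : ℕ → Finset ℂ := fun n => Nat.rec ∅ (fun _ T => insert (pick T) T) n
  have hT : ∀ n, T (n + 1) = insert (pick (T n)) (T n) := fun n => rfl
  have hTmono : Monotone T := monotone_nat_of_le_succ fun n => by
    rw [hT]; exact Finset.subset_insert _ _
  have hmem : ∀ {m n}, m < n → pick (T m) ∈ T n := fun {m n} h =>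
    hTmono (Nat.succ_le_of_lt h) (by rw [Nat.succ_eq_add_one, hT]; exact Finset.mem_insert_self _ _)
  have hinj : Function.Injective fun n => pick (T n) := by
    intro m n h
    rcases lt_trichotomy m n with hl | hl | hl
    · exact absurd (hmem hl) (by simp only at h; rw [h]; exact hpT _)
    · exact hl
    · exact absurd (hmem hl) (by simp only at h; rw [← h]; exact hpT _)
  refine ⟨fun n => pick (T n), hinj, ?_, ?_⟩
  · refine Set.Subset.antisymm (Set.range_subset_iff.2 fun n => hpS _) fun s hs => ?_
    by_contra hns
    have hsT : ∀ n, s ∉ T n := by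
      intro n
      induction n with
      | zero => exact Finset.notMem_empty s
      | succ n ih =>
        rw [hT, Finset.mem_insert, not_or]
        exact ⟨fun e => hns ⟨n, e.symm⟩, ih⟩
    refine Set.infinite_of_injective_forall_mem hinj (fun n => ?_) (hfin ‖s‖)
    exact ⟨hpS _, hpmin _ s hs (hsT n)⟩
  · refine monotone_nat_of_le_succ fun n => hpmin _ _ (hpS _) fun h => hpT (T (n + 1)) ?_
    exact hTmono (Nat.le_succ n) h

/-! ### Distance to `E` -/

theorem infDist_mul_eq {a b u : ℂ} (hu : ‖u‖ = 1) (h : a * u ^ 3 = b) (z : ℂ) :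
    Metric.infDist (u * z) (E 3 a) = Metric.infDist z (E 3 b) := by
  have hu0 : u ≠ 0 := by rintro rfl; simp at hu
  have hiso : Isometry fun z : ℂ => u * z := Isometry.of_dist_eq fun x y => by
    rw [dist_eq_norm, ← mul_sub, norm_mul, hu, one_mul, dist_eq_norm]
  have him : (fun z : ℂ => u * z) '' E 3 b = E 3 a := by
    ext w
    constructor
    · rintro ⟨z, hz, rfl⟩
      simp only [E, Set.mem_ofPred_eq, ← h] at hz ⊢
      rwa [mul_pow, ← mul_assoc]
    · intro hw
      refine ⟨u⁻¹ * w, ?_, mul_inv_cancel_left₀ hu0 w⟩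
      simp only [E, Set.mem_ofPred_eq, ← h] at hw ⊢
      rwa [mul_assoc, ← mul_pow, mul_inv_cancel_left₀ hu0]
  rw [← him, Metric.infDist_image hiso]

theorem infDist_E_le_of_sector {ρ : ℂ} (hρ : ρ ≠ 0) (h1 : 0 ≤ height 1 ρ) (h2 : 0 ≤ height 2 ρ) :
    Metric.infDist ρ (E 3 Complex.I) ≤ height 1 ρ ∧
      Metric.infDist ρ (E 3 Complex.I) ≤ height 2 ρ := by
  have hpos : 0 < height 1 ρ + height 2 ρ :=
    lt_of_lt_of_le (by have := norm_pos_iff.2 hρ; positivity) (norm_le_height_add h1 h2)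
  have e3 := sqrt_three_sq
  constructor
  · refine le_of_forall_pos_lt_add fun ε hε => ?_
    -- cross the line `Im ωρ = 0` orthogonally, by a little
    set s := min (ε / 2) ((height 1 ρ + height 2 ρ) / 2) with hs
    have hs0 : 0 < s := lt_min (by linarith) (by linarith)
    have hs1 : s ≤ ε / 2 := min_le_left _ _
    have hs2 : s ≤ (height 1 ρ + height 2 ρ) / 2 := min_le_right _ _
    set w : ℂ := ρ - Complex.I * omega 3 ^ 2 * ((height 1 ρ + s : ℝ) : ℂ) with hw
    have f1 : height 1 w = -s := by
      rw [hw, height_sub]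
      have : height 1 (Complex.I * omega 3 ^ 2 * ((height 1 ρ + s : ℝ) : ℂ)) = height 1 ρ + s := by
        have : omega 3 ^ 1 * (Complex.I * omega 3 ^ 2 * ((height 1 ρ + s : ℝ) : ℂ)) =
            Complex.I * ((height 1 ρ + s : ℝ) : ℂ) := by
          linear_combination (Complex.I * ((height 1 ρ + s : ℝ) : ℂ)) * omega_cube
        rw [height, this, Complex.I_mul_im, Complex.ofReal_re]
      rw [this]; ring
    have f2 : height 2 w = height 2 ρ + (height 1 ρ + s) / 2 := by
      rw [hw, height_sub]
      have : height 2 (Complex.I * omega 3 ^ 2 * ((height 1 ρ + s : ℝ) : ℂ)) =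
          -(height 1 ρ + s) / 2 := by
        have : omega 3 ^ 2 * (Complex.I * omega 3 ^ 2 * ((height 1 ρ + s : ℝ) : ℂ)) =
            Complex.I * (omega 3 * ((height 1 ρ + s : ℝ) : ℂ)) := by
          linear_combination (Complex.I * omega 3 * ((height 1 ρ + s : ℝ) : ℂ)) * omega_cube
        rw [height, this, Complex.I_mul_im, Complex.re_mul_ofReal, omega_re]; ring
      rw [this]; ring
    have f0 := height_sum w
    have hE : w ∈ E 3 Complex.I := by
      rw [mem_E_I]
      have g1 : height 0 w < 0 := by linarith
      have g2 : height 1 w < 0 := by linarith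
      have g3 : 0 < height 2 w := by linarith
      exact mul_pos (mul_pos_of_neg_of_neg g1 g2) g3
    refine (Metric.infDist_le_dist_of_mem hE).trans_lt ?_
    rw [hw, dist_eq_norm, sub_sub_cancel, norm_mul, norm_mul, norm_pow, norm_omega, Complex.norm_I,
      one_pow, one_mul, one_mul, Complex.norm_real, Real.norm_of_nonneg (by linarith)]
    linarith
  · refine le_of_forall_pos_lt_add fun ε hε => ?_
    set s := min (ε / 2) ((height 1 ρ + height 2 ρ) / 2) with hs
    have hs0 : 0 < s := lt_min (by linarith) (by linarith)
    have hs1 : s ≤ ε / 2 := min_le_left _ _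
    have hs2 : s ≤ (height 1 ρ + height 2 ρ) / 2 := min_le_right _ _
    set w : ℂ := ρ - Complex.I * omega 3 * ((height 2 ρ + s : ℝ) : ℂ) with hw
    have f2 : height 2 w = -s := by
      rw [hw, height_sub]
      have : height 2 (Complex.I * omega 3 * ((height 2 ρ + s : ℝ) : ℂ)) = height 2 ρ + s := by
        have : omega 3 ^ 2 * (Complex.I * omega 3 * ((height 2 ρ + s : ℝ) : ℂ)) =
            Complex.I * ((height 2 ρ + s : ℝ) : ℂ) := by
          linear_combination (Complex.I * ((height 2 ρ + s : ℝ) : ℂ)) * omega_cube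
        rw [height, this, Complex.I_mul_im, Complex.ofReal_re]
      rw [this]; ring
    have f1 : height 1 w = height 1 ρ + (height 2 ρ + s) / 2 := by
      rw [hw, height_sub]
      have : height 1 (Complex.I * omega 3 * ((height 2 ρ + s : ℝ) : ℂ)) =
          -(height 2 ρ + s) / 2 := by
        have : omega 3 ^ 1 * (Complex.I * omega 3 * ((height 2 ρ + s : ℝ) : ℂ)) =
            Complex.I * ((-1 - omega 3) * ((height 2 ρ + s : ℝ) : ℂ)) := by
          linear_combination (Complex.I * ((height 2 ρ + s : ℝ) : ℂ)) * omega_quadratic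
        rw [height, this, Complex.I_mul_im, Complex.re_mul_ofReal, Complex.sub_re, omega_re]
        simp; ring
      rw [this]; ring
    have f0 := height_sum w
    have hE : w ∈ E 3 Complex.I := by
      rw [mem_E_I]
      have g1 : height 0 w < 0 := by linarith
      have g2 : height 2 w < 0 := by linarith
      have g3 : 0 < height 1 w := by linarith
      exact mul_pos_of_neg_of_neg (mul_neg_of_neg_of_pos g1 g3) g2
    refine (Metric.infDist_le_dist_of_mem hE).trans_lt ?_
    rw [hw, dist_eq_norm, sub_sub_cancel, norm_mul, norm_mul, norm_omega, Complex.norm_I,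
      one_mul, one_mul, Complex.norm_real, Real.norm_of_nonneg (by linarith)]
    linarith

theorem le_infDist_E_of_sector {ρ : ℂ} {δ : ℝ} (h1 : δ ≤ height 1 ρ) (h2 : δ ≤ height 2 ρ) :
    δ ≤ Metric.infDist ρ (E 3 Complex.I) := by
  have hne : (E 3 Complex.I).Nonempty := ⟨Complex.I, by
    rw [mem_E_I, height_zero, height_one, height_two]; simp⟩
  rw [Metric.le_infDist hne]
  intro w hw
  by_contra! hlt
  have g1 := (abs_le.1 (abs_height_sub_le 1 ρ w)).2
  have g2 := (abs_le.1 (abs_height_sub_le 2 ρ w)).2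
  have hs := height_sum w
  rw [mem_E_I] at hw
  have p1 : 0 < height 1 w := by linarith
  have p2 : 0 < height 2 w := by linarith
  have := mul_neg_of_neg_of_pos (mul_neg_of_neg_of_pos (by linarith : height 0 w < 0) p1) p2
  linarith

theorem infDist_E_le_norm (ρ : ℂ) : Metric.infDist ρ (E 3 Complex.I) ≤ ‖ρ‖ := by
  refine le_of_forall_pos_lt_add fun ε hε => ?_
  have hE : (((ε / 2 : ℝ) : ℂ) * Complex.I) ∈ E 3 Complex.I := by
    rw [mem_E_I, height_zero, height_one, height_two]
    simp
    nlinarith [mul_pos (mul_pos hε hε) hε]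
  refine (Metric.infDist_le_dist_of_mem hE).trans_lt ?_
  rw [dist_eq_norm]
  refine (norm_sub_le _ _).trans_lt ?_
  rw [norm_mul, Complex.norm_I, mul_one, Complex.norm_real, Real.norm_of_nonneg (by linarith)]
  linarith

theorem infDist_E_le_of_zero {X Z Y η : ℂ} (hη : η ^ 3 = 1) (hX : X * η = X) (hZ : Z ≠ 0)
    (hYZ : ‖Y‖ ≤ ‖Z‖) :
    ∃ C, ∀ ρ, ρ ≠ 0 → expSum X Z Y η ρ = 0 →
      Metric.infDist ρ (E 3 Complex.I) ≤ C * Real.exp (-(2 / 5 * ‖ρ‖)) := by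
  obtain ⟨C, R, H⟩ := height_le_of_zero hη hZ hYZ X
  refine ⟨max |C| (|R| * Real.exp (2 / 5 * |R|)), fun ρ hρ h0 => ?_⟩
  have he := Real.exp_pos (-(2 / 5 * ‖ρ‖))
  rcases le_or_gt R ‖ρ‖ with hR | hR
  · refine le_trans ?_ (mul_le_mul_of_nonneg_right (le_max_left _ _) he.le)
    rcases lt_or_ge 0 (height 0 ρ * height 1 ρ * height 2 ρ) with hE | hE
    · rw [Metric.infDist_zero_of_mem ((mem_E_I ρ).2 hE)]
      positivity
    · obtain ⟨k, h1, h2⟩ := exists_rotation_of_nonpos hE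
      have hn : ‖omega 3 ^ k‖ = 1 := by rw [norm_pow, norm_omega, one_pow]
      have hk : (omega 3 ^ k) ^ 3 = 1 := by rw [← pow_mul, mul_comm, pow_mul, omega_cube, one_pow]
      have hnρ : ‖omega 3 ^ k * ρ‖ = ‖ρ‖ := by rw [norm_mul, hn, one_mul]
      rw [← infDist_mul_eq (a := Complex.I) (b := Complex.I) hn (by rw [hk, mul_one])]
      have hb := infDist_E_le_of_sector
        (mul_ne_zero (pow_ne_zero k omega_ne_zero) hρ) h1 h2
      have := H _ h1 h2 ((expSum_omega_pow_eq_zero_iff hη hX Z Y k ρ).2 h0) (by rwa [hnρ])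
      rw [hnρ] at this
      have hC : C * Real.exp (-(2 / 5 * ‖ρ‖)) ≤ |C| * Real.exp (-(2 / 5 * ‖ρ‖)) := by
        gcongr; exact le_abs_self C
      rcases this with h | h
      · exact hb.1.trans (h.trans hC)
      · exact hb.2.trans (h.trans hC)
  · refine le_trans ?_ (mul_le_mul_of_nonneg_right (le_max_right _ _) he.le)
    have hR' : ‖ρ‖ ≤ |R| := hR.le.trans (le_abs_self R)
    rw [mul_assoc, ← Real.exp_add]
    refine (infDist_E_le_norm ρ).trans (hR'.trans (le_mul_of_one_le_right (abs_nonneg _) ?_))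
    exact Real.one_le_exp (by linarith)

/-! ### The zero bound -/

theorem zeroBound_iff {B : BoundaryConditions 3} {a τ : ℂ} (hτ : τ = 1 ∨ τ = -1)
    (ha : a = τ * Complex.I) {m X Z Y η : ℂ} {d : ℕ} (hm : m ≠ 0) (hη : η ^ 3 = 1)
    (hX : X * η = X) (h : ∀ ρ, B.charDet a (τ * ρ) = m * ρ ^ d * expSum X Z Y η ρ)
    (hX0 : Z = 0 → Y = 0 → X ≠ 0) : B.ZeroBound a ↔ ‖Y‖ ≤ ‖Z‖ := by
  have hττ : τ * τ = 1 := by rcases hτ with rfl | rfl <;> norm_num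
  have hτn : ‖τ‖ = 1 := by rcases hτ with rfl | rfl <;> norm_num
  have hτ0 : τ ≠ 0 := by rintro rfl; simp at hττ
  have hzero : ∀ ρ, ρ ≠ 0 → (B.charDet a (τ * ρ) = 0 ↔ expSum X Z Y η ρ = 0) := by
    intro ρ hρ
    rw [h, mul_eq_zero, or_iff_right (mul_ne_zero hm (pow_ne_zero d hρ))]
  have hdist : ∀ z, Metric.infDist (τ * z) (E 3 a) = Metric.infDist z (E 3 Complex.I) := fun z =>
    infDist_mul_eq hτn (by rw [ha]; linear_combination (Complex.I * (τ * τ + 1)) * hττ) z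
  by_cases hZY : Z = 0 ∧ Y = 0
  · obtain ⟨rfl, rfl⟩ := hZY
    refine ⟨fun _ => le_rfl, fun _ σ hσ => ?_⟩
    exfalso
    have h0 : σ 0 ∈ Set.range σ := ⟨0, rfl⟩
    rw [hσ.2.1] at h0
    obtain ⟨h1, h2⟩ := h0
    have e : τ * (τ * σ 0) = σ 0 := by rw [← mul_assoc, hττ, one_mul]
    rw [← e, hzero _ (mul_ne_zero hτ0 h1)] at h2
    simp [expSum] at h2
    exact hX0 rfl rfl h2
  obtain ⟨z₀, hz₀⟩ := exists_expSum_ne_zero (X := X) (Z := Z) (Y := Y) hη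
    (by by_contra! hc; exact hZY hc)
  obtain ⟨A, hA, hcount⟩ := exists_card_zeros_le (differentiable_expSum X Z Y η)
    (norm_expSum_le hη X Z Y) hz₀
  constructor
  · -- a listing of the zeros contains infinitely many which stay away from `E`
    intro hZB
    by_contra! hlt
    obtain ⟨δ, hδ, H⟩ := exists_zero_sector hη hlt X
    set S : Set ℂ := {ρ | ρ ≠ 0 ∧ B.charDet a ρ = 0} with hS
    have hmemS : ∀ {ρ}, ρ ≠ 0 → expSum X Z Y η ρ = 0 → τ * ρ ∈ S := fun hρ h0 =>
      ⟨mul_ne_zero hτ0 hρ, (hzero _ hρ).2 h0⟩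
    have hfin : ∀ R, (S ∩ {z | ‖z‖ ≤ R}).Finite := by
      intro R
      by_contra hinf
      obtain ⟨T, hTs, hTc⟩ := (show (S ∩ {z | ‖z‖ ≤ R}).Infinite from hinf).exists_subset_card_eq
        (⌊A * (1 + |R|)⌋₊ + 1)
      have := hcount R (T.image fun z => τ * z) (by
        intro σ hσ
        obtain ⟨z, hz, rfl⟩ := Finset.mem_image.1 hσ
        obtain ⟨⟨hz0, hz1⟩, hz2⟩ := hTs hz
        refine ⟨by rw [norm_mul, hτn, one_mul]; exact hz2, ?_⟩
        rw [← hzero _ (mul_ne_zero hτ0 hz0), ← mul_assoc, hττ, one_mul]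
        exact hz1)
      rw [Finset.card_image_of_injective _ (mul_right_injective₀ hτ0), hTc] at this
      push_cast at this
      linarith [Nat.lt_floor_add_one (A * (1 + |R|))]
    have hfar : ∀ R, ∃ z ∈ S, R < ‖z‖ ∧ δ ≤ Metric.infDist z (E 3 a) := by
      intro R
      obtain ⟨σ, h0, hR, h1, h2⟩ := H (|R| + 1)
      have hσ0 : σ ≠ 0 := by
        rintro rfl; simp at hR; linarith [abs_nonneg R]
      refine ⟨τ * σ, hmemS hσ0 h0, ?_, ?_⟩
      · rw [norm_mul, hτn, one_mul]; linarith [le_abs_self R]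
      · rw [hdist]; exact le_infDist_E_of_sector h1 h2
    have hinf : S.Infinite := by
      intro hf
      obtain ⟨R, hR⟩ := hf.isBounded.exists_norm_le
      obtain ⟨z, hz, hz', -⟩ := hfar R
      linarith [hR z hz]
    obtain ⟨σ, hσ1, hσ2, hσ3⟩ := exists_monotone_enumeration hinf hfin
    have hO := hZB σ ⟨hσ1, hσ2, hσ3⟩
    have hlim : Tendsto (fun k : ℕ => ((k : ℝ) ^ (3 - 1))⁻¹) atTop (𝓝 0) :=
      tendsto_inv_atTop_zero.comp ((tendsto_pow_atTop (by norm_num)).comp tendsto_natCast_atTop_atTop)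
    obtain ⟨N, hN⟩ := eventually_atTop.1 ((hO.trans_tendsto hlim).eventually_lt_const hδ)
    obtain ⟨z, hz, hzN, hzδ⟩ := hfar ‖σ N‖
    rw [← hσ2] at hz
    obtain ⟨k, rfl⟩ := hz
    have hk : N ≤ k := by
      by_contra! hk
      have : ‖σ k‖ ≤ ‖σ N‖ := hσ3 hk.le
      linarith
    linarith [hN k hk]
  · intro hYZ σ hσ
    have hZ : Z ≠ 0 := by
      rintro rfl
      rw [norm_zero, norm_le_zero_iff] at hYZ
      exact hZY ⟨rfl, hYZ⟩
    obtain ⟨C, hC⟩ := infDist_E_le_of_zero hη hX hZ hYZ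
    have hσmem : ∀ k, σ k ≠ 0 ∧ expSum X Z Y η (τ * σ k) = 0 := by
      intro k
      have h0 : σ k ∈ Set.range σ := ⟨k, rfl⟩
      rw [hσ.2.1] at h0
      refine ⟨h0.1, ?_⟩
      rw [← hzero _ (mul_ne_zero hτ0 h0.1), ← mul_assoc, hττ, one_mul]
      exact h0.2
    have hgrow : ∀ k : ℕ, (k : ℝ) ≤ A * (1 + ‖σ k‖) := by
      intro k
      have := hcount ‖σ k‖ ((Finset.range k).image fun j => τ * σ j) (by
        intro w hw
        obtain ⟨j, hj, rfl⟩ := Finset.mem_image.1 hw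
        refine ⟨?_, (hσmem j).2⟩
        rw [norm_mul, hτn, one_mul]
        exact hσ.2.2 (Finset.mem_range.1 hj).le)
      have hinj : Function.Injective fun j => τ * σ j := (mul_right_injective₀ hτ0).comp hσ.1
      rwa [Finset.card_image_of_injective _ hinj, Finset.card_range, abs_norm] at this
    have hdk : ∀ k, Metric.infDist (σ k) (E 3 a) ≤ C * Real.exp (-(2 / 5 * ‖σ k‖)) := by
      intro k
      have := hC (τ * σ k) (mul_ne_zero hτ0 (hσmem k).1) (hσmem k).2
      rw [← hdist, ← mul_assoc, hττ, one_mul, norm_mul, hτn, one_mul] at this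
      exact this
    -- `exp (-2|σ_k|/5)` decays exponentially in `k`
    refine Asymptotics.IsBigO.of_bound (|C| * (Real.exp (2 / 5) * (2 / (2 / (5 * A)) ^ 2)))
      (eventually_atTop.2 ⟨1, fun k hk => ?_⟩)
    have hk0 : (0 : ℝ) < k := by exact_mod_cast hk
    rw [Real.norm_of_nonneg Metric.infDist_nonneg, Real.norm_of_nonneg (by positivity)]
    refine (hdk k).trans ?_
    have e1 : Real.exp (-(2 / 5 * ‖σ k‖)) ≤ Real.exp (2 / 5) * Real.exp (-(2 / (5 * A) * k)) := by
      rw [← Real.exp_add]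
      apply Real.exp_le_exp.2
      have h1 := hgrow k
      have h2 : 2 / (5 * A) * (k : ℝ) ≤ 2 / (5 * A) * (A * (1 + ‖σ k‖)) := by gcongr
      have h3 : 2 / (5 * A) * (A * (1 + ‖σ k‖)) = 2 / 5 * (1 + ‖σ k‖) := by field_simp
      linarith
    have e2 : Real.exp (-(2 / (5 * A) * k)) ≤ 2 / (2 / (5 * A)) ^ 2 * ((k : ℝ) ^ 2)⁻¹ := by
      have hp : 0 < 2 / (5 * A) * k := by positivity
      have h1 := Real.quadratic_le_exp_of_nonneg hp.le
      rw [Real.exp_neg]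
      have h2 : (2 / (5 * A) * k) ^ 2 / 2 ≤ Real.exp (2 / (5 * A) * k) := by linarith
      refine (inv_anti₀ (by positivity) h2).trans_eq ?_
      field_simp
    calc C * Real.exp (-(2 / 5 * ‖σ k‖)) ≤ |C| * Real.exp (-(2 / 5 * ‖σ k‖)) := by
          gcongr; exact le_abs_self C
      _ ≤ |C| * (Real.exp (2 / 5) * (2 / (2 / (5 * A)) ^ 2 * ((k : ℝ) ^ 2)⁻¹)) := by
          gcongr
          exact e1.trans (by gcongr)
      _ = _ := by norm_num; ring

/-! ### The transform of the final function -/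

theorem continuousOn_fourier_integrand {q : ℝ → ℂ} (hq : ContinuousOn q (Set.Icc 0 1)) (ρ : ℂ) :
    ContinuousOn (fun x : ℝ => Complex.exp (-Complex.I * ρ * x) * q x) (Set.Icc 0 1) :=
  (by fun_prop : Continuous fun x : ℝ => Complex.exp (-Complex.I * ρ * x)).continuousOn.mul hq

theorem intervalIntegrable_of_Icc {f : ℝ → ℂ} (hf : ContinuousOn f (Set.Icc 0 1)) :
    IntervalIntegrable f MeasureTheory.volume 0 1 :=
  ContinuousOn.intervalIntegrable (by rwa [Set.uIcc_of_le zero_le_one])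

theorem norm_exp_neg_I_mul (ρ : ℂ) (x : ℝ) :
    ‖Complex.exp (-Complex.I * ρ * x)‖ = Real.exp (x * ρ.im) := by
  rw [Complex.norm_exp]
  congr 1
  simp
  ring

theorem norm_exp_neg_I_mul_le (ρ : ℂ) {x : ℝ} (h0 : 0 ≤ x) (h1 : x ≤ 1) :
    ‖Complex.exp (-Complex.I * ρ * x)‖ ≤ max 1 (Real.exp ρ.im) := by
  rw [norm_exp_neg_I_mul]
  rcases le_total 0 ρ.im with h | h
  · exact le_max_of_le_right (Real.exp_le_exp.2 (by nlinarith))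
  · exact le_max_of_le_left (Real.exp_le_one_iff.2 (mul_nonpos_of_nonneg_of_nonpos h0 h))

theorem differentiable_fourier {q : ℝ → ℂ} (hq : ContinuousOn q (Set.Icc 0 1)) :
    Differentiable ℂ (fourier q) := by
  intro ρ
  obtain ⟨C, hC⟩ := isCompact_Icc.exists_bound_of_continuousOn hq
  have hC0 : 0 ≤ C := (norm_nonneg _).trans (hC 0 ⟨le_rfl, zero_le_one⟩)
  have hI : ∀ {t : ℝ}, t ∈ Set.uIoc (0 : ℝ) 1 → t ∈ Set.Icc (0 : ℝ) 1 := fun ht => by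
    rw [Set.uIoc_of_le zero_le_one] at ht
    exact ⟨ht.1.le, ht.2⟩
  have hmeas : ∀ f : ℝ → ℂ, ContinuousOn f (Set.Icc 0 1) →
      MeasureTheory.AEStronglyMeasurable f (MeasureTheory.volume.restrict (Set.uIoc 0 1)) :=
    fun f hf => (hf.mono fun t ht => hI ht).aestronglyMeasurable measurableSet_uIoc
  have hc' : ContinuousOn
      (fun x : ℝ => -Complex.I * x * (Complex.exp (-Complex.I * ρ * x) * q x)) (Set.Icc 0 1) :=
    (by fun_prop : Continuous fun x : ℝ => -Complex.I * x).continuousOn.mul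
      (continuousOn_fourier_integrand hq ρ)
  refine (intervalIntegral.hasDerivAt_integral_of_dominated_loc_of_deriv_le
    (F := fun (z : ℂ) (x : ℝ) => Complex.exp (-Complex.I * z * x) * q x)
    (F' := fun (z : ℂ) (x : ℝ) => -Complex.I * x * (Complex.exp (-Complex.I * z * x) * q x))
    (bound := fun _ => Real.exp (‖ρ‖ + 1) * C) (s := Metric.ball ρ 1)
    (Metric.ball_mem_nhds ρ one_pos)
    (Eventually.of_forall fun z => hmeas _ (continuousOn_fourier_integrand hq z))
    (intervalIntegrable_of_Icc (continuousOn_fourier_integrand hq ρ)) (hmeas _ hc') ?_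
    intervalIntegrable_const ?_).2.differentiableAt
  · refine Eventually.of_forall fun t ht z hz => ?_
    have ht' := hI ht
    have hz' : ‖z‖ ≤ ‖ρ‖ + 1 := by
      have h1 := norm_sub_norm_le z ρ
      rw [Metric.mem_ball, dist_eq_norm] at hz
      linarith
    have h1 : ‖Complex.exp (-Complex.I * z * t)‖ ≤ Real.exp (‖ρ‖ + 1) := by
      rw [norm_exp_neg_I_mul]
      apply Real.exp_le_exp.2
      have := (Complex.abs_im_le_norm z).trans hz'
      nlinarith [ht'.1, ht'.2, le_abs_self z.im, abs_nonneg z.im]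
    have h2 : ‖-Complex.I * (t : ℂ)‖ ≤ 1 := by
      rw [norm_mul, norm_neg, Complex.norm_I, one_mul, Complex.norm_real, Real.norm_of_nonneg ht'.1]
      exact ht'.2
    rw [norm_mul, norm_mul (Complex.exp _)]
    have h3 := hC t ht'
    calc _ ≤ 1 * (Real.exp (‖ρ‖ + 1) * C) := by gcongr
      _ = _ := one_mul _
  · refine Eventually.of_forall fun t _ z _ => ?_
    have h1 : HasDerivAt (fun z : ℂ => -Complex.I * z * t) (-Complex.I * t) z := by
      simpa using ((hasDerivAt_id z).const_mul (-Complex.I)).mul_const (t : ℂ)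
    have h2 := (h1.cexp).mul_const (q t)
    exact h2.congr_deriv (by ring)

theorem fourier_by_parts {q q' : ℝ → ℂ} (hq : ContinuousOn q (Set.Icc 0 1))
    (hd : ∀ x ∈ Set.Ioo (0 : ℝ) 1, HasDerivAt q (q' x) x) (hq' : ContinuousOn q' (Set.Icc 0 1))
    (ρ : ℂ) :
    Complex.I * ρ * fourier q ρ = q 0 - Complex.exp (-Complex.I * ρ) * q 1 + fourier q' ρ := by
  have hE : ∀ x : ℝ, HasDerivAt (fun x : ℝ => Complex.exp (-Complex.I * ρ * x))
      (Complex.exp (-Complex.I * ρ * x) * (-Complex.I * ρ)) x := by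
    intro x
    have h1 : HasDerivAt (fun x : ℝ => -Complex.I * ρ * (x : ℂ)) (-Complex.I * ρ) x := by
      simpa using (Complex.ofRealCLM.hasDerivAt (x := x)).const_mul (-Complex.I * ρ)
    exact h1.cexp
  have i1 := intervalIntegrable_of_Icc (continuousOn_fourier_integrand hq ρ)
  have i2 := intervalIntegrable_of_Icc (continuousOn_fourier_integrand hq' ρ)
  have key := intervalIntegral.integral_eq_sub_of_hasDerivAt_of_le (zero_le_one (α := ℝ))
    (continuousOn_fourier_integrand hq ρ)
    (f' := fun x => (-Complex.I * ρ) * (Complex.exp (-Complex.I * ρ * x) * q x) +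
      Complex.exp (-Complex.I * ρ * x) * q' x)
    (fun x hx => ((hE x).fun_mul (hd x hx)).congr_deriv (by ring))
    ((i1.const_mul _).add i2)
  rw [intervalIntegral.integral_add (i1.const_mul _) i2, intervalIntegral.integral_const_mul] at key
  simp only [Complex.ofReal_one, Complex.ofReal_zero, mul_one, mul_zero, Complex.exp_zero,
    one_mul] at key
  simp only [fourier]
  linear_combination -key

theorem exists_norm_fourier_le {q : ℝ → ℂ} (hq : ContinuousOn q (Set.Icc 0 1)) :
    ∃ C, 0 ≤ C ∧ ∀ ρ, ‖fourier q ρ‖ ≤ C * max 1 (Real.exp ρ.im) := by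
  obtain ⟨C, hC⟩ := isCompact_Icc.exists_bound_of_continuousOn hq
  have hC0 : 0 ≤ C := (norm_nonneg _).trans (hC 0 ⟨le_rfl, zero_le_one⟩)
  refine ⟨C, hC0, fun ρ => ?_⟩
  have := intervalIntegral.norm_integral_le_of_norm_le_const (a := (0 : ℝ)) (b := 1)
    (f := fun x : ℝ => Complex.exp (-Complex.I * ρ * x) * q x) (C := C * max 1 (Real.exp ρ.im))
    (fun x hx => by
      rw [Set.uIoc_of_le zero_le_one] at hx
      rw [norm_mul, mul_comm]
      gcongr
      · exact hC x ⟨hx.1.le, hx.2⟩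
      · exact norm_exp_neg_I_mul_le ρ hx.1.le hx.2)
  simpa [fourier] using this

theorem exists_norm_fourier_mul_le {q : ℝ → ℂ} (hq : ContDiffOn ℝ (⊤ : ℕ∞) q (Set.Icc 0 1)) :
    ∃ C, 0 ≤ C ∧ ∀ ρ, ‖ρ‖ * ‖fourier q ρ‖ ≤ C * max 1 (Real.exp ρ.im) := by
  have hu : UniqueDiffOn ℝ (Set.Icc (0 : ℝ) 1) := uniqueDiffOn_Icc one_pos
  have hq' : ContinuousOn (derivWithin q (Set.Icc 0 1)) (Set.Icc 0 1) :=
    hq.continuousOn_derivWithin hu (by exact_mod_cast le_top)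
  obtain ⟨C, hC0, hC⟩ := exists_norm_fourier_le hq'
  refine ⟨‖q 0‖ + ‖q 1‖ + C, by positivity, fun ρ => ?_⟩
  have key := fourier_by_parts hq.continuousOn (q' := derivWithin q (Set.Icc 0 1)) (fun x hx => by
    have h1 : DifferentiableWithinAt ℝ q (Set.Icc 0 1) x :=
      (hq.differentiableOn (by simp)) x ⟨hx.1.le, hx.2.le⟩
    exact h1.hasDerivWithinAt.hasDerivAt (Icc_mem_nhds hx.1 hx.2)) hq' ρ
  have h1 : ‖ρ‖ * ‖fourier q ρ‖ = ‖Complex.I * ρ * fourier q ρ‖ := by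
    rw [norm_mul, norm_mul, Complex.norm_I, one_mul]
  rw [h1, key]
  have h2 : ‖Complex.exp (-Complex.I * ρ)‖ ≤ max 1 (Real.exp ρ.im) := by
    have := norm_exp_neg_I_mul_le ρ zero_le_one le_rfl
    simpa using this
  have h3 : (1 : ℝ) ≤ max 1 (Real.exp ρ.im) := le_max_left _ _
  calc _ ≤ ‖q 0‖ + ‖Complex.exp (-Complex.I * ρ)‖ * ‖q 1‖ + ‖fourier (derivWithin q (Set.Icc 0 1)) ρ‖ := by
        refine (norm_add_le _ _).trans ?_
        gcongr
        refine (norm_sub_le _ _).trans ?_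
        rw [norm_mul]
    _ ≤ ‖q 0‖ * max 1 (Real.exp ρ.im) + max 1 (Real.exp ρ.im) * ‖q 1‖ +
        C * max 1 (Real.exp ρ.im) := by
        gcongr
        · exact le_mul_of_one_le_right (norm_nonneg _) h3
        · exact hC ρ
    _ = _ := by ring

theorem fourier_reflect (q : ℝ → ℂ) (ρ : ℂ) :
    fourier q (-ρ) = Complex.exp (Complex.I * ρ) * fourier (fun x => q (1 - x)) ρ := by
  have h := intervalIntegral.integral_comp_sub_left (a := (0 : ℝ)) (b := 1)
    (fun x : ℝ => Complex.exp (-Complex.I * (-ρ) * x) * q x) 1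
  simp only [sub_self, sub_zero] at h
  rw [fourier, ← h, fourier, ← intervalIntegral.integral_const_mul]
  refine intervalIntegral.integral_congr fun x _ => ?_
  rw [← mul_assoc, ← Complex.exp_add]
  push_cast
  ring_nf

/-! ### The characteristic matrix without its monomial factors -/

/-- The `3 × 3` determinant with rows `α`, `zβ`, `z²γ`. -/
def rowDet (z α β γ : Fin 3 → ℂ) : ℂ :=
  (Matrix.of ![fun l => α l, fun l => z l * β l, fun l => z l ^ 2 * γ l]).det

theorem rowDet_eq (z α β γ : Fin 3 → ℂ) : rowDet z α β γ =
    α 0 * (z 1 * β 1) * (z 2 ^ 2 * γ 2) - α 0 * (z 2 * β 2) * (z 1 ^ 2 * γ 1)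
    - α 1 * (z 0 * β 0) * (z 2 ^ 2 * γ 2) + α 1 * (z 2 * β 2) * (z 0 ^ 2 * γ 0)
    + α 2 * (z 0 * β 0) * (z 1 ^ 2 * γ 1) - α 2 * (z 1 * β 1) * (z 0 ^ 2 * γ 0) := by
  rw [rowDet, Matrix.det_fin_three]
  simp

/-- Multiplying the columns by cube roots of unity permutes the rows cyclically. -/
theorem prod_mul_rowDet {z : Fin 3 → ℂ} (hz : ∀ l, z l ^ 3 = 1) (α β γ : Fin 3 → ℂ) :
    z 0 * z 1 * z 2 * rowDet z α β γ = rowDet z γ α β := by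
  simp only [rowDet_eq]
  linear_combination
    γ 2 * (α 0 * z 0 * z 1 ^ 2 * β 1 - α 1 * z 1 * z 0 ^ 2 * β 0) * hz 2 +
    γ 1 * (α 2 * z 2 * z 0 ^ 2 * β 0 - α 0 * z 0 * z 2 ^ 2 * β 2) * hz 1 +
    γ 0 * (α 1 * z 1 * z 2 ^ 2 * β 2 - α 2 * z 2 * z 1 ^ 2 * β 1) * hz 0

/-- The characteristic matrix after its `l`-th column has been divided by a monomial: the boundary
value without pivot in column `l` has order `2 - p l`, and together with what the boundary conditions
tie to it, it enters the global relation with the factor `x l * exp (-iρ) + y l`. -/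
def colMatrix (p : Fin 3 → ℕ) (x y : Fin 3 → ℂ) (ρ : ℂ) : Matrix (Fin 3) (Fin 3) ℂ :=
  Matrix.of fun k l => omega 3 ^ (k.val * p l) * (x l * wave k.val (-ρ) + y l)

/-- The cube roots of unity that belong to the exponents `p`. -/
def root (p : Fin 3 → ℕ) (l : Fin 3) : ℂ := omega 3 ^ p l

theorem root_cube (p : Fin 3 → ℕ) (l : Fin 3) : root p l ^ 3 = 1 := by
  rw [root, ← pow_mul, mul_comm, pow_mul, omega_cube, one_pow]

/-- The coefficient of `exp (iρ)` in the characteristic determinant; its rows are the dominant parts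
of the rows of `colMatrix` where `exp (-iρ)` is small and `exp (-iωρ)`, `exp (-iω²ρ)` are large. -/
def leadCoeff (p : Fin 3 → ℕ) (x y : Fin 3 → ℂ) : ℂ := rowDet (root p) y x x

/-- The constant term of the characteristic determinant. -/
def constCoeff (p : Fin 3 → ℕ) (x y : Fin 3 → ℂ) : ℂ :=
  rowDet (root p) x x x + rowDet (root p) y y y

theorem constCoeff_swap (p : Fin 3 → ℕ) (x y : Fin 3 → ℂ) :
    constCoeff p y x = constCoeff p x y := add_comm _ _

/-- The factor `ω ^ (p 0 + p 1 + p 2)` by which the three exponentials differ. -/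
def twist (p : Fin 3 → ℕ) : ℂ := root p 0 * root p 1 * root p 2

theorem twist_cube (p : Fin 3 → ℕ) : twist p ^ 3 = 1 := by
  rw [twist, mul_pow, mul_pow, root_cube, root_cube, root_cube]; norm_num

theorem constCoeff_mul_twist (p : Fin 3 → ℕ) (x y : Fin 3 → ℂ) :
    constCoeff p x y * twist p = constCoeff p x y := by
  rw [constCoeff, mul_comm, twist, mul_add, prod_mul_rowDet (root_cube p),
    prod_mul_rowDet (root_cube p)]

theorem colMatrix_eq (p : Fin 3 → ℕ) (x y : Fin 3 → ℂ) (ρ : ℂ) (k l : Fin 3) :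
    colMatrix p x y ρ k l = root p l ^ k.val * (x l * wave k.val (-ρ) + y l) := by
  rw [colMatrix, Matrix.of_apply, root, ← pow_mul, mul_comm (p l)]

theorem wave_neg_zero_eq (ρ : ℂ) : wave 0 ρ = wave 1 (-ρ) * wave 2 (-ρ) := by
  linear_combination -wave 0 ρ * wave_prod (-ρ) + wave 1 (-ρ) * wave 2 (-ρ) * wave_mul_neg 0 ρ

theorem wave_neg_one_eq (ρ : ℂ) : wave 1 ρ = wave 0 (-ρ) * wave 2 (-ρ) := by
  linear_combination -wave 1 ρ * wave_prod (-ρ) + wave 0 (-ρ) * wave 2 (-ρ) * wave_mul_neg 1 ρ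

theorem wave_neg_two_eq (ρ : ℂ) : wave 2 ρ = wave 0 (-ρ) * wave 1 (-ρ) := by
  linear_combination -wave 2 ρ * wave_prod (-ρ) + wave 0 (-ρ) * wave 1 (-ρ) * wave_mul_neg 2 ρ

theorem det_colMatrix (p : Fin 3 → ℕ) (x y : Fin 3 → ℂ) (ρ : ℂ) :
    (colMatrix p x y ρ).det =
      expSum (constCoeff p x y) (leadCoeff p x y) (leadCoeff p y x) (twist p) ρ := by
  have hz := root_cube p
  have a1 := prod_mul_rowDet hz y x x
  have a2 := prod_mul_rowDet hz x y x
  have b1 := prod_mul_rowDet hz x y y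
  have b2 := prod_mul_rowDet hz y x y
  have e3 := wave_prod (-ρ)
  have h : (colMatrix p x y ρ).det = rowDet (root p) (fun l => x l * wave 0 (-ρ) + y l)
      (fun l => x l * wave 1 (-ρ) + y l) (fun l => x l * wave 2 (-ρ) + y l) := by
    rw [rowDet]
    congr 1
    ext k l
    rw [colMatrix_eq]
    fin_cases k <;> simp
  rw [h]
  simp only [expSum, Finset.sum_range_succ, Finset.sum_range_zero, constCoeff, leadCoeff, twist,
    wave_neg_zero_eq ρ, wave_neg_one_eq ρ, wave_neg_two_eq ρ]
  have hexp : rowDet (root p) (fun l => x l * wave 0 (-ρ) + y l)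
      (fun l => x l * wave 1 (-ρ) + y l) (fun l => x l * wave 2 (-ρ) + y l) =
      wave 0 (-ρ) * wave 1 (-ρ) * wave 2 (-ρ) * rowDet (root p) x x x + rowDet (root p) y y y +
      wave 0 (-ρ) * rowDet (root p) x y y + wave 1 (-ρ) * rowDet (root p) y x y +
      wave 2 (-ρ) * rowDet (root p) y y x + wave 1 (-ρ) * wave 2 (-ρ) * rowDet (root p) y x x +
      wave 0 (-ρ) * wave 2 (-ρ) * rowDet (root p) x y x +
      wave 0 (-ρ) * wave 1 (-ρ) * rowDet (root p) x x y := by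
    simp only [rowDet_eq]; ring
  rw [hexp]
  linear_combination rowDet (root p) x x x * e3 - wave 0 (-ρ) * wave 2 (-ρ) * a1 -
    wave 0 (-ρ) * wave 1 (-ρ) * (a2 + root p 0 * root p 1 * root p 2 * a1)
    - wave 1 (-ρ) * b1 - wave 2 (-ρ) * (b2 + root p 0 * root p 1 * root p 2 * b1)

theorem colMatrix_neg (p : Fin 3 → ℕ) (x y : Fin 3 → ℂ) (ρ : ℂ) :
    colMatrix p x y (-ρ) = Matrix.of fun k l => wave k.val ρ * colMatrix p y x ρ k l := by
  ext k l
  simp only [colMatrix, Matrix.of_apply, neg_neg]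
  linear_combination -omega 3 ^ (k.val * p l) * y l * wave_mul_neg k.val ρ

/-- The transforms of the final function at `ρ, ωρ, ω²ρ`. -/
def fourierVec (q : ℝ → ℂ) (ρ : ℂ) (k : Fin 3) : ℂ := fourier q (omega 3 ^ k.val * ρ)

theorem fourierVec_neg (q : ℝ → ℂ) (ρ : ℂ) (k : Fin 3) :
    fourierVec q (-ρ) k = wave k.val ρ * fourierVec (fun x => q (1 - x)) ρ k := by
  rw [fourierVec, mul_neg, fourier_reflect, fourierVec, wave, mul_assoc Complex.I]

/-- Reflecting `[0, 1]` exchanges the roles of `x` and `y` and of `ρ` and `-ρ`. -/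
theorem cramer_colMatrix_neg (p : Fin 3 → ℕ) (x y : Fin 3 → ℂ) (q : ℝ → ℂ) (ρ : ℂ) (l : Fin 3) :
    (colMatrix p x y (-ρ)).cramer (fourierVec q (-ρ)) l =
      (colMatrix p y x ρ).cramer (fourierVec (fun x => q (1 - x)) ρ) l := by
  rw [Matrix.cramer_apply, Matrix.cramer_apply, colMatrix_neg]
  have h : (Matrix.of fun k l => wave k.val ρ * colMatrix p y x ρ k l).updateCol l
      (fourierVec q (-ρ)) = Matrix.of fun k l' => wave (Fin.val k) ρ *
        (colMatrix p y x ρ).updateCol l (fourierVec (fun x => q (1 - x)) ρ) k l' := by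
    ext k l'
    by_cases hl : l' = l
    · subst hl; simp [fourierVec_neg]
    · simp [Matrix.updateCol_ne hl]
  rw [h, Matrix.det_mul_column (fun k : Fin 3 => wave k.val ρ), Fin.prod_univ_three]
  simp [wave_prod]

theorem norm_det_le {M : Matrix (Fin 3) (Fin 3) ℂ} {b : Fin 3 → ℝ} (h : ∀ k l, ‖M k l‖ ≤ b k) :
    ‖M.det‖ ≤ 6 * ∏ k, b k := by
  rw [Matrix.det_apply']
  have h1 : ∀ σ ∈ (Finset.univ : Finset (Equiv.Perm (Fin 3))),
      ‖((Equiv.Perm.sign σ : ℤ) : ℂ) * ∏ i, M (σ i) i‖ ≤ ∏ k, b k := by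
    intro σ _
    have hs : ‖((Equiv.Perm.sign σ : ℤ) : ℂ)‖ = 1 := by
      rcases Int.units_eq_one_or (Equiv.Perm.sign σ) with h | h <;> simp [h]
    rw [norm_mul, hs, one_mul, norm_prod, ← Equiv.prod_comp σ b]
    exact Finset.prod_le_prod (fun _ _ => norm_nonneg _) fun i _ => h (σ i) i
  have h2 := norm_sum_le_of_le _ h1
  rw [Finset.sum_const, Finset.card_univ, Fintype.card_perm, Fintype.card_fin] at h2
  simpa [Nat.factorial] using h2

/-- Replacing a column by transforms of a smooth function gains a factor `1 / |ρ|` over the common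
scale of the rows. -/
theorem exists_norm_cramer_le (p : Fin 3 → ℕ) (x y : Fin 3 → ℂ) {q : ℝ → ℂ}
    (hq : ContDiffOn ℝ (⊤ : ℕ∞) q (Set.Icc 0 1)) :
    ∃ C, 0 ≤ C ∧ ∀ ρ l,
      ‖ρ‖ * ‖(colMatrix p x y ρ).cramer (fourierVec q ρ) l‖ ≤ C * rowScale ρ := by
  obtain ⟨C, hC0, hC⟩ := exists_norm_fourier_mul_le hq
  set S := C + ∑ l, (‖x l‖ + ‖y l‖) with hS
  have hS0 : 0 ≤ S := by positivity
  refine ⟨6 * S ^ 3, by positivity, fun ρ l => ?_⟩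
  have hw : ∀ k : ℕ, ‖wave k (-ρ)‖ = Real.exp (omega 3 ^ k * ρ).im := fun k => by
    rw [norm_wave, height_neg, neg_neg, height]
  have hent : ∀ k l' : Fin 3, ‖(colMatrix p x y ρ).updateCol l ((ρ : ℂ) • fourierVec q ρ) k l'‖ ≤
      S * max 1 ‖wave k.val (-ρ)‖ := by
    intro k l'
    by_cases hl : l' = l
    · subst hl
      rw [Matrix.updateCol_self, Pi.smul_apply, smul_eq_mul, norm_mul, hw, fourierVec]
      have h1 := hC (omega 3 ^ k.val * ρ)
      rw [norm_mul, norm_pow, norm_omega, one_pow, one_mul] at h1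
      refine h1.trans ?_
      gcongr
      rw [hS]
      have : 0 ≤ ∑ l, (‖x l‖ + ‖y l‖) := by positivity
      linarith
    · rw [Matrix.updateCol_ne hl, colMatrix, Matrix.of_apply, norm_mul, norm_pow, norm_omega, one_pow,
        one_mul]
      refine (norm_add_le _ _).trans ?_
      rw [norm_mul]
      have h1 : ‖x l'‖ + ‖y l'‖ ≤ S := by
        have := Finset.single_le_sum (f := fun l => ‖x l‖ + ‖y l‖) (fun _ _ => by positivity)
          (Finset.mem_univ l')
        linarith
      calc ‖x l'‖ * ‖wave k.val (-ρ)‖ + ‖y l'‖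
          ≤ ‖x l'‖ * max 1 ‖wave k.val (-ρ)‖ + ‖y l'‖ * max 1 ‖wave k.val (-ρ)‖ := by
            gcongr
            · exact le_max_right _ _
            · exact le_mul_of_one_le_right (norm_nonneg _) (le_max_left _ _)
        _ = (‖x l'‖ + ‖y l'‖) * max 1 ‖wave k.val (-ρ)‖ := by ring
        _ ≤ _ := by gcongr
  have h1 := norm_det_le hent
  rw [Matrix.det_updateCol_smul, norm_mul, ← Matrix.cramer_apply, Finset.prod_mul_distrib,
    Finset.prod_const, Finset.card_univ, Fintype.card_fin] at h1
  rw [rowScale, ← Fin.prod_univ_eq_prod_range (fun k => max 1 ‖wave k (-ρ)‖) 3]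
  linarith

theorem differentiable_cramer (p : Fin 3 → ℕ) (x y : Fin 3 → ℂ) {q : ℝ → ℂ}
    (hq : ContinuousOn q (Set.Icc 0 1)) (l : Fin 3) :
    Differentiable ℂ fun ρ => (colMatrix p x y ρ).cramer (fourierVec q ρ) l := by
  have hent : ∀ k l' : Fin 3, Differentiable ℂ fun ρ =>
      (colMatrix p x y ρ).updateCol l (fourierVec q ρ) k l' := by
    intro k l'
    by_cases hl : l' = l
    · subst hl
      simp only [Matrix.updateCol_self, fourierVec]
      exact (differentiable_fourier hq).comp (differentiable_id.const_mul _)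
    · simp only [Matrix.updateCol_ne hl, colMatrix, Matrix.of_apply]
      exact ((((differentiable_wave k.val).comp differentiable_neg).const_mul _).add_const _).const_mul _
  simp only [Matrix.cramer_apply, Matrix.det_apply']
  exact Differentiable.fun_sum fun σ _ =>
    (Differentiable.fun_finsetProd fun i _ => hent (σ i) i).const_mul _

/-! ### A ray in `D` away from the zeros -/

/-- A ray inside the sector of `D` around `-i`, off its axis: the heights of the point with parameter
`t` are `-3t`, `t` and `2t`. The axis itself would not do, as the zeros may accumulate along it. -/
def ray (t : ℝ) : ℂ := ⟨-t / Real.sqrt 3, -3 * t⟩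

theorem height_zero_ray (t : ℝ) : height 0 (ray t) = -3 * t := by rw [height_zero, ray]

theorem height_one_ray (t : ℝ) : height 1 (ray t) = t := by
  rw [height_one, ray]
  field_simp
  ring

theorem height_two_ray (t : ℝ) : height 2 (ray t) = 2 * t := by
  rw [height_two, ray]
  field_simp
  ring

theorem ray_mem_D {t : ℝ} (ht : 0 < t) : ray t ∈ D 3 Complex.I := by
  rw [mem_D_I, height_zero_ray, height_one_ray, height_two_ray]
  nlinarith [mul_pos (mul_pos ht ht) ht]

theorem le_norm_ray (t : ℝ) : t ≤ ‖ray t‖ := by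
  have := (le_abs_self _).trans (abs_height_le 1 (ray t))
  rwa [height_one_ray] at this

theorem norm_ray_le {t : ℝ} (ht : 0 ≤ t) : ‖ray t‖ ≤ 4 * t := by
  have h := sum_height_sq (ray t)
  rw [height_zero_ray, height_one_ray, height_two_ray] at h
  refine (abs_le_of_sq_le_sq' ?_ (by positivity)).2
  nlinarith [sq_nonneg t]

theorem ray_ne_zero {t : ℝ} (ht : 0 < t) : ray t ≠ 0 :=
  norm_pos_iff.1 (ht.trans_le (le_norm_ray t))

theorem tendsto_norm_ray : Tendsto (fun t => ‖ray t‖) atTop atTop :=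
  tendsto_atTop_mono le_norm_ray tendsto_id

theorem tendsto_pow_mul_ray {f : ℝ → ℂ} (hf : ∀ t, 0 ≤ t → ‖f t‖ ≤ Real.exp (-t)) (n : ℕ) :
    Tendsto (fun t => (Complex.I * ray t) ^ n * f t) atTop (𝓝 0) := by
  have h := (Real.tendsto_pow_mul_exp_neg_atTop_nhds_zero n).const_mul ((4 : ℝ) ^ n)
  rw [mul_zero] at h
  refine squeeze_zero_norm' (eventually_atTop.2 ⟨0, fun t ht => ?_⟩) h
  rw [norm_mul, norm_pow, norm_mul, Complex.norm_I, one_mul, ← mul_assoc, ← mul_pow]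
  have := norm_ray_le ht
  have := hf t ht
  gcongr

theorem norm_wave_zero_neg_ray {t : ℝ} (ht : 0 ≤ t) : ‖wave 0 (-ray t)‖ ≤ Real.exp (-t) := by
  rw [norm_wave, height_neg, height_zero_ray]
  exact Real.exp_le_exp.2 (by linarith)

theorem norm_wave_one_ray {t : ℝ} (_ht : 0 ≤ t) : ‖wave 1 (ray t)‖ ≤ Real.exp (-t) := by
  rw [norm_wave, height_one_ray]

theorem norm_wave_two_ray {t : ℝ} (ht : 0 ≤ t) : ‖wave 2 (ray t)‖ ≤ Real.exp (-t) := by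
  rw [norm_wave, height_two_ray]
  exact Real.exp_le_exp.2 (by linarith)

/-- Without the terms `exp (iωᵏρ)`, the term `exp (-iω²ρ)` dominates along the ray. -/
theorem expSum_ne_zero_near_ray {X Y η : ℂ} (hη : η ^ 3 = 1) (h : Y = 0 → X ≠ 0) :
    ∃ T, ∀ t, T ≤ t → ∀ w, dist w (ray t) ≤ 1 / 2 → expSum X 0 Y η w ≠ 0 := by
  by_cases hY : Y = 0
  · subst hY
    exact ⟨0, fun t _ w _ => by simpa [expSum] using h rfl⟩
  have hY' := norm_pos_iff.2 hY
  have hn := norm_eta hη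
  obtain ⟨T, hT⟩ := exists_exp_le (8 * ‖Y‖ + 2 * ‖X‖) (c := 1) one_pos (half_pos hY')
  refine ⟨max T 0, fun t ht w hw h0 => ?_⟩
  have ht0 : 0 ≤ t := (le_max_right _ _).trans ht
  have hsm := hT t ((le_max_left _ _).trans ht)
  rw [one_mul] at hsm
  have hw' : dist (-w) (-ray t) ≤ 1 / 2 := by rwa [dist_neg_neg]
  have b0 := norm_wave_le_of_dist (k := 0) hw'
  have b1 := norm_wave_le_of_dist (k := 1) hw'
  have b2 := norm_wave_le_of_dist (k := 2) hw
  rw [height_neg, height_zero_ray, neg_neg] at b0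
  rw [height_neg, height_one_ray, neg_neg] at b1
  rw [height_two_ray] at b2
  have e2 := wave_mul_neg 2 w
  have key : η ^ 2 * Y = -(η * Y * (wave 1 (-w) * wave 2 w) + Y * (wave 0 (-w) * wave 2 w) +
      X * wave 2 w) := by
    simp only [expSum, Finset.sum_range_succ, Finset.sum_range_zero] at h0
    linear_combination wave 2 w * h0 - η ^ 2 * Y * e2
  have n1 : ‖wave 1 (-w) * wave 2 w‖ ≤ 4 * Real.exp (-t) := by
    rw [norm_mul]
    calc _ ≤ 2 * Real.exp t * (2 * Real.exp (-(2 * t))) := by gcongr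
      _ = 4 * (Real.exp t * Real.exp (-(2 * t))) := by ring
      _ = _ := by rw [← Real.exp_add]; congr 2; ring
  have n2 : ‖wave 2 w‖ ≤ 2 * Real.exp (-t) := by
    refine b2.trans ?_
    gcongr; linarith
  have n0 : ‖wave 0 (-w) * wave 2 w‖ ≤ 4 * Real.exp (-t) := by
    rw [norm_mul]
    have : Real.exp (-3 * t) ≤ 1 := Real.exp_le_one_iff.2 (by linarith)
    calc _ ≤ 2 * 1 * (2 * Real.exp (-t)) := by
          gcongr
          exact b0.trans (by linarith)
      _ = _ := by ring
  have hle : ‖Y‖ ≤ ‖Y‖ / 2 := by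
    calc ‖Y‖ = ‖η ^ 2 * Y‖ := by rw [norm_mul, norm_pow, hn, one_pow, one_mul]
      _ ≤ ‖Y‖ * (4 * Real.exp (-t)) + ‖Y‖ * (4 * Real.exp (-t)) + ‖X‖ * (2 * Real.exp (-t)) := by
        rw [key, norm_neg]
        refine (norm_add_le _ _).trans ?_
        refine add_le_add ((norm_add_le _ _).trans (add_le_add ?_ ?_)) ?_
        · rw [norm_mul, norm_mul η, hn, one_mul]; gcongr
        · rw [norm_mul]; gcongr
        · rw [norm_mul]; gcongr
      _ = (8 * ‖Y‖ + 2 * ‖X‖) * Real.exp (-t) := by ring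
      _ ≤ _ := hsm
  linarith

/-! ### Transforms of the test functions -/

theorem fourier_const (b ρ : ℂ) :
    Complex.I * ρ * fourier (fun _ => b) ρ = b * (1 - Complex.exp (-Complex.I * ρ)) := by
  rw [fourier_by_parts (q := fun _ => b) (q' := fun _ => 0) continuousOn_const
    (fun x _ => hasDerivAt_const x b) continuousOn_const]
  simp [fourier]
  ring

theorem hasDerivAt_ofReal' (x : ℝ) : HasDerivAt (fun x : ℝ => (x : ℂ)) 1 x :=
  Complex.ofRealCLM.hasDerivAt (x := x)

theorem fourier_one_sub (ρ : ℂ) :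
    (Complex.I * ρ) ^ 2 * fourier (fun x => 1 - (x : ℂ)) ρ =
      Complex.I * ρ - (1 - Complex.exp (-Complex.I * ρ)) := by
  have h := fourier_by_parts (q := fun x : ℝ => 1 - (x : ℂ)) (q' := fun _ => -1)
    (by fun_prop) (fun x _ => by simpa using (hasDerivAt_ofReal' x).const_sub 1)
    continuousOn_const ρ
  have h1 := fourier_const (-1) ρ
  push_cast at h
  linear_combination Complex.I * ρ * h + h1

theorem fourier_parabola (ρ : ℂ) :
    (Complex.I * ρ) ^ 3 * fourier (fun x => (x : ℂ) - (x : ℂ) ^ 2) ρ =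
      Complex.I * ρ * (1 + Complex.exp (-Complex.I * ρ)) -
        2 * (1 - Complex.exp (-Complex.I * ρ)) := by
  have h := fourier_by_parts (q := fun x : ℝ => (x : ℂ) - (x : ℂ) ^ 2)
    (q' := fun x : ℝ => 1 - 2 * (x : ℂ)) (by fun_prop) (fun x _ => by
      have := (hasDerivAt_ofReal' x).fun_sub ((hasDerivAt_ofReal' x).fun_pow 2)
      exact this.congr_deriv (by simp)) (by fun_prop) ρ
  have h' := fourier_by_parts (q := fun x : ℝ => 1 - 2 * (x : ℂ)) (q' := fun _ => -2) (by fun_prop)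
    (fun x _ => by simpa using ((hasDerivAt_ofReal' x).const_mul 2).const_sub 1)
    continuousOn_const ρ
  have h1 := fourier_const (-2) ρ
  push_cast at h h'
  linear_combination (Complex.I * ρ) ^ 2 * h + Complex.I * ρ * h' + h1

theorem exp_neg_I_omega (k : ℕ) (ρ : ℂ) :
    Complex.exp (-Complex.I * (omega 3 ^ k * ρ)) = wave k (-ρ) := by
  rw [wave]; ring_nf

/-! ### Well-conditioning -/

/-- A linear combination of the three transforms, taken with the size they have along the ray. -/
def combo (v : Fin 3 → ℂ) (q : ℝ → ℂ) (ρ : ℂ) : ℂ :=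
  v 0 * fourierVec q ρ 0 + v 1 * wave 1 ρ * fourierVec q ρ 1 + v 2 * wave 2 ρ * fourierVec q ρ 2

/-- If `v` annihilates the dominant parts of the rows, then combining the rows of the linear system
`N ξ = q̂` according to `v` leaves only exponentially small coefficients. -/
theorem tendsto_combo {p : Fin 3 → ℕ} {x y : Fin 3 → ℂ} {v : Fin 3 → ℂ}
    (hv : ∀ l, v 0 * y l + v 1 * (root p l * x l) + v 2 * (root p l ^ 2 * x l) = 0) {q : ℝ → ℂ}
    {ξ : ℝ → Fin 3 → ℂ} (hξ : ∀ l, Tendsto (fun t => ξ t l) atTop (𝓝 0))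
    (hsys : ∀ᶠ t in atTop, (colMatrix p x y (ray t)).mulVec (ξ t) = fourierVec q (ray t)) (n : ℕ) :
    Tendsto (fun t => (Complex.I * ray t) ^ n * combo v q (ray t)) atTop (𝓝 0) := by
  have h0 := tendsto_pow_mul_ray (f := fun t => wave 0 (-ray t)) (fun t => norm_wave_zero_neg_ray) n
  have h1 := tendsto_pow_mul_ray (f := fun t => wave 1 (ray t)) (fun t => norm_wave_one_ray) n
  have h2 := tendsto_pow_mul_ray (f := fun t => wave 2 (ray t)) (fun t => norm_wave_two_ray) n
  have hlim : Tendsto (fun t => ∑ l, (v 0 * x l * ((Complex.I * ray t) ^ n * wave 0 (-ray t)) +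
      v 1 * (root p l * y l) * ((Complex.I * ray t) ^ n * wave 1 (ray t)) +
      v 2 * (root p l ^ 2 * y l) * ((Complex.I * ray t) ^ n * wave 2 (ray t))) * ξ t l) atTop
      (𝓝 (∑ l : Fin 3, (v 0 * x l * 0 + v 1 * (root p l * y l) * 0 +
        v 2 * (root p l ^ 2 * y l) * 0) * 0)) :=
    tendsto_finsetSum _ fun l _ => (((h0.const_mul _).add (h1.const_mul _)).add
      (h2.const_mul _)).mul (hξ l)
  simp only [mul_zero, Finset.sum_const_zero] at hlim
  refine hlim.congr' (hsys.mono fun t ht => ?_)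
  have hk : ∀ k, fourierVec q (ray t) k = ∑ l, colMatrix p x y (ray t) k l * ξ t l := fun k => by
    rw [← ht]; rfl
  simp only [combo]
  rw [hk, hk, hk]
  simp only [Fin.sum_univ_three, colMatrix_eq]
  have e1 := wave_mul_neg 1 (ray t)
  have e2 := wave_mul_neg 2 (ray t)
  simp only [Fin.isValue, Fin.val_zero, Fin.val_one, Fin.val_two, pow_zero, pow_one, one_mul]
  linear_combination (-(Complex.I * ray t) ^ n) * (
    ξ t 0 * hv 0 + ξ t 1 * hv 1 + ξ t 2 * hv 2 +
    v 1 * (root p 0 * x 0 * ξ t 0 + root p 1 * x 1 * ξ t 1 + root p 2 * x 2 * ξ t 2) * e1 +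
    v 2 * (root p 0 ^ 2 * x 0 * ξ t 0 + root p 1 ^ 2 * x 1 * ξ t 1 + root p 2 ^ 2 * x 2 * ξ t 2) * e2)

theorem tendsto_inv_ray : Tendsto (fun t => (Complex.I * ray t)⁻¹) atTop (𝓝 0) := by
  refine tendsto_zero_iff_norm_tendsto_zero.2 ?_
  simp only [norm_inv, norm_mul, Complex.norm_I, one_mul]
  exact tendsto_inv_atTop_zero.comp tendsto_norm_ray

theorem omega_pow_cube (k : ℕ) : (omega 3 ^ k) ^ 3 = 1 := by
  rw [← pow_mul, mul_comm, pow_mul, omega_cube, one_pow]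

theorem fourierVec_one_ray {t : ℝ} (k : Fin 3) :
    (Complex.I * ray t) ^ 1 * fourierVec (fun _ => 1) (ray t) k =
      (omega 3 ^ k.val) ^ 2 * (1 - wave k.val (-ray t)) := by
  have f := fourier_const 1 (omega 3 ^ k.val * ray t)
  rw [exp_neg_I_omega] at f
  rw [fourierVec]
  linear_combination (omega 3 ^ k.val) ^ 2 * f - Complex.I * ray t *
    fourier (fun _ => 1) (omega 3 ^ k.val * ray t) * omega_pow_cube k.val

theorem fourierVec_one_sub_ray {t : ℝ} (ht : 0 < t) (k : Fin 3) :
    (Complex.I * ray t) ^ 1 * fourierVec (fun x => 1 - (x : ℂ)) (ray t) k =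
      (omega 3 ^ k.val) ^ 2 -
        omega 3 ^ k.val * (1 - wave k.val (-ray t)) * (Complex.I * ray t)⁻¹ := by
  have hne : Complex.I * ray t ≠ 0 := mul_ne_zero Complex.I_ne_zero (ray_ne_zero ht)
  have f := fourier_one_sub (omega 3 ^ k.val * ray t)
  rw [exp_neg_I_omega] at f
  rw [fourierVec, eq_sub_iff_add_eq, ← mul_left_inj' hne, add_mul, inv_mul_cancel_right₀ hne]
  linear_combination omega 3 ^ k.val * f - (Complex.I * ray t) ^ 2 *
    fourier (fun x => 1 - (x : ℂ)) (omega 3 ^ k.val * ray t) * omega_pow_cube k.val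

theorem fourierVec_parabola_ray {t : ℝ} (ht : 0 < t) (k : Fin 3) :
    (Complex.I * ray t) ^ 2 * fourierVec (fun x => (x : ℂ) - (x : ℂ) ^ 2) (ray t) k =
      omega 3 ^ k.val * (1 + wave k.val (-ray t)) -
        2 * (1 - wave k.val (-ray t)) * (Complex.I * ray t)⁻¹ := by
  have hne : Complex.I * ray t ≠ 0 := mul_ne_zero Complex.I_ne_zero (ray_ne_zero ht)
  have f := fourier_parabola (omega 3 ^ k.val * ray t)
  rw [exp_neg_I_omega] at f
  rw [fourierVec, eq_sub_iff_add_eq, ← mul_left_inj' hne, add_mul, inv_mul_cancel_right₀ hne]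
  linear_combination f - (Complex.I * ray t) ^ 3 *
    fourier (fun x => (x : ℂ) - (x : ℂ) ^ 2) (omega 3 ^ k.val * ray t) * omega_pow_cube k.val

/-- The limits of the combinations for `1 - x`, `1` and `x - x²` determine the coefficients. -/
theorem eq_zero_of_tendsto_combo {v : Fin 3 → ℂ}
    (h : ∀ q : ℝ → ℂ, ContDiffOn ℝ (⊤ : ℕ∞) q (Set.Icc 0 1) → ∀ n : ℕ,
      Tendsto (fun t => (Complex.I * ray t) ^ n * combo v q (ray t)) atTop (𝓝 0)) : v = 0 := by
  have small : ∀ {f : ℝ → ℂ}, (∀ t, 0 ≤ t → ‖f t‖ ≤ Real.exp (-t)) → Tendsto f atTop (𝓝 0) := by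
    intro f hf
    simpa using tendsto_pow_mul_ray hf 0
  have h4 : Tendsto (fun t => (wave 0 (-ray t), wave 1 (ray t), wave 2 (ray t),
      (Complex.I * ray t)⁻¹)) atTop (𝓝 ((0 : ℂ), (0 : ℂ), (0 : ℂ), (0 : ℂ))) :=
    (small fun t => norm_wave_zero_neg_ray).prodMk_nhds
      ((small fun t => norm_wave_one_ray).prodMk_nhds
        ((small fun t => norm_wave_two_ray).prodMk_nhds tendsto_inv_ray))
  have hsmooth : ContDiff ℝ (⊤ : ℕ∞) fun x : ℝ => (x : ℂ) := Complex.ofRealCLM.contDiff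
  have extract : ∀ {q : ℝ → ℂ} {n : ℕ} {G : ℂ × ℂ × ℂ × ℂ → ℂ},
      ContDiffOn ℝ (⊤ : ℕ∞) q (Set.Icc 0 1) → Continuous G →
      (∀ t, 0 < t → (Complex.I * ray t) ^ n * combo v q (ray t) =
        G (wave 0 (-ray t), wave 1 (ray t), wave 2 (ray t), (Complex.I * ray t)⁻¹)) →
      G (0, 0, 0, 0) = 0 := by
    intro q n G hq hG he
    refine tendsto_nhds_unique ((hG.tendsto _).comp h4) ((h q hq n).congr' ?_)
    exact eventually_atTop.2 ⟨1, fun t ht => he t (by linarith)⟩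
  -- `1 - x` has the boundary values `1` and `0`
  have a0 := extract (q := fun x => 1 - (x : ℂ)) (n := 1)
    (G := fun s => v 0 * (1 - (1 - s.1) * s.2.2.2) +
      v 1 * (omega 3 ^ 2 * s.2.1 - omega 3 * (s.2.1 - 1) * s.2.2.2) +
      v 2 * ((omega 3 ^ 2) ^ 2 * s.2.2.1 - omega 3 ^ 2 * (s.2.2.1 - 1) * s.2.2.2))
    (contDiff_const.sub hsmooth).contDiffOn (by fun_prop) (fun t ht => by
      have f0 := fourierVec_one_sub_ray ht 0
      have f1 := fourierVec_one_sub_ray ht 1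
      have f2 := fourierVec_one_sub_ray ht 2
      have e1 := wave_mul_neg 1 (ray t)
      have e2 := wave_mul_neg 2 (ray t)
      simp only [combo, Fin.val_zero, Fin.val_one, Fin.val_two, pow_one, pow_zero] at *
      linear_combination v 0 * f0 + v 1 * wave 1 (ray t) * f1 + v 2 * wave 2 (ray t) * f2 +
        (Complex.I * ray t)⁻¹ * (v 1 * omega 3 * e1 + v 2 * omega 3 ^ 2 * e2))
  -- `1` has the boundary values `1` and `1`
  have a1 := extract (q := fun _ => 1) (n := 1)
    (G := fun s => v 0 * (1 - s.1) + v 1 * (omega 3 ^ 2 * (s.2.1 - 1)) +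
      v 2 * ((omega 3 ^ 2) ^ 2 * (s.2.2.1 - 1)))
    contDiff_const.contDiffOn (by fun_prop) (fun t _ => by
      have f0 := fourierVec_one_ray (t := t) 0
      have f1 := fourierVec_one_ray (t := t) 1
      have f2 := fourierVec_one_ray (t := t) 2
      have e1 := wave_mul_neg 1 (ray t)
      have e2 := wave_mul_neg 2 (ray t)
      simp only [combo, Fin.val_zero, Fin.val_one, Fin.val_two, pow_one, pow_zero] at *
      linear_combination v 0 * f0 + v 1 * wave 1 (ray t) * f1 + v 2 * wave 2 (ray t) * f2 -
        (v 1 * omega 3 ^ 2 * e1 + v 2 * (omega 3 ^ 2) ^ 2 * e2))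
  -- `x - x²` vanishes at both ends, with derivatives `1` and `-1`
  have a2 := extract (q := fun x => (x : ℂ) - (x : ℂ) ^ 2) (n := 2)
    (G := fun s => v 0 * (1 + s.1 - 2 * (1 - s.1) * s.2.2.2) +
      v 1 * (omega 3 * (s.2.1 + 1) - 2 * (s.2.1 - 1) * s.2.2.2) +
      v 2 * (omega 3 ^ 2 * (s.2.2.1 + 1) - 2 * (s.2.2.1 - 1) * s.2.2.2))
    (hsmooth.sub (hsmooth.pow 2)).contDiffOn (by fun_prop) (fun t ht => by
      have f0 := fourierVec_parabola_ray ht 0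
      have f1 := fourierVec_parabola_ray ht 1
      have f2 := fourierVec_parabola_ray ht 2
      have e1 := wave_mul_neg 1 (ray t)
      have e2 := wave_mul_neg 2 (ray t)
      simp only [combo, Fin.val_zero, Fin.val_one, Fin.val_two, pow_one, pow_zero] at *
      linear_combination v 0 * f0 + v 1 * wave 1 (ray t) * f1 + v 2 * wave 2 (ray t) * f2 +
        (v 1 * omega 3 * e1 + v 2 * omega 3 ^ 2 * e2) +
        2 * (Complex.I * ray t)⁻¹ * (v 1 * e1 + v 2 * e2))
  simp only [zero_sub, mul_zero, sub_zero, mul_one, add_zero, zero_add, mul_neg] at a0 a1 a2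
  have w3 := omega_cube
  rw [a0] at a1 a2
  have h1 : v 1 = -omega 3 * v 2 := by
    linear_combination omega 3 ^ 2 * a2 - (v 1 + v 2 * omega 3) * w3
  have h2 : (omega 3 - 1) * v 2 = 0 := by
    rw [h1] at a1
    linear_combination -a1 + (1 - omega 3) * v 2 * w3
  have h3 : omega 3 - 1 ≠ 0 := by
    intro h
    have := congrArg Complex.re h
    rw [Complex.sub_re, omega_re] at this
    norm_num at this
  have h4 : v 2 = 0 := (mul_eq_zero.1 h2).resolve_left h3
  rw [h4, mul_zero] at h1
  ext l
  fin_cases l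
  exacts [a0, h1, h4]

theorem wellConditioned_iff {B : BoundaryConditions 3} {a τ : ℂ} (hτ : τ = 1 ∨ τ = -1)
    (ha : a = τ * Complex.I) {p : Fin 3 → ℕ} {x y : Fin 3 → ℂ} {m : ℂ} {d : ℕ} (hm : m ≠ 0)
    {T : (ℝ → ℂ) → ℝ → ℂ}
    (hT : ∀ q, ContDiffOn ℝ (⊤ : ℕ∞) q (Set.Icc 0 1) → ContDiffOn ℝ (⊤ : ℕ∞) (T q) (Set.Icc 0 1))
    (hTT : ∀ q, T (T q) = q)
    (hdet : ∀ ρ, B.charDet a (τ * ρ) = m * ρ ^ d * (colMatrix p x y ρ).det)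
    (heta : ∀ q ρ l, B.eta a q (.inl l) (τ * ρ) =
      m * ρ ^ d * (colMatrix p x y ρ).cramer (fourierVec (T q) ρ) l)
    (heta' : ∀ q ρ r, B.eta a q (.inr r) ρ =
      -∑ l, (B.A r (B.free l) : ℂ) * B.eta a q (.inl l) ρ)
    (hX : leadCoeff p x y = 0 → leadCoeff p y x = 0 → constCoeff p x y ≠ 0) :
    B.WellConditioned a ↔ leadCoeff p x y ≠ 0 := by
  have hττ : τ * τ = 1 := by rcases hτ with rfl | rfl <;> norm_num
  have hτn : ‖τ‖ = 1 := by rcases hτ with rfl | rfl <;> norm_num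
  have hτ0 : τ ≠ 0 := by rintro rfl; simp at hττ
  have hττρ : ∀ ρ, τ * (τ * ρ) = ρ := fun ρ => by rw [← mul_assoc, hττ, one_mul]
  have hτdist : ∀ ρ σ, dist (τ * ρ) (τ * σ) = dist ρ σ := fun ρ σ => by
    rw [dist_eq_norm, ← mul_sub, norm_mul, hτn, one_mul, dist_eq_norm]
  have hD : ∀ ρ, τ * ρ ∈ D 3 a ↔ ρ ∈ D 3 Complex.I := fun ρ => by
    have : a * (τ * ρ) ^ 3 = Complex.I * ρ ^ 3 := by
      rw [ha]; linear_combination (Complex.I * ρ ^ 3 * (τ * τ + 1)) * hττ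
    simp only [D, Set.mem_ofPred_eq, this]
  have hM : ∀ ρ, ρ ≠ 0 → m * ρ ^ d ≠ 0 := fun ρ hρ => mul_ne_zero hm (pow_ne_zero d hρ)
  have hη := twist_cube p
  constructor
  · intro hWC hZ
    obtain ⟨v, hv0, hv⟩ := Matrix.exists_vecMul_eq_zero_iff.2 (show (Matrix.of ![fun l => y l,
      fun l => root p l * x l, fun l => root p l ^ 2 * x l]).det = 0 from hZ)
    refine hv0 (eq_zero_of_tendsto_combo fun q hq n => ?_)
    have hv' : ∀ l, v 0 * y l + v 1 * (root p l * x l) + v 2 * (root p l ^ 2 * x l) = 0 := by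
      intro l
      have := congrFun hv l
      simpa [Matrix.vecMul, dotProduct, Fin.sum_univ_three] using this
    obtain ⟨t₀, ht₀⟩ := expSum_ne_zero_near_ray (X := constCoeff p x y) (Y := leadCoeff p y x) hη
      (hX hZ)
    have hdet0 : ∀ t, t₀ ≤ t → (colMatrix p x y (ray t)).det ≠ 0 := by
      intro t ht
      rw [det_colMatrix, hZ]
      exact ht₀ t ht _ (by norm_num)
    have hray : Tendsto (fun t => τ * ray t) atTop (Bornology.cobounded ℂ ⊓
        Filter.principal (D 3 a ∩ B.awayFromZeros a (1 / 2))) := by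
      refine tendsto_inf.2 ⟨?_, tendsto_principal.2 (eventually_atTop.2
        ⟨max t₀ 1, fun t ht => ⟨?_, ?_⟩⟩)⟩
      · rw [← tendsto_norm_atTop_iff_cobounded]
        simpa [hτn] using tendsto_norm_ray
      · rw [hD]
        exact ray_mem_D (by linarith [le_max_right t₀ 1])
      · intro σ hσ
        by_contra! hlt
        have ht1 : 1 ≤ t := (le_max_right _ _).trans ht
        rw [← hττρ σ, hτdist, dist_comm] at hlt
        rw [← hττρ σ, hdet, det_colMatrix, hZ, mul_eq_zero] at hσ
        refine ht₀ t ((le_max_left _ _).trans ht) _ hlt.le (hσ.resolve_left (hM _ ?_))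
        intro h0
        rw [h0, dist_eq_norm, zero_sub, norm_neg] at hlt
        linarith [le_norm_ray t]
    refine tendsto_combo hv' (ξ := fun t l => (colMatrix p x y (ray t)).cramer
      (fourierVec q (ray t)) l / (colMatrix p x y (ray t)).det) (fun l => ?_)
      (eventually_atTop.2 ⟨t₀, fun t ht => ?_⟩) n
    · have := ((hWC (T q) (hT q hq) (.inl l)).2 (1 / 2) (by norm_num)).comp hray
      refine this.congr' (eventually_atTop.2 ⟨1, fun t ht => ?_⟩)
      have hne := hM _ (ray_ne_zero (by linarith : 0 < t))
      simp only [Function.comp, heta, hdet, hTT]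
      rw [mul_div_mul_left _ _ hne]
    · have h1 := Matrix.mulVec_cramer (colMatrix p x y (ray t)) (fourierVec q (ray t))
      have h2 : (fun l => (colMatrix p x y (ray t)).cramer (fourierVec q (ray t)) l /
          (colMatrix p x y (ray t)).det) = (colMatrix p x y (ray t)).det⁻¹ •
          (colMatrix p x y (ray t)).cramer (fourierVec q (ray t)) := by
        ext l; rw [Pi.smul_apply, smul_eq_mul, div_eq_inv_mul]
      rw [h2, Matrix.mulVec_smul, h1, smul_smul, inv_mul_cancel₀ (hdet0 t ht), one_smul]
  · intro hZ q hq
    have hTq := hT q hq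
    have hinl : ∀ l, Differentiable ℂ (B.eta a q (.inl l)) ∧ ∀ ε : ℝ, 0 < ε →
        Tendsto (fun ρ => B.eta a q (.inl l) ρ / B.charDet a ρ)
          (Bornology.cobounded ℂ ⊓ Filter.principal (D 3 a ∩ B.awayFromZeros a ε)) (𝓝 0) := by
      intro l
      constructor
      · have h1 : B.eta a q (.inl l) = fun ρ => m * (τ * ρ) ^ d *
            (fun ρ => (colMatrix p x y ρ).cramer (fourierVec (T q) ρ) l) (τ * ρ) := by
          ext ρ
          rw [← heta, hττρ]
        rw [h1]
        have h2 := (differentiable_cramer p x y hTq.continuousOn l).comp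
          (differentiable_id.const_mul τ)
        exact (by fun_prop : Differentiable ℂ fun ρ : ℂ => m * (τ * ρ) ^ d).mul h2
      · intro ε hε
        obtain ⟨C, hC0, hC⟩ := exists_norm_cramer_le p x y hTq
        obtain ⟨R, δ, hδ, hlow⟩ := exists_lower_bound hη (constCoeff_mul_twist p x y) hZ
          (leadCoeff p y x) hε
        have hlim : Tendsto (fun ρ : ℂ => C / δ * ‖ρ‖⁻¹)
            (Bornology.cobounded ℂ ⊓ Filter.principal (D 3 a ∩ B.awayFromZeros a ε)) (𝓝 0) := by
          have := (tendsto_inv_atTop_zero.comp (tendsto_norm_cobounded_atTop (E := ℂ))).const_mul (C / δ)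
          rw [mul_zero] at this
          exact this.mono_left inf_le_left
        refine squeeze_zero_norm' ?_ hlim
        have hbig : ∀ᶠ ρ : ℂ in Bornology.cobounded ℂ, max R 1 ≤ ‖ρ‖ :=
          tendsto_norm_cobounded_atTop.eventually_ge_atTop _
        filter_upwards [mem_inf_of_left hbig, mem_inf_of_right (mem_principal_self _)] with ρ hρ hρ'
        set w := τ * ρ with hw
        have hwρ : ρ = τ * w := (hττρ ρ).symm
        have hwn : ‖w‖ = ‖ρ‖ := by rw [hw, norm_mul, hτn, one_mul]
        have hw1 : 1 ≤ ‖w‖ := hwn ▸ (le_max_right _ _).trans hρ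
        have hw0 : w ≠ 0 := norm_pos_iff.1 (by linarith)
        have hl := hlow w ((hD w).1 (hwρ ▸ hρ'.1)) (hwn ▸ (le_max_left _ _).trans hρ)
          (fun σ hσ => by
            have := hρ'.2 (τ * σ) (by rw [hdet, det_colMatrix, hσ, mul_zero])
            rwa [hwρ, hτdist] at this)
        rw [← det_colMatrix] at hl
        have hs : 1 ≤ rowScale w := by
          rw [rowScale]
          exact Finset.one_le_prod fun k _ => le_max_left _ _
        have hdpos : 0 < ‖(colMatrix p x y w).det‖ :=
          lt_of_lt_of_le (mul_pos hδ (by linarith)) hl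
        have hc := hC w l
        rw [hwρ, heta, hdet, mul_div_mul_left _ _ (hM w hw0), norm_div, ← hwρ, ← hwn,
          div_le_iff₀ hdpos]
        have hw1' : 0 < ‖w‖ := by linarith
        have h5 : ‖(colMatrix p x y w).cramer (fourierVec (T q) w) l‖ ≤ C * rowScale w / ‖w‖ := by
          rw [le_div_iff₀ hw1']; linarith
        refine h5.trans ?_
        calc C * rowScale w / ‖w‖ = C / δ * ‖w‖⁻¹ * (δ * rowScale w) := by field_simp
          _ ≤ _ := by gcongr
    rintro (l | r)
    · exact hinl l
    · constructor
      · have h1 : B.eta a q (.inr r) = fun ρ =>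
            -∑ l, (B.A r (B.free l) : ℂ) * B.eta a q (.inl l) ρ := by
          ext ρ; exact heta' q ρ r
        rw [h1]
        exact (Differentiable.fun_sum fun l _ => (hinl l).1.const_mul _).neg
      · intro ε hε
        have h1 : (fun ρ => B.eta a q (.inr r) ρ / B.charDet a ρ) = fun ρ =>
            -∑ l, (B.A r (B.free l) : ℂ) * (B.eta a q (.inl l) ρ / B.charDet a ρ) := by
          ext ρ
          rw [heta', neg_div, Finset.sum_div]
          simp only [mul_div_assoc]
        rw [h1]
        have h2 := (tendsto_finsetSum Finset.univ fun l _ =>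
          ((hinl l).2 ε hε).const_mul ((B.A r (B.free l) : ℂ))).neg
        simpa using h2

namespace BoundaryConditions

/-! ### The characteristic matrix of a set of boundary conditions -/

variable {B : BoundaryConditions 3}

/-- The exponents `2 - order` of the columns without pivot. -/
def expo (B : BoundaryConditions 3) (l : Fin 3) : ℕ := (B.free l).val / 2

/-- The coefficient of `exp (-iρ)` in the `l`-th column: it collects the boundary values at `1`. -/
def atOne (B : BoundaryConditions 3) (l : Fin 3) : ℝ :=
  (if (B.free l).val % 2 = 0 then 0 else -1) +
    ∑ r, if (B.piv r).val % 2 = 0 then 0 else B.A r (B.free l)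

/-- The constant term in the `l`-th column: it collects the boundary values at `0`. -/
def atZero (B : BoundaryConditions 3) (l : Fin 3) : ℝ :=
  (if (B.free l).val % 2 = 0 then 1 else 0) -
    ∑ r, if (B.piv r).val % 2 = 0 then B.A r (B.free l) else 0

/-- `colMatrix` for the boundary conditions. -/
def normMatrix (B : BoundaryConditions 3) (ρ : ℂ) : Matrix (Fin 3) (Fin 3) ℂ :=
  colMatrix B.expo (fun l => B.atOne l) (fun l => B.atZero l) ρ

theorem half_piv_eq (hB : B.NonRobin) {r l : Fin 3} (h : B.A r (B.free l) ≠ 0) :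
    (B.piv r).val / 2 = (B.free l).val / 2 := by
  obtain ⟨j, hj⟩ := hB r
  have h1 := hj _ h
  have h2 := hj (B.piv r) (by rw [B.leading_one]; exact one_ne_zero)
  rw [← h2, order, order] at h1
  have := (B.piv r).isLt
  have := (B.free l).isLt
  omega

theorem piv_lt_free {r l : Fin 3} (h : B.A r (B.free l) ≠ 0) : (B.piv r).val < (B.free l).val := by
  have h1 : ¬ B.free l < B.piv r := fun hlt => h (B.zero_of_lt_piv r _ hlt)
  have h2 : (B.piv r).val ≠ (B.free l).val := fun e => B.piv_ne_free r l (Fin.ext e)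
  rw [Fin.lt_def] at h1
  omega

/-- Within one order of the derivative, the value at `0` precedes the value at `1`. -/
theorem coeff_eq_zero (hB : B.NonRobin) {r l : Fin 3}
    (h : (B.free l).val % 2 = 0 ∨ (B.piv r).val % 2 ≠ 0) : B.A r (B.free l) = 0 := by
  by_contra hne
  have h1 := half_piv_eq hB hne
  have h2 := piv_lt_free hne
  omega

theorem atOne_of_even (hB : B.NonRobin) {l : Fin 3} (h : (B.free l).val % 2 = 0) :
    B.atOne l = 0 := by
  simp [atOne, h, coeff_eq_zero hB (Or.inl h)]

theorem atZero_of_even (hB : B.NonRobin) {l : Fin 3} (h : (B.free l).val % 2 = 0) :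
    B.atZero l = 1 := by
  simp [atZero, h, coeff_eq_zero hB (Or.inl h)]

theorem atOne_of_odd (hB : B.NonRobin) {l : Fin 3} (h : (B.free l).val % 2 ≠ 0) :
    B.atOne l = -1 := by
  rw [atOne, if_neg h, Finset.sum_eq_zero, add_zero]
  intro r _
  split_ifs with hr
  · rfl
  · exact coeff_eq_zero hB (Or.inr hr)

/-- If both values of one order are without pivot, no boundary condition involves them. -/
theorem atZero_of_pair (hB : B.NonRobin) {l l' : Fin 3} (hl : l < l') (h : B.expo l = B.expo l') :
    (B.free l).val % 2 = 0 ∧ (B.free l').val % 2 ≠ 0 ∧ B.atZero l' = 0 := by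
  have hlt : (B.free l).val < (B.free l').val := B.free_strictMono hl
  rw [expo, expo] at h
  refine ⟨by omega, by omega, ?_⟩
  rw [atZero, if_neg (by omega), Finset.sum_eq_zero, sub_zero]
  intro r _
  split_ifs
  · by_contra hne
    have h1 := half_piv_eq hB hne
    have h2 := piv_lt_free hne
    exact B.piv_ne_free r l (Fin.ext (by omega))
  · rfl

theorem c_order_omega_mul (a ρ : ℂ) (k : ℕ) (i : Fin (2 * 3)) :
    c 3 a (order 3 i) (omega 3 ^ k * ρ) = omega 3 ^ (k * (i.val / 2)) * c 3 a (order 3 i) ρ := by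
  have h : 3 - 1 - order 3 i = i.val / 2 := by
    rw [order]
    have := i.isLt
    omega
  rw [c, c, h, mul_pow, ← pow_mul]
  ring

theorem globalCoeff_omega_mul (a ρ : ℂ) (k : ℕ) (i : Fin (2 * 3)) :
    globalCoeff 3 a i (omega 3 ^ k * ρ) = omega 3 ^ (k * (i.val / 2)) * c 3 a (order 3 i) ρ *
      (if i.val % 2 = 0 then 1 else -wave k (-ρ)) := by
  rw [globalCoeff, c_order_omega_mul, exp_neg_I_omega]

theorem order_piv_eq (hB : B.NonRobin) {r l : Fin 3} (h : B.A r (B.free l) ≠ 0) :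
    order 3 (B.piv r) = order 3 (B.free l) := by
  rw [order, order, half_piv_eq hB h]

theorem charMatrix_eq (hB : B.NonRobin) (a ρ : ℂ) :
    B.charMatrix a ρ =
      Matrix.of fun k l => c 3 a (order 3 (B.free l)) ρ * B.normMatrix ρ k l := by
  ext k l
  have hterm : ∀ r, (B.A r (B.free l) : ℂ) * globalCoeff 3 a (B.piv r) (omega 3 ^ k.val * ρ) =
      omega 3 ^ (k.val * B.expo l) * c 3 a (order 3 (B.free l)) ρ *
        ((B.A r (B.free l) : ℂ) * (if (B.piv r).val % 2 = 0 then 1 else -wave k.val (-ρ))) := by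
    intro r
    by_cases h : B.A r (B.free l) = 0
    · simp [h]
    · rw [globalCoeff_omega_mul, order_piv_eq hB h, half_piv_eq hB h, expo]
      ring
  have hsum : ∀ r, (B.A r (B.free l) : ℂ) * (if (B.piv r).val % 2 = 0 then 1 else -wave k.val (-ρ)) =
      ((if (B.piv r).val % 2 = 0 then B.A r (B.free l) else 0 : ℝ) : ℂ) -
        ((if (B.piv r).val % 2 = 0 then 0 else B.A r (B.free l) : ℝ) : ℂ) * wave k.val (-ρ) := by
    intro r
    split_ifs <;> simp
  simp only [charMatrix, normMatrix, colMatrix, Matrix.of_apply]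
  rw [Finset.sum_congr rfl fun r _ => hterm r, globalCoeff_omega_mul, ← Finset.mul_sum,
    Finset.sum_congr rfl fun r _ => hsum r, Finset.sum_sub_distrib, ← Finset.sum_mul, atOne, atZero]
  push_cast
  rw [← expo]
  split_ifs <;> push_cast <;> ring

/-- The total degree of the monomials in the columns. -/
def degree (B : BoundaryConditions 3) : ℕ := B.expo 0 + B.expo 1 + B.expo 2

/-- The product of the constants in the monomials in the columns. -/
def scale (B : BoundaryConditions 3) (a : ℂ) : ℂ :=
  ∏ l, (-a * (Complex.I ^ (order 3 (B.free l) + 1))⁻¹)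

theorem scale_ne_zero {a : ℂ} (ha : a ≠ 0) : B.scale a ≠ 0 :=
  Finset.prod_ne_zero_iff.2 fun _ _ =>
    mul_ne_zero (neg_ne_zero.2 ha) (inv_ne_zero (pow_ne_zero _ Complex.I_ne_zero))

theorem prod_c_eq (a ρ : ℂ) :
    ∏ l, c 3 a (order 3 (B.free l)) ρ = B.scale a * ρ ^ B.degree := by
  have h : ∀ l, c 3 a (order 3 (B.free l)) ρ =
      (-a * (Complex.I ^ (order 3 (B.free l) + 1))⁻¹) * ρ ^ B.expo l := by
    intro l
    have : 3 - 1 - order 3 (B.free l) = B.expo l := by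
      rw [order, expo]
      have := (B.free l).isLt
      omega
    rw [c, this]; ring
  simp only [h]
  rw [Finset.prod_mul_distrib, scale, Fin.prod_univ_three (fun l => ρ ^ B.expo l), degree, pow_add,
    pow_add]

theorem degree_bounds (B : BoundaryConditions 3) : 1 ≤ B.degree ∧ B.degree ≤ 5 := by
  have h1 : (B.free 0).val < (B.free 1).val := B.free_strictMono (by decide)
  have h2 : (B.free 1).val < (B.free 2).val := B.free_strictMono (by decide)
  have h3 := (B.free 2).isLt
  simp only [degree, expo]
  omega

theorem charDet_eq (hB : B.NonRobin) (a ρ : ℂ) :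
    B.charDet a ρ = B.scale a * ρ ^ B.degree * (B.normMatrix ρ).det := by
  rw [charDet, charMatrix_eq hB,
    Matrix.det_mul_row (fun l => c 3 a (order 3 (B.free l)) ρ) (B.normMatrix ρ), prod_c_eq]

/-- The monomials cancel in the quotients `η_j / Δ_P`. -/
theorem eta_inl_eq (hB : B.NonRobin) (a : ℂ) (q : ℝ → ℂ) (ρ : ℂ) (l : Fin 3) :
    B.eta a q (.inl l) ρ =
      B.scale a * ρ ^ B.degree * (B.normMatrix ρ).cramer (fourierVec q ρ) l := by
  rw [eta, etaHat, charMatrix_eq hB, ← Matrix.det_updateCol_smul, Matrix.cramer_apply, ← prod_c_eq,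
    ← Matrix.det_mul_row]
  congr 1
  ext k l'
  by_cases hl : l' = l
  · subst hl
    simp [fourierVec]
  · simp [Matrix.updateCol_ne hl]

theorem eta_inr_eq (hB : B.NonRobin) (a : ℂ) (q : ℝ → ℂ) (ρ : ℂ) (r : Fin 3) :
    B.eta a q (.inr r) ρ = -∑ l, (B.A r (B.free l) : ℂ) * B.eta a q (.inl l) ρ := by
  simp only [eta]
  rw [mul_neg, Finset.mul_sum]
  congr 1
  refine Finset.sum_congr rfl fun l _ => ?_
  by_cases h : B.A r (B.free l) = 0
  · simp [h]
  · rw [order_piv_eq hB h]; ring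

/-- The coefficient of `exp (iρ)` in `Δ_P`, up to the monomial. -/
def plusCoeff (B : BoundaryConditions 3) : ℂ :=
  leadCoeff B.expo (fun l => B.atOne l) (fun l => B.atZero l)

/-- The coefficient of `exp (-iρ)` in `Δ_P`, up to the monomial. -/
def minusCoeff (B : BoundaryConditions 3) : ℂ :=
  leadCoeff B.expo (fun l => B.atZero l) (fun l => B.atOne l)

/-- The constant term in `Δ_P`, up to the monomial. -/
def zeroCoeff (B : BoundaryConditions 3) : ℂ :=
  constCoeff B.expo (fun l => B.atOne l) (fun l => B.atZero l)

theorem charDet_eq_expSum (hB : B.NonRobin) (a ρ : ℂ) :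
    B.charDet a ρ = B.scale a * ρ ^ B.degree *
      expSum B.zeroCoeff B.plusCoeff B.minusCoeff (twist B.expo) ρ := by
  rw [charDet_eq hB, normMatrix, det_colMatrix, zeroCoeff, plusCoeff, minusCoeff]

theorem root_conj (p : Fin 3 → ℕ) (l : Fin 3) : (starRingEnd ℂ) (root p l) = root p l ^ 2 := by
  have h3 := root_cube p l
  have hn : ‖root p l‖ = 1 := norm_eta h3
  rw [← Complex.inv_eq_conj hn]
  refine inv_eq_of_mul_eq_one_right ?_
  rw [← h3]; ring

theorem re_leadCoeff (p : Fin 3 → ℕ) (x y : Fin 3 → ℝ) :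
    (leadCoeff p (fun l => x l) (fun l => y l)).re = 0 := by
  have hz := root_cube p
  have h : (starRingEnd ℂ) (leadCoeff p (fun l => x l) (fun l => y l)) =
      -leadCoeff p (fun l => x l) (fun l => y l) := by
    simp only [leadCoeff, rowDet_eq, map_add, map_sub, map_mul, map_pow, root_conj,
      Complex.conj_ofReal]
    have h4 : ∀ l, (root p l ^ 2) ^ 2 = root p l := fun l => by
      linear_combination root p l * hz l
    simp only [h4]
    ring
  have := congrArg Complex.re h
  rw [Complex.conj_re, Complex.neg_re] at this
  linarith

theorem plusCoeff_eq (B : BoundaryConditions 3) : B.plusCoeff = B.plusCoeff.im * Complex.I := by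
  apply Complex.ext
  · simp [plusCoeff, re_leadCoeff]
  · simp

theorem minusCoeff_eq (B : BoundaryConditions 3) : B.minusCoeff = B.minusCoeff.im * Complex.I := by
  apply Complex.ext
  · simp [minusCoeff, re_leadCoeff]
  · simp

theorem omega_pow_ne {i j : ℕ} (hij : i < j) (hj : j ≤ 2) : omega 3 ^ i ≠ omega 3 ^ j := by
  have hprim : IsPrimitiveRoot (omega 3) 3 := by
    rw [omega]
    exact_mod_cast Complex.isPrimitiveRoot_exp 3 (by norm_num)
  intro h
  have := hprim.pow_inj (by omega) (by omega) h
  omega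

theorem atOne_or_atZero_ne_zero (hB : B.NonRobin) (l : Fin 3) :
    B.atOne l ≠ 0 ∨ B.atZero l ≠ 0 := by
  by_cases h : (B.free l).val % 2 = 0
  · exact Or.inr (by rw [atZero_of_even hB h]; exact one_ne_zero)
  · exact Or.inl (by rw [atOne_of_odd hB h]; norm_num)

/-- If the exponentials are absent from `Δ_P`, the constant term is not. With one pivot for each
order this holds because a real polynomial `bt³ + c` with `b, c ≠ 0` is no product of real linear
factors. -/
theorem zeroCoeff_ne_zero (hB : B.NonRobin) (hp : B.plusCoeff = 0) (hm : B.minusCoeff = 0) :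
    B.zeroCoeff ≠ 0 := by
  have hlt1 : (B.free 0).val < (B.free 1).val := B.free_strictMono (by decide)
  have hlt2 : (B.free 1).val < (B.free 2).val := B.free_strictMono (by decide)
  have hlt3 := (B.free 2).isLt
  have hr0 := pow_ne_zero (B.expo 0) omega_ne_zero
  have hr1 := pow_ne_zero (B.expo 1) omega_ne_zero
  have hr2 := pow_ne_zero (B.expo 2) omega_ne_zero
  simp only [plusCoeff, minusCoeff, leadCoeff, rowDet_eq, root] at hp hm
  by_cases h01 : B.expo 0 = B.expo 1
  · exfalso
    obtain ⟨h0, h1, h2⟩ := atZero_of_pair hB (by decide) h01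
    have hne := sub_ne_zero.2 (omega_pow_ne (i := B.expo 1) (j := B.expo 2)
      (by simp only [expo] at h01 ⊢; omega) (by simp only [expo]; omega))
    rw [h01, h2, atOne_of_even hB h0, atZero_of_even hB h0, atOne_of_odd hB h1] at hp hm
    push_cast at hp hm
    rcases atOne_or_atZero_ne_zero hB 2 with h | h
    · have h' : (B.atOne 2 : ℂ) ≠ 0 := by exact_mod_cast h
      refine mul_ne_zero (mul_ne_zero (mul_ne_zero hr1 hr2) hne) h' ?_
      linear_combination hp
    · have h' : (B.atZero 2 : ℂ) ≠ 0 := by exact_mod_cast h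
      refine mul_ne_zero (mul_ne_zero (mul_ne_zero hr1 hr2) hne) h' ?_
      linear_combination -hm
  by_cases h12 : B.expo 1 = B.expo 2
  · exfalso
    obtain ⟨h0, h1, h2⟩ := atZero_of_pair hB (by decide) h12
    have hne := sub_ne_zero.2 (omega_pow_ne (i := B.expo 0) (j := B.expo 1)
      (by simp only [expo] at h01 ⊢; omega) (by simp only [expo]; omega))
    rw [← h12, h2, atOne_of_even hB h0, atZero_of_even hB h0, atOne_of_odd hB h1] at hp hm
    push_cast at hp hm
    rcases atOne_or_atZero_ne_zero hB 0 with h | h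
    · have h' : (B.atOne 0 : ℂ) ≠ 0 := by exact_mod_cast h
      refine mul_ne_zero (mul_ne_zero (mul_ne_zero hr0 hr1) hne) h' ?_
      linear_combination -hp
    · have h' : (B.atZero 0 : ℂ) ≠ 0 := by exact_mod_cast h
      refine mul_ne_zero (mul_ne_zero (mul_ne_zero hr0 hr1) hne) h' ?_
      linear_combination hm
  have e0 : B.expo 0 = 0 := by simp only [expo] at h01 h12 ⊢; omega
  have e1 : B.expo 1 = 1 := by simp only [expo] at h01 h12 ⊢; omega
  have e2 : B.expo 2 = 2 := by simp only [expo] at h01 h12 ⊢; omega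
  rw [e0, e1, e2] at hp hm
  have w3 := omega_cube
  have hκ : omega 3 ^ 2 - omega 3 ≠ 0 := by
    have := omega_pow_ne (i := 1) (j := 2) (by norm_num) le_rfl
    rw [pow_one] at this
    exact sub_ne_zero.2 this.symm
  set x := B.atOne
  set y := B.atZero
  have hp' : y 0 * x 1 * x 2 + x 0 * y 1 * x 2 + x 0 * x 1 * y 2 = 0 := by
    have : (omega 3 ^ 2 - omega 3) *
        ((y 0 * x 1 * x 2 + x 0 * y 1 * x 2 + x 0 * x 1 * y 2 : ℝ) : ℂ) = 0 := by
      push_cast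
      linear_combination hp - ((y 0 : ℂ) * x 1 * x 2 * (omega 3 ^ 2 - omega 3) +
        (x 0 : ℂ) * y 1 * x 2 * (-omega 3)) * w3
    exact_mod_cast (mul_eq_zero.1 this).resolve_left hκ
  have hm' : x 0 * y 1 * y 2 + y 0 * x 1 * y 2 + y 0 * y 1 * x 2 = 0 := by
    have : (omega 3 ^ 2 - omega 3) *
        ((x 0 * y 1 * y 2 + y 0 * x 1 * y 2 + y 0 * y 1 * x 2 : ℝ) : ℂ) = 0 := by
      push_cast
      linear_combination hm - ((x 0 : ℂ) * y 1 * y 2 * (omega 3 ^ 2 - omega 3) +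
        (y 0 : ℂ) * x 1 * y 2 * (-omega 3)) * w3
    exact_mod_cast (mul_eq_zero.1 this).resolve_left hκ
  have hX : B.zeroCoeff =
      3 * (omega 3 ^ 2 - omega 3) * ((x 0 * x 1 * x 2 + y 0 * y 1 * y 2 : ℝ) : ℂ) := by
    simp only [zeroCoeff, constCoeff, rowDet_eq, root, e0, e1, e2]
    push_cast
    linear_combination ((x 0 : ℂ) * x 1 * x 2 + y 0 * y 1 * y 2) *
      (omega 3 ^ 2 - 2 * omega 3) * w3
  rw [hX]
  refine mul_ne_zero (mul_ne_zero (by norm_num) hκ) ?_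
  norm_cast
  have hxy : ∀ l, (x l = 0 ∧ y l = 1) ∨ x l = -1 := by
    intro l
    by_cases h : (B.free l).val % 2 = 0
    · exact Or.inl ⟨atOne_of_even hB h, atZero_of_even hB h⟩
    · exact Or.inr (atOne_of_odd hB h)
  rcases hxy 0 with ⟨a0, b0⟩ | a0 <;> rcases hxy 1 with ⟨a1, b1⟩ | a1 <;>
    rcases hxy 2 with ⟨a2, b2⟩ | a2 <;> simp only [*] at hp' hm' ⊢ <;>
    (try norm_num at hp') <;> (try norm_num at hm') <;> try norm_num
  -- all three values at `1` occur: the sum of the squares of the `y l` vanishes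
  have hsq : y 0 ^ 2 + y 1 ^ 2 + y 2 ^ 2 = 0 := by
    linear_combination (y 0 + y 1 + y 2) * hp' + 2 * hm'
  have hy0 : y 0 = 0 := by
    have : y 0 ^ 2 ≤ 0 := by linarith [sq_nonneg (y 1), sq_nonneg (y 2)]
    exact pow_eq_zero_iff two_ne_zero |>.1 (le_antisymm this (sq_nonneg _))
  rw [hy0]; norm_num

end BoundaryConditions

/-! ### The criteria in terms of the two coefficients -/

namespace BoundaryConditions

variable {B : BoundaryConditions 3}

theorem charDet_neg_eq_expSum (hB : B.NonRobin) (a ρ : ℂ) :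
    B.charDet a (-ρ) = B.scale a * (-1) ^ B.degree * ρ ^ B.degree *
      expSum B.zeroCoeff B.minusCoeff B.plusCoeff (twist B.expo) ρ := by
  rw [charDet_eq_expSum hB, expSum_neg, neg_pow]
  ring

theorem zeroCoeff_mul_twist (B : BoundaryConditions 3) :
    B.zeroCoeff * twist B.expo = B.zeroCoeff := constCoeff_mul_twist _ _ _

theorem zeroBound_I_iff (hB : B.NonRobin) :
    B.ZeroBound Complex.I ↔ ‖B.minusCoeff‖ ≤ ‖B.plusCoeff‖ :=
  zeroBound_iff (Or.inl rfl) (one_mul _).symm (scale_ne_zero Complex.I_ne_zero) (twist_cube _)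
    B.zeroCoeff_mul_twist (fun ρ => by rw [one_mul, charDet_eq_expSum hB]) (zeroCoeff_ne_zero hB)

theorem zeroBound_neg_I_iff (hB : B.NonRobin) :
    B.ZeroBound (-Complex.I) ↔ ‖B.plusCoeff‖ ≤ ‖B.minusCoeff‖ :=
  zeroBound_iff (Or.inr rfl) (neg_one_mul _).symm
    (mul_ne_zero (scale_ne_zero (neg_ne_zero.2 Complex.I_ne_zero))
      (pow_ne_zero B.degree (neg_ne_zero.2 one_ne_zero))) (twist_cube _)
    B.zeroCoeff_mul_twist (fun ρ => by rw [neg_one_mul, charDet_neg_eq_expSum hB])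
    (fun h1 h2 => zeroCoeff_ne_zero hB h2 h1)

theorem wellConditioned_I_iff (hB : B.NonRobin) :
    B.WellConditioned Complex.I ↔ B.plusCoeff ≠ 0 :=
  wellConditioned_iff (T := id) (Or.inl rfl) (one_mul _).symm (scale_ne_zero Complex.I_ne_zero)
    (fun _ h => h) (fun _ => rfl) (fun ρ => by rw [one_mul, charDet_eq hB, normMatrix])
    (fun q ρ l => by rw [one_mul, eta_inl_eq hB, normMatrix, id])
    (eta_inr_eq hB _) (zeroCoeff_ne_zero hB)

theorem wellConditioned_neg_I_iff (hB : B.NonRobin) :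
    B.WellConditioned (-Complex.I) ↔ B.minusCoeff ≠ 0 :=
  wellConditioned_iff (T := fun q x => q (1 - x)) (Or.inr rfl) (neg_one_mul _).symm
    (mul_ne_zero (scale_ne_zero (neg_ne_zero.2 Complex.I_ne_zero))
      (pow_ne_zero B.degree (neg_ne_zero.2 one_ne_zero)))
    (fun q hq => hq.comp (contDiff_const.sub contDiff_id).contDiffOn fun x hx =>
      ⟨by simpa using hx.2, by simpa using hx.1⟩)
    (fun q => by simp)
    (fun ρ => by
      rw [neg_one_mul, charDet_neg_eq_expSum hB, det_colMatrix, constCoeff_swap, zeroCoeff,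
        plusCoeff, minusCoeff])
    (fun q ρ l => by
      rw [neg_one_mul, eta_inl_eq hB, normMatrix, cramer_colMatrix_neg, neg_pow]
      ring)
    (eta_inr_eq hB _) (fun h1 h2 => by
      rw [constCoeff_swap]; exact zeroCoeff_ne_zero hB h2 h1)

end BoundaryConditions

/-! ### The forms -/

/-- `Δ` is a monomial times an exponential sum with the coefficients `Z` of `exp (iωᵏρ)` and `Y` of
`exp (-iωᵏρ)`, up to cube roots of unity. -/
def HasForm (Δ : ℂ → ℂ) (Z Y : ℂ) : Prop :=
  ∃ m : ℂ, m ≠ 0 ∧ ∃ (d : ℕ) (X η : ℂ), η ^ 3 = 1 ∧ ∀ ρ, Δ ρ = m * ρ ^ d * expSum X Z Y η ρ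

theorem HasForm.comp_neg {Δ : ℂ → ℂ} {Z Y : ℂ} (h : HasForm Δ Z Y) :
    HasForm (fun ρ => Δ (-ρ)) Y Z := by
  obtain ⟨m, hm, d, X, η, hη, h⟩ := h
  refine ⟨m * (-1) ^ d, mul_ne_zero hm (pow_ne_zero d (neg_ne_zero.2 one_ne_zero)), d, X, η, hη,
    fun ρ => ?_⟩
  simp only
  rw [h, expSum_neg, neg_pow]
  ring

theorem HasForm.eq_zero {Δ : ℂ → ℂ} {Z Y Z' Y' : ℂ} (h : HasForm Δ Z Y) (h' : HasForm Δ Z' Y')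
    (hZ : Z = 0) : Z' = 0 := by
  obtain ⟨m, hm, d, X, η, hη, h⟩ := h
  obtain ⟨m', hm', d', X', η', hη', h'⟩ := h'
  obtain ⟨K, hK⟩ := norm_expSum_neg_I_mul_sub_le hη X Z Y
  have h1 := (tendsto_expSum_neg_I_mul hη' X' Z' Y').norm
  have h2 : Tendsto (fun t : ℝ => ‖m‖ / ‖m'‖ * K * (2 ^ d * ((1 / 2 * t) ^ d * Real.exp (-(1 / 2 * t)))))
      atTop (𝓝 0) := by
    have := ((Real.tendsto_pow_mul_exp_neg_atTop_nhds_zero d).comp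
      (tendsto_id.const_mul_atTop (by norm_num : (0 : ℝ) < 1 / 2))).const_mul (2 ^ d)
      |>.const_mul (‖m‖ / ‖m'‖ * K)
    simpa using this
  have h3 : ‖Z'‖ ≤ 0 := by
    refine le_of_tendsto_of_tendsto h1 h2 (eventually_atTop.2 ⟨1, fun t ht => ?_⟩)
    have hm'' := norm_pos_iff.2 hm'
    have ht0 : 0 ≤ t := by linarith
    have hn : ‖(-Complex.I * (t : ℂ))‖ = t := by
      rw [norm_mul, norm_neg, Complex.norm_I, one_mul, Complex.norm_real, Real.norm_of_nonneg ht0]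
    have e := congrArg norm ((h (-Complex.I * t)).symm.trans (h' (-Complex.I * t)))
    rw [norm_mul, norm_mul, norm_mul, norm_mul, norm_pow, norm_pow, hn] at e
    have hb := hK t ht0
    rw [hZ, sub_zero, norm_mul] at hb
    have hge : 1 ≤ t ^ d' := one_le_pow₀ ht
    simp only
    rw [norm_mul]
    calc ‖expSum X' Z' Y' η' (-Complex.I * t)‖ * ‖((Real.exp (-t) : ℝ) : ℂ)‖
        ≤ t ^ d' * ‖expSum X' Z' Y' η' (-Complex.I * t)‖ * ‖((Real.exp (-t) : ℝ) : ℂ)‖ := by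
          gcongr
          exact le_mul_of_one_le_left (norm_nonneg _) hge
      _ = ‖m‖ / ‖m'‖ * t ^ d *
          (‖expSum X 0 Y η (-Complex.I * t)‖ * ‖((Real.exp (-t) : ℝ) : ℂ)‖) := by
          rw [hZ] at e
          generalize ‖expSum X 0 Y η (-Complex.I * t)‖ = u at e ⊢
          generalize ‖expSum X' Z' Y' η' (-Complex.I * t)‖ = u' at e ⊢
          generalize ‖((Real.exp (-t) : ℝ) : ℂ)‖ = s
          field_simp
          linear_combination -s * e
      _ ≤ ‖m‖ / ‖m'‖ * t ^ d * (K * Real.exp (-(1 / 2 * t))) := by gcongr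
      _ = _ := by rw [mul_pow, ← mul_assoc (2 ^ d), ← mul_assoc (2 ^ d), ← mul_pow]; norm_num; ring
  exact norm_le_zero_iff.1 h3

/-- The moduli of the two coefficients are determined by `Δ` up to a common factor: their quotient is
the limit of `|Δ (it) / Δ (-it)|`. -/
theorem HasForm.norm_mul_norm {Δ : ℂ → ℂ} {Z Y Z' Y' : ℂ} (h : HasForm Δ Z Y)
    (h' : HasForm Δ Z' Y') : ‖Y‖ * ‖Z'‖ = ‖Y'‖ * ‖Z‖ := by
  obtain ⟨m, hm, d, X, η, hη, h⟩ := h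
  obtain ⟨m', hm', d', X', η', hη', h'⟩ := h'
  have l1 := ((tendsto_expSum_neg_I_mul hη X Y Z).norm).mul (tendsto_expSum_neg_I_mul hη' X' Z' Y').norm
  have l2 := ((tendsto_expSum_neg_I_mul hη' X' Y' Z').norm).mul (tendsto_expSum_neg_I_mul hη X Z Y).norm
  refine tendsto_nhds_unique (l1.congr' (eventually_atTop.2 ⟨1, fun t ht => ?_⟩)) l2
  have ht0 : 0 < t := by linarith
  have hn : ‖(-Complex.I * (t : ℂ))‖ = t := by
    rw [norm_mul, norm_neg, Complex.norm_I, one_mul, Complex.norm_real, Real.norm_of_nonneg ht0.le]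
  have e := congrArg norm ((h (-Complex.I * t)).symm.trans (h' (-Complex.I * t)))
  have e' := congrArg norm ((h (-(-Complex.I * t))).symm.trans (h' (-(-Complex.I * t))))
  rw [expSum_neg, expSum_neg] at e'
  rw [norm_mul, norm_mul, norm_mul, norm_mul, norm_pow, norm_pow, hn] at e
  rw [norm_mul, norm_mul, norm_mul, norm_mul, norm_pow, norm_pow, norm_neg, hn] at e'
  have hc : ‖m‖ * t ^ d * (‖m'‖ * t ^ d') ≠ 0 := by
    have := norm_pos_iff.2 hm
    have := norm_pos_iff.2 hm'
    positivity
  simp only [norm_mul]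
  refine mul_left_cancel₀ hc ?_
  set u := ‖expSum X Z Y η (-Complex.I * t)‖
  set u' := ‖expSum X' Z' Y' η' (-Complex.I * t)‖
  set w := ‖expSum X Y Z η (-Complex.I * t)‖
  set w' := ‖expSum X' Y' Z' η' (-Complex.I * t)‖
  set s := ‖((Real.exp (-t) : ℝ) : ℂ)‖
  linear_combination s * s * (‖m'‖ * t ^ d' * u' * e' - ‖m'‖ * t ^ d' * w' * e)

theorem omega_zpow_cube (W : ℤ) : (omega 3 ^ W) ^ 3 = 1 := by
  rw [← zpow_natCast, ← zpow_mul, mul_comm, zpow_mul, zpow_natCast, omega_cube, one_zpow]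

theorem omega_zpow_mul (W : ℤ) (r : ℕ) : omega 3 ^ (W * (r : ℤ)) = (omega 3 ^ W) ^ r := by
  rw [zpow_mul, zpow_natCast]

theorem exp_eq_wave_neg (r : ℕ) (ρ : ℂ) :
    Complex.exp (-Complex.I * omega 3 ^ r * ρ) = wave r (-ρ) := by
  rw [wave]; ring_nf

theorem exp_eq_wave (r : ℕ) (ρ : ℂ) :
    Complex.exp (Complex.I * omega 3 ^ r * ρ) = wave r ρ := rfl

theorem FormI.hasForm {Δ : ℂ → ℂ} (h : FormI Δ) : HasForm Δ 0 0 := by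
  obtain ⟨M, ⟨m, hm, d, -, -, hM⟩, h⟩ := h
  exact ⟨m, hm, d, 1, 1, one_pow 3, fun ρ => by simp [h, hM, expSum]⟩

theorem FormII.hasForm {Δ : ℂ → ℂ} (h : FormII Δ) : HasForm Δ 1 0 := by
  obtain ⟨M, ⟨m, hm, d, -, -, hM⟩, X, W, -, h⟩ := h
  exact ⟨m, hm, d, X, omega 3 ^ W, omega_zpow_cube W, fun ρ => by
    simp only [h, hM, expSum, omega_zpow_mul, exp_eq_wave, one_mul, zero_mul, add_zero]⟩

theorem FormIII.hasForm {Δ : ℂ → ℂ} (h : FormIII Δ) : HasForm Δ 0 1 := by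
  obtain ⟨M, ⟨m, hm, d, -, -, hM⟩, X, W, -, h⟩ := h
  exact ⟨m, hm, d, X, omega 3 ^ W, omega_zpow_cube W, fun ρ => by
    simp only [h, hM, expSum, omega_zpow_mul, exp_eq_wave_neg, one_mul, zero_mul, zero_add]⟩

theorem FormIV.hasForm {Δ : ℂ → ℂ} {Y : ℝ} (h : FormIV Δ Y) : HasForm Δ 1 Y := by
  obtain ⟨-, M, ⟨m, hm, d, -, -, hM⟩, X, W, -, h⟩ := h
  exact ⟨m, hm, d, X, omega 3 ^ W, omega_zpow_cube W, fun ρ => by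
    simp only [h, hM, expSum, omega_zpow_mul, exp_eq_wave_neg, exp_eq_wave, one_mul]⟩

namespace BoundaryConditions

variable {B : BoundaryConditions 3} {a : ℂ}

theorem hasForm (hB : B.NonRobin) (ha : a ≠ 0) :
    HasForm (B.charDet a) B.plusCoeff B.minusCoeff :=
  ⟨B.scale a, scale_ne_zero ha, B.degree, B.zeroCoeff, twist B.expo, twist_cube _,
    charDet_eq_expSum hB a⟩

theorem isMonomial {m : ℂ} (hm : m ≠ 0) (B : BoundaryConditions 3) :
    IsMonomial fun ρ => m * ρ ^ B.degree :=
  ⟨m, hm, B.degree, B.degree_bounds.1, B.degree_bounds.2, fun _ => rfl⟩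

theorem exists_twist_eq (B : BoundaryConditions 3) :
    ∃ W : ℤ, (W = -1 ∨ W = 0 ∨ W = 1) ∧ twist B.expo = omega 3 ^ W := by
  have h : twist B.expo = omega 3 ^ B.degree := by
    rw [twist, root, root, root, degree, pow_add, pow_add]
  have h3 := omega_cube
  have hinv : omega 3 ^ (-1 : ℤ) = omega 3 ^ 2 := by
    rw [zpow_neg_one]
    refine inv_eq_of_mul_eq_one_right ?_
    rw [← h3]; ring
  obtain ⟨h1, h5⟩ := B.degree_bounds
  rw [h]
  generalize B.degree = d at *
  interval_cases d
  · exact ⟨1, by simp, by simp⟩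
  · exact ⟨-1, by simp, hinv.symm⟩
  · exact ⟨0, by simp, by simp [h3]⟩
  · exact ⟨1, by simp, by rw [zpow_one]; linear_combination omega 3 * h3⟩
  · exact ⟨-1, by simp, by rw [hinv]; linear_combination omega 3 ^ 2 * h3⟩

theorem formI_iff (hB : B.NonRobin) (ha : a ≠ 0) :
    FormI (B.charDet a) ↔ B.plusCoeff = 0 ∧ B.minusCoeff = 0 := by
  constructor
  · intro h
    exact ⟨h.hasForm.eq_zero (hasForm hB ha) rfl,
      h.hasForm.comp_neg.eq_zero (hasForm hB ha).comp_neg rfl⟩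
  · rintro ⟨hZ, hY⟩
    refine ⟨_, isMonomial (mul_ne_zero (scale_ne_zero (B := B) ha) (zeroCoeff_ne_zero hB hZ hY)) B,
      fun ρ => ?_⟩
    rw [charDet_eq_expSum hB, hZ, hY]
    simp [expSum]
    ring

theorem formII_iff (hB : B.NonRobin) (ha : a ≠ 0) :
    FormII (B.charDet a) ↔ B.plusCoeff ≠ 0 ∧ B.minusCoeff = 0 := by
  constructor
  · intro h
    exact ⟨fun h0 => one_ne_zero ((hasForm hB ha).eq_zero h.hasForm h0),
      h.hasForm.comp_neg.eq_zero (hasForm hB ha).comp_neg rfl⟩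
  · rintro ⟨hZ, hY⟩
    obtain ⟨W, hW, hη⟩ := B.exists_twist_eq
    refine ⟨_, isMonomial (mul_ne_zero (scale_ne_zero (B := B) ha) hZ) B, B.zeroCoeff / B.plusCoeff, W, hW,
      fun ρ => ?_⟩
    rw [charDet_eq_expSum hB, hY, hη]
    simp only [expSum, omega_zpow_mul, exp_eq_wave, zero_mul, add_zero, Finset.sum_range_succ,
      Finset.sum_range_zero]
    field_simp
    ring

theorem formIII_iff (hB : B.NonRobin) (ha : a ≠ 0) :
    FormIII (B.charDet a) ↔ B.plusCoeff = 0 ∧ B.minusCoeff ≠ 0 := by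
  constructor
  · intro h
    exact ⟨h.hasForm.eq_zero (hasForm hB ha) rfl,
      fun h0 => one_ne_zero ((hasForm hB ha).comp_neg.eq_zero h.hasForm.comp_neg h0)⟩
  · rintro ⟨hZ, hY⟩
    obtain ⟨W, hW, hη⟩ := B.exists_twist_eq
    refine ⟨_, isMonomial (mul_ne_zero (scale_ne_zero (B := B) ha) hY) B, B.zeroCoeff / B.minusCoeff, W, hW,
      fun ρ => ?_⟩
    rw [charDet_eq_expSum hB, hZ, hη]
    simp only [expSum, omega_zpow_mul, exp_eq_wave_neg, zero_mul, zero_add, Finset.sum_range_succ,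
      Finset.sum_range_zero]
    field_simp

theorem formIV_imp (hB : B.NonRobin) (ha : a ≠ 0) {Y : ℝ} (h : FormIV (B.charDet a) Y) :
    B.plusCoeff ≠ 0 ∧ B.minusCoeff ≠ 0 ∧ ‖B.minusCoeff‖ = |Y| * ‖B.plusCoeff‖ := by
  have hY : (Y : ℂ) ≠ 0 := by exact_mod_cast h.1
  have h1 := h.hasForm
  have h2 := hasForm hB ha
  refine ⟨fun h0 => one_ne_zero (h2.eq_zero h1 h0),
    fun h0 => hY (h2.comp_neg.eq_zero h1.comp_neg h0), ?_⟩
  have := h2.norm_mul_norm h1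
  rwa [norm_one, mul_one, Complex.norm_real, Real.norm_eq_abs] at this

theorem exists_formIV_iff (hB : B.NonRobin) (ha : a ≠ 0) :
    (∃ Y : ℝ, FormIV (B.charDet a) Y) ↔ B.plusCoeff ≠ 0 ∧ B.minusCoeff ≠ 0 := by
  constructor
  · rintro ⟨Y, h⟩
    exact ⟨(formIV_imp hB ha h).1, (formIV_imp hB ha h).2.1⟩
  · rintro ⟨hZ, hY⟩
    have hZi : (B.plusCoeff.im : ℂ) ≠ 0 := fun h => hZ (by rw [plusCoeff_eq, h, zero_mul])
    have hYi : (B.minusCoeff.im : ℂ) ≠ 0 := fun h => hY (by rw [minusCoeff_eq, h, zero_mul])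
    obtain ⟨W, hW, hη⟩ := B.exists_twist_eq
    -- the quotient is real, as both coefficients are imaginary
    have hq : B.minusCoeff = ((B.minusCoeff.im / B.plusCoeff.im : ℝ) : ℂ) * B.plusCoeff := by
      conv_lhs => rw [minusCoeff_eq]
      conv_rhs => rw [plusCoeff_eq]
      push_cast
      simp only [Complex.mul_im, Complex.ofReal_re, Complex.ofReal_im, Complex.I_re, Complex.I_im,
        mul_one, mul_zero, add_zero]
      field_simp
    refine ⟨B.minusCoeff.im / B.plusCoeff.im, div_ne_zero (by exact_mod_cast hYi)
      (by exact_mod_cast hZi), _, isMonomial (mul_ne_zero (scale_ne_zero (B := B) ha) hZ) B,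
      B.zeroCoeff / B.plusCoeff, W, hW, fun ρ => ?_⟩
    rw [charDet_eq_expSum hB, hη]
    conv_lhs => rw [hq]
    simp only [expSum, omega_zpow_mul, exp_eq_wave_neg, exp_eq_wave, Finset.sum_range_succ,
      Finset.sum_range_zero]
    field_simp
    ring

end BoundaryConditions

end IBVP

end

theorem proposition3p2 (B : IBVP.BoundaryConditions 3) (hB : B.NonRobin)
    (a : ℂ) (ha : a = Complex.I ∨ a = -Complex.I) :
    -- the determinant has one of the four forms
    (IBVP.FormI (B.charDet a) ∨ IBVP.FormII (B.charDet a) ∨ IBVP.FormIII (B.charDet a) ∨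
      ∃ Y : ℝ, IBVP.FormIV (B.charDet a) Y) ∧
    -- the forms correspond to the classes
    (IBVP.FormI (B.charDet a) ↔ B.ClassI) ∧
    (IBVP.FormII (B.charDet a) ↔ B.ClassII) ∧
    (IBVP.FormIII (B.charDet a) ↔ B.ClassIII) ∧
    ((∃ Y : ℝ, IBVP.FormIV (B.charDet a) Y) ↔ (B.ClassIVa ∨ B.ClassIVb ∨ B.ClassIVc)) ∧
    (∀ Y : ℝ, IBVP.FormIV (B.charDet a) Y →
      (|Y| < 1 ↔ B.ClassIVa) ∧ (|Y| = 1 ↔ B.ClassIVb) ∧ (1 < |Y| ↔ B.ClassIVc)) := by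
  have ha0 : a ≠ 0 := by rcases ha with rfl | rfl <;> simp
  have hIV := fun Y : ℝ => IBVP.BoundaryConditions.formIV_imp (Y := Y) hB ha0
  simp only [IBVP.BoundaryConditions.ClassI, IBVP.BoundaryConditions.ClassII,
    IBVP.BoundaryConditions.ClassIII, IBVP.BoundaryConditions.ClassIVa,
    IBVP.BoundaryConditions.ClassIVb, IBVP.BoundaryConditions.ClassIVc,
    IBVP.BoundaryConditions.formI_iff hB ha0, IBVP.BoundaryConditions.formII_iff hB ha0,
    IBVP.BoundaryConditions.formIII_iff hB ha0, IBVP.BoundaryConditions.exists_formIV_iff hB ha0,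
    IBVP.BoundaryConditions.zeroBound_I_iff hB, IBVP.BoundaryConditions.zeroBound_neg_I_iff hB,
    IBVP.BoundaryConditions.wellConditioned_I_iff hB,
    IBVP.BoundaryConditions.wellConditioned_neg_I_iff hB]
  generalize B.plusCoeff = Z at *
  generalize B.minusCoeff = Y at *
  have hZ : Z ≠ 0 ↔ 0 < ‖Z‖ := norm_pos_iff.symm
  have hY : Y ≠ 0 ↔ 0 < ‖Y‖ := norm_pos_iff.symm
  refine ⟨by tauto, ⟨?_, by tauto⟩, ⟨?_, by tauto⟩, ⟨?_, by tauto⟩, ⟨?_, by tauto⟩, ?_⟩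
  · rintro ⟨rfl, rfl⟩
    simp
  · rintro ⟨h, rfl⟩
    simp [h]
  · rintro ⟨rfl, h⟩
    simp [h]
  · rintro ⟨h, h'⟩
    have := le_total ‖Y‖ ‖Z‖
    tauto
  · intro y hy
    obtain ⟨h1, h2, h3⟩ := hIV y hy
    have hpos := hZ.1 h1
    have e1 : ‖Y‖ ≤ ‖Z‖ ↔ |y| ≤ 1 := by rw [h3, mul_le_iff_le_one_left hpos]
    have e2 : ‖Z‖ ≤ ‖Y‖ ↔ 1 ≤ |y| := by rw [h3, le_mul_iff_one_le_left hpos]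
    rw [e1, e2]
    refine ⟨⟨fun h => ⟨⟨h.le, h.not_ge⟩, h1, h2⟩, fun h => not_le.1 h.1.2⟩,
      ⟨fun h => ⟨⟨h.le, h.ge⟩, h1, h2⟩, fun h => le_antisymm h.1.1 h.1.2⟩,
      ⟨fun h => ⟨⟨h.not_ge, h.le⟩, h1, h2⟩, fun h => not_le.1 h.1.1⟩⟩
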